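/- **Setting.** Fix a finite set $\mathsf{Tid}$ of threads, a set $\mathsf{Loc}$ of locations and a set $\mathsf{Val}$ of values with a distinguished element $0$. An *event label* is $\mathtt R(x,v_R)$, $\mathtt W(x,v_W)$ or $\mathtt{RMW}(x,v_R,v_W)$ with $x\in\mathsf{Loc}$ and $v_R,v_W\in\mathsf{Val}$. A *behavior* $\beta$ assigns to every thread a finite or infinite sequence of event labels. A finite or infinite sequence over $\mathsf{Tid}\times\{\text{event labels}\}$ induces the behavior that maps $\tau$ to the sequence of labels paired with $\tau$. **Operational side.** A *memory system* $\mathcal M$ is a labeled transition system with an initial state, observable labels $\tau{:}l$ ($\tau\in\mathsf{Tid}$, $l$ an event label) and a set of silent labels. A *run* is a finite or infinite sequence of consecutive transitions from the initial state. A run is *memory-fair* if it is finite, or for every silent label $\theta$ and index $k$ such that $\theta$ is enabled in the source of the $j$-th transition for all $j\ge k$, some $j$-th transition with $j\ge k$ has label $\theta$. $\mathrm{Beh}_{\mathrm{mf}}(\mathcal M)$ is the set of behaviors induced by the sequences of observable labels of memory-fair runs. The four systems are: - $\mathcal M_{\mathsf{SC}}$: the state is $M:\mathsf{Loc}\to\mathsf{Val}$,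 initially constantly $0$; there are no silent labels. $\mathtt W(x,v)$ sets $M(x):=v$; $\mathtt R(x,v)$ requires $M(x)=v$; $\mathtt{RMW}(x,v_R,v_W)$ performs $\mathtt R(x,v_R)$ and then $\mathtt W(x,v_W)$ atomically. - $\mathcal M_{\mathsf{TSO}}$: the state is a memory $M$, initially constantly $0$, and a FIFO buffer of pairs in $\mathsf{Loc}\times\mathsf{Val}$ per thread, initially empty. $\tau{:}\mathtt W(x,v)$ adds $(x,v)$ to the buffer of $\tau$; $\tau{:}\mathtt R(x,v)$ requires that $v$ is the value of $x$ after applying the buffer of $\tau$, oldest entry first, to $M$; $\tau{:}\mathtt{RMW}(x,v_R,v_W)$ requires an empty buffer of $\tau$ and $M(x)=v_R$, and sets $M(x):=v_W$. The silent label $\mathtt{prop}(\tau)$ removes the oldest entry of the buffer of $\tau$ and applies it to $M$. - $\mathcal M_{\mathsf{RA}}$: the state is a set $M$ of messages $\langle x,v,t,V\rangle$ (location, value, timestamp $t\in\mathbb N$, view $V:\mathsf{Loc}\to\mathbb N$) and a view $T(\tau)$ per thread. Initially $M=\{\langle x,0,0,\lambda y.0\rangle: x\in\mathsf{Loc}\}$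 and all views are $0$. $\tau{:}\mathtt W(x,v)$ picks $t>T(\tau)(x)$ not used by any message of $x$ in $M$, sets $T(\tau)(x):=t$ and adds $\langle x,v,t,T(\tau)\rangle$ (with the updated view) to $M$; $\tau{:}\mathtt R(x,v)$ picks $\langle x,v,t,V\rangle\in M$ with $T(\tau)(x)\le t$ and sets $T(\tau):=T(\tau)\sqcup V$ (pointwise maximum); $\tau{:}\mathtt{RMW}(x,v_R,v_W)$ performs $\mathtt R(x,v_R)$ and then $\mathtt W(x,v_W)$ atomically, where the write increases $T(\tau)(x)$ by exactly $1$. The silent label $\mathtt{prop}(\tau,m)$, enabled if $m\in M$ has location $x$ and timestamp $t>T(\tau)(x)$, sets $T(\tau)(x):=t$. - $\mathcal M_{\mathsf{StrongCOH}}$: as $\mathcal M_{\mathsf{RA}}$, except that reading $\langle x,v,t,V\rangle$ (also inside an $\mathtt{RMW}$) only sets $T(\tau)(x):=t$. **Declarative side.** An *event* is a triple of a serial number in $\mathbb N\cup\{\bot\}$, a thread in $\mathsf{Tid}\cup\{\bot\}$ and an event label. Let $\mathsf{Init}=\{\langle\bot,\bot,\mathtt W(x,0)\rangle:x\in\mathsf{Loc}\}$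 and $\mathsf{Event}(\beta)=\mathsf{Init}\cup\{\langle k,\tau,\beta(\tau)(k)\rangle:\tau\in\mathsf{Tid},\,k\in\mathrm{dom}(\beta(\tau))\}$. A set $E\supseteq\mathsf{Init}$ of events is *well-formed* if every event of $E\setminus\mathsf{Init}$ has thread and serial number different from $\bot$ and is determined in $E\setminus\mathsf{Init}$ by these two, and if, for every event of $E\setminus\mathsf{Init}$ with serial number $n$ and every $k<n$, $E$ contains an event of the same thread with serial number $k$. Let $\mathtt R$ (resp. $\mathtt W$) be the set of events labeled by a read (resp. write) or a read-modify-write, and $\mathtt{RMW}=\mathtt R\cap\mathtt W$. An *execution graph* $G=\langle E,\mathit{rf},\mathit{mo}\rangle$ consists of a well-formed set $E$; a relation $\mathit{rf}$ on $E$ that relates elements of $\mathtt W$ to elements of $\mathtt R$ with the same location such that the value written equals the value read, and in which every element of $E\cap\mathtt R$ has exactly one predecessor; and a relation $\mathit{mo}$ that is the disjoint union over $x\in\mathsf{Loc}$ of strict total orders on the elements of $E\cap\mathtt W$ with location $x$. Put - $\mathit{po}=\{(a,b)\in E^2: (a\in\mathsf{Init}\wedge b\notin\mathsf{Init})$, or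 $a,b$ are non-initialization events of the same thread and the serial number of $a$ is smaller than that of $b\}$; - $\mathit{fr}=(\mathit{rf}^{-1};\mathit{mo})\setminus\mathrm{id}_E$, $\ \mathit{rfe}=\mathit{rf}\setminus\mathit{po}$, $\ \mathit{ppo}=\mathit{po}\setminus((\mathtt W\setminus\mathtt{RMW})\times(\mathtt R\setminus\mathtt{RMW}))$, $\ \mathit{hb}=(\mathit{po}\cup\mathit{rf})^+$; and write $S|_{\mathtt{loc}}$ for the restriction of a relation $S$ to pairs of events with the same location. Then - $G\in\mathcal G_{\mathsf{SC}}$ iff $(\mathit{po}\cup\mathit{rf}\cup\mathit{mo}\cup\mathit{fr})^+$ is irreflexive; - $G\in\mathcal G_{\mathsf{TSO}}$ iff $(\mathit{ppo}\cup\mathit{rfe}\cup\mathit{mo}\cup\mathit{fr})^+$ and $(\mathit{po}|_{\mathtt{loc}}\cup\mathit{rf}\cup\mathit{mo}\cup\mathit{fr})^+$ are irreflexive; - $G\in\mathcal G_{\mathsf{RA}}$ iff $(\mathit{hb}|_{\mathtt{loc}}\cup\mathit{rf}\cup\mathit{mo}\cup\mathit{fr})^+$ is irreflexive; - $G\in\mathcal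 G_{\mathsf{StrongCOH}}$ iff $\mathit{hb}$ and $(\mathit{po}|_{\mathtt{loc}}\cup\mathit{rf}\cup\mathit{mo}\cup\mathit{fr})^+$ are irreflexive. $G$ is *fair* if $\mathit{mo}$ and $\mathit{fr}$ are prefix-finite, i.e. $\{a:(a,b)\in\mathit{mo}\}$ and $\{a:(a,b)\in\mathit{fr}\}$ are finite for every $b\in E$. Let $\mathcal G_X^{\mathtt{fair}}$ be the set of fair graphs in $\mathcal G_X$, and for a set $\mathcal G$ of execution graphs let $\mathrm{Beh}(\mathcal G)$ be the set of behaviors $\beta$ with $\mathsf{Event}(\beta)=E$ for some $\langle E,\mathit{rf},\mathit{mo}\rangle\in\mathcal G$. **Theorem.** For every $X\in\{\mathsf{SC},\mathsf{TSO},\mathsf{RA},\mathsf{StrongCOH}\}$, $$\mathrm{Beh}_{\mathrm{mf}}(\mathcal M_X)=\mathrm{Beh}(\mathcal G_X^{\mathtt{fair}}).$$ -/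

import Mathlib

namespace FairMM

universe u v w

/-! ### Sequences

A finite or infinite sequence is a `Stream'.Seq`; `s.get? k = some a` says that `k` is in the domain
of `s` and `s(k) = a`, and `s.Terminates` says that `s` is finite. -/

theorem exists_count_eq (P : ℕ → Prop) [DecidablePred P] (k : ℕ) :
    ∀ n, k < Nat.count P n → ∃ m, P m ∧ Nat.count P m = k := by
  intro n
  induction n with
  | zero => intro h; simp at h
  | succ n ih =>
    intro h
    by_cases hk : k < Nat.count P n
    · exact ih hk
    · rw [Nat.count_succ] at h
      by_cases hP : P n
      · refine ⟨n, hP, ?_⟩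
        simp [hP] at h
        omega
      · simp [hP] at h
        omega

/-- Index `n` of `s` carries an element that is kept by the partial function `f`. -/
def Kept {α : Type u} {β : Type v} (f : α → Option β) (s : Stream'.Seq α) (n : ℕ) : Prop :=
  ((s.get? n).bind f).isSome

open Classical in
/-- The subsequence of `s` formed by the elements on which the partial function `f` is defined,
mapped by `f`: its `k`-th element comes from the index `n` that is kept and has exactly `k` kept
indices before it (there is at most one such `n`). -/
noncomputable def subseq {α : Type u} {β : Type v} (f : α → Option β) (s : Stream'.Seq α) :
    Stream'.Seq β :=
  ⟨fun k => if h : ∃ n, Kept f s n ∧ Nat.count (Kept f s) n = k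
      then (s.get? h.choose).bind f else none, by
    intro k hk
    by_cases h : ∃ n, Kept f s n ∧ Nat.count (Kept f s) n = k
    · have h1 : Kept f s h.choose := h.choose_spec.1
      have h2 : (s.get? h.choose).bind f = none := by
        have hk' : (if h : ∃ n, Kept f s n ∧ Nat.count (Kept f s) n = k
          then (s.get? h.choose).bind f else none) = none := hk
        rwa [dif_pos h] at hk'
      have h3 : ((s.get? h.choose).bind f).isSome = true := h1
      exact absurd h3 (by simp [h2])
    · have h' : ¬ ∃ n, Kept f s n ∧ Nat.count (Kept f s) n = k + 1 := by
        rintro ⟨n, -, hn⟩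
        exact h (exists_count_eq (Kept f s) k n (by omega))
      exact dif_neg h'⟩

/-! ### Labeled transition systems -/

/-- An LTS with states `Q`, observable labels `Obs` and silent labels `Sil`. -/
structure LTS (Q : Type u) (Obs : Type v) (Sil : Type w) where
  init : Q
  step : Q → Obs ⊕ Sil → Q → Prop

/-- A triple source, label, target. -/
structure Transition (Q : Type u) (Obs : Type v) (Sil : Type w) where
  src : Q
  tlab : Obs ⊕ Sil
  tgt : Q

section LTS

variable {Q : Type u} {Obs : Type v} {Sil : Type w}

/-- The label `σ` is enabled in the state `q`. -/
def LTS.Enabled (A : LTS Q Obs Sil) (q : Q) (σ : Obs ⊕ Sil) : Prop :=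
  ∃ q', A.step q σ q'

/-- `μ` is a (finite or infinite) run of `A`. -/
structure LTS.IsRun (A : LTS Q Obs Sil) (μ : Stream'.Seq (Transition Q Obs Sil)) : Prop where
  trans : ∀ k t, μ.get? k = some t → A.step t.src t.tlab t.tgt
  start : ∀ t, μ.get? 0 = some t → t.src = A.init
  link : ∀ k t t', μ.get? k = some t → μ.get? (k + 1) = some t' → t.tgt = t'.src

/-- The trace induced by a run. -/
def trace (μ : Stream'.Seq (Transition Q Obs Sil)) : Stream'.Seq (Obs ⊕ Sil) :=
  μ.map Transition.tlab

/-- The observable trace induced by a run: the restriction of its trace to observable labels. -/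
noncomputable def obsTrace (μ : Stream'.Seq (Transition Q Obs Sil)) : Stream'.Seq Obs :=
  subseq Sum.getLeft? (trace μ)

/-- The silent label `θ` is continuously enabled in the infinite run `μ` at index `k`. -/
def LTS.ContEnabledAt (A : LTS Q Obs Sil) (μ : Stream'.Seq (Transition Q Obs Sil)) (θ : Sil)
    (k : ℕ) : Prop :=
  ∀ j, k ≤ j → ∃ t, μ.get? j = some t ∧ A.Enabled t.src (Sum.inr θ)

/-- Memory fairness of a run: it is finite, or every silent label that is continuously enabled at
some index `k` is taken at some index `j ≥ k`. -/
def LTS.MemoryFair (A : LTS Q Obs Sil) (μ : Stream'.Seq (Transition Q Obs Sil)) : Prop :=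
  μ.Terminates ∨
    ∀ (θ : Sil) (k : ℕ), A.ContEnabledAt μ θ k →
      ∃ j t, k ≤ j ∧ μ.get? j = some t ∧ t.tlab = Sum.inr θ

end LTS

/-! ### Event labels and behaviors -/

/-- Event labels: read `R(x, v_R)`, write `W(x, v_W)`, read-modify-write `RMW(x, v_R, v_W)`. -/
inductive ELab (Loc : Type u) (Val : Type v) where
  | read (x : Loc) (vR : Val)
  | write (x : Loc) (vW : Val)
  | rmw (x : Loc) (vR vW : Val)

section ELab

variable {Loc : Type u} {Val : Type v}

def ELab.loc : ELab Loc Val → Loc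
  | .read x _ => x
  | .write x _ => x
  | .rmw x _ _ => x

def ELab.valR : ELab Loc Val → Option Val
  | .read _ vR => some vR
  | .write _ _ => none
  | .rmw _ vR _ => some vR

def ELab.valW : ELab Loc Val → Option Val
  | .read _ _ => none
  | .write _ vW => some vW
  | .rmw _ _ vW => some vW

/-- The label is a read or a read-modify-write. -/
def ELab.IsR : ELab Loc Val → Prop
  | .read _ _ => True
  | .write _ _ => False
  | .rmw _ _ _ => True

/-- The label is a write or a read-modify-write. -/
def ELab.IsW : ELab Loc Val → Prop
  | .read _ _ => False
  | .write _ _ => True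
  | .rmw _ _ _ => True

/-- The label is a read-modify-write. -/
def ELab.IsRMW : ELab Loc Val → Prop
  | .read _ _ => False
  | .write _ _ => False
  | .rmw _ _ _ => True

end ELab

/-- A behavior assigns a finite or infinite sequence of event labels to every thread. -/
abbrev Behavior (Tid : Type w) (Loc : Type u) (Val : Type v) :=
  Tid → Stream'.Seq (ELab Loc Val)

/-- The behavior induced by a concurrent trace. -/
noncomputable def behOf {Tid : Type w} {Loc : Type u} {Val : Type v} [DecidableEq Tid]
    (ρ : Stream'.Seq (Tid × ELab Loc Val)) : Behavior Tid Loc Val :=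
  fun τ => subseq (fun σ => if σ.1 = τ then some σ.2 else none) ρ

/-- The memory-fair behaviors of a memory system. -/
def BehMF {Tid : Type*} {Loc : Type*} {Val : Type*} {Q : Type*} {Sil : Type*} [DecidableEq Tid]
    (A : LTS Q (Tid × ELab Loc Val) Sil) : Set (Behavior Tid Loc Val) :=
  {β | ∃ μ, A.IsRun μ ∧ A.MemoryFair μ ∧ β = behOf (obsTrace μ)}

/-! ### Operational memory systems -/

section Operational

variable {Tid : Type w} {Loc : Type u} {Val : Type v} [DecidableEq Loc]

/-! #### Sequential consistency -/

def scRead (x : Loc) (a : Val) (M M' : Loc → Val) : Prop :=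
  M x = a ∧ M' = M

def scWrite (x : Loc) (a : Val) (M M' : Loc → Val) : Prop :=
  M' = Function.update M x a

def scStep (M : Loc → Val) : (Tid × ELab Loc Val) ⊕ Empty → (Loc → Val) → Prop
  | .inl (_, .write x a), M' => scWrite x a M M'
  | .inl (_, .read x a), M' => scRead x a M M'
  | .inl (_, .rmw x vR vW), M' => ∃ M₁, scRead x vR M M₁ ∧ scWrite x vW M₁ M'
  | .inr _, _ => False

variable (Tid Loc Val) in
/-- The memory system for SC. -/
def memSC [Zero Val] : LTS (Loc → Val) (Tid × ELab Loc Val) Empty where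
  init := fun _ => 0
  step := scStep

/-! #### Total store order -/

/-- A memory and, for every thread, a store buffer (newest entry at the head of the list). -/
structure TSOState (Tid : Type w) (Loc : Type u) (Val : Type v) where
  mem : Loc → Val
  buf : Tid → List (Loc × Val)

/-- The memory obtained by applying all the entries of a buffer, oldest first. -/
def applyBuffer (M : Loc → Val) (b : List (Loc × Val)) : Loc → Val :=
  b.foldr (fun p M' => Function.update M' p.1 p.2) M

/-- The silent label `τ` stands for `prop(τ)`. -/
def tsoStep [DecidableEq Tid] (q : TSOState Tid Loc Val) :
    (Tid × ELab Loc Val) ⊕ Tid → TSOState Tid Loc Val → Prop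
  | .inl (τ, .write x a), q' => q' = ⟨q.mem, Function.update q.buf τ ((x, a) :: q.buf τ)⟩
  | .inl (τ, .read x a), q' => applyBuffer q.mem (q.buf τ) x = a ∧ q' = q
  | .inl (τ, .rmw x vR vW), q' =>
      q.buf τ = [] ∧ q.mem x = vR ∧ q' = ⟨Function.update q.mem x vW, q.buf⟩
  | .inr τ, q' => ∃ (b : List (Loc × Val)) (x : Loc) (a : Val), q.buf τ = b ++ [(x, a)] ∧
      q' = ⟨Function.update q.mem x a, Function.update q.buf τ b⟩

variable (Tid Loc Val) in
/-- The memory system for TSO. -/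
def memTSO [DecidableEq Tid] [Zero Val] : LTS (TSOState Tid Loc Val) (Tid × ELab Loc Val) Tid where
  init := ⟨fun _ => 0, fun _ => []⟩
  step := tsoStep

/-! #### Release/acquire and strong coherence -/

/-- Views assign a timestamp to every location; `⊔` on views is the pointwise maximum. -/
abbrev View (Loc : Type u) := Loc → ℕ

structure Msg (Loc : Type u) (Val : Type v) where
  loc : Loc
  val : Val
  ts : ℕ
  view : View Loc

/-- A set of messages and, for every thread, its view. -/
structure VState (Tid : Type w) (Loc : Type u) (Val : Type v) where
  mem : Set (Msg Loc Val)
  tview : Tid → View Loc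

section

variable [DecidableEq Tid]

def viewWrite (τ : Tid) (x : Loc) (a : Val) (q q' : VState Tid Loc Val) : Prop :=
  ∃ t : ℕ, (¬ ∃ m ∈ q.mem, m.loc = x ∧ m.ts = t) ∧ q.tview τ x < t ∧
    q'.tview = Function.update q.tview τ (Function.update (q.tview τ) x t) ∧
    q'.mem = q.mem ∪ {⟨x, a, t, q'.tview τ⟩}

/-- A read step; `upd V m` is the view of a thread with view `V` after it has read the message `m`.
-/
def viewRead (upd : View Loc → Msg Loc Val → View Loc) (τ : Tid) (x : Loc) (a : Val)
    (q q' : VState Tid Loc Val) : Prop :=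
  ∃ m ∈ q.mem, m.loc = x ∧ m.val = a ∧ q.tview τ x ≤ m.ts ∧
    q' = ⟨q.mem, Function.update q.tview τ (upd (q.tview τ) m)⟩

/-- The silent label `(τ, m)` stands for `prop(τ, m)`. -/
def viewStep (upd : View Loc → Msg Loc Val → View Loc) (q : VState Tid Loc Val) :
    (Tid × ELab Loc Val) ⊕ (Tid × Msg Loc Val) → VState Tid Loc Val → Prop
  | .inl (τ, .write x a), q' => viewWrite τ x a q q'
  | .inl (τ, .read x a), q' => viewRead upd τ x a q q'
  | .inl (τ, .rmw x vR vW), q' => ∃ q₁, viewRead upd τ x vR q q₁ ∧ viewWrite τ x vW q₁ q' ∧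
      q'.tview τ x = q₁.tview τ x + 1
  | .inr (τ, m), q' => m ∈ q.mem ∧ q.tview τ m.loc < m.ts ∧
      q' = ⟨q.mem, Function.update q.tview τ (Function.update (q.tview τ) m.loc m.ts)⟩

/-- Initially there is one message `⟨x : 0 @ 0, V₀⟩` for every location, and all views are `V₀`. -/
def viewInit [Zero Val] : VState Tid Loc Val where
  mem := {m | ∃ x : Loc, m = ⟨x, 0, 0, fun _ => 0⟩}
  tview := fun _ _ => 0

variable (Tid Loc Val) in
/-- The memory system for RA: a read joins the view of the message into the view of the thread. -/
def memRA [Zero Val] : LTS (VState Tid Loc Val) (Tid × ELab Loc Val) (Tid × Msg Loc Val) where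
  init := viewInit
  step := viewStep (fun V m => V ⊔ m.view)

variable (Tid Loc Val) in
/-- The memory system for StrongCOH: a read only records the timestamp of the message. -/
def memStrongCOH [Zero Val] :
    LTS (VState Tid Loc Val) (Tid × ELab Loc Val) (Tid × Msg Loc Val) where
  init := viewInit
  step := viewStep (fun V m => Function.update V m.loc m.ts)

end

end Operational

/-! ### Events and execution graphs -/

/-- Events; the value `none` of the serial number and of the thread identifier stands for `⊥`. -/
@[ext]
structure Event (Tid : Type w) (Loc : Type u) (Val : Type v) where
  sn : Option ℕ
  tid : Option Tid
  lab : ELab Loc Val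

section Events

variable {Tid : Type w} {Loc : Type u} {Val : Type v}

abbrev Event.loc (e : Event Tid Loc Val) : Loc := e.lab.loc
abbrev Event.valR (e : Event Tid Loc Val) : Option Val := e.lab.valR
abbrev Event.valW (e : Event Tid Loc Val) : Option Val := e.lab.valW
abbrev Event.IsR (e : Event Tid Loc Val) : Prop := e.lab.IsR
abbrev Event.IsW (e : Event Tid Loc Val) : Prop := e.lab.IsW
abbrev Event.IsRMW (e : Event Tid Loc Val) : Prop := e.lab.IsRMW

variable (Tid Loc Val) in
/-- The set of initialization events. -/
def Init [Zero Val] : Set (Event Tid Loc Val) :=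
  {e | ∃ x : Loc, e = ⟨none, none, .write x 0⟩}

/-- Sequenced-before. -/
def seqBefore [Zero Val] (e₁ e₂ : Event Tid Loc Val) : Prop :=
  (e₁ ∈ Init Tid Loc Val ∧ e₂ ∉ Init Tid Loc Val) ∨
    (e₁.tid = e₂.tid ∧ ∃ k₁ k₂ : ℕ, e₁.sn = some k₁ ∧ e₂.sn = some k₂ ∧ k₁ < k₂)

/-- The set of events extracted from a behavior. -/
def eventsOf [Zero Val] (β : Behavior Tid Loc Val) : Set (Event Tid Loc Val) :=
  Init Tid Loc Val ∪ {e | ∃ τ k l, (β τ).get? k = some l ∧ e = ⟨some k, some τ, l⟩}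

/-- Well-formed sets of events. -/
structure WellFormed [Zero Val] (E : Set (Event Tid Loc Val)) : Prop where
  init_subset : Init Tid Loc Val ⊆ E
  ne_bot : ∀ e ∈ E \ Init Tid Loc Val, e.tid ≠ none ∧ e.sn ≠ none
  inj : ∀ e₁ ∈ E \ Init Tid Loc Val, ∀ e₂ ∈ E \ Init Tid Loc Val,
    e₁.tid = e₂.tid → e₁.sn = e₂.sn → e₁ = e₂
  downward : ∀ e ∈ E \ Init Tid Loc Val, ∀ n k : ℕ, e.sn = some n → k < n →
    ∃ l, (⟨some k, e.tid, l⟩ : Event Tid Loc Val) ∈ E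

end Events

/-- Execution graphs. The modification order `mo` is the disjoint union of its restrictions to the
writes to each location, and each restriction is a strict total order. -/
structure EGraph (Tid : Type w) (Loc : Type u) (Val : Type v) [Zero Val] where
  E : Set (Event Tid Loc Val)
  rf : Event Tid Loc Val → Event Tid Loc Val → Prop
  mo : Event Tid Loc Val → Event Tid Loc Val → Prop
  wf : WellFormed E
  rf_mem : ∀ e r, rf e r → e ∈ E ∧ r ∈ E
  rf_match : ∀ e r, rf e r → e.IsW ∧ r.IsR ∧ e.loc = r.loc ∧ e.valW = r.valR
  rf_functional : ∀ e₁ e₂ r, rf e₁ r → rf e₂ r → e₁ = e₂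
  rf_total : ∀ r ∈ E, r.IsR → ∃ e, rf e r
  mo_mem : ∀ a b, mo a b → a ∈ E ∧ b ∈ E
  mo_match : ∀ a b, mo a b → a.IsW ∧ b.IsW ∧ a.loc = b.loc
  mo_irrefl : ∀ a, ¬ mo a a
  mo_trans : ∀ a b c, mo a b → mo b c → mo a c
  mo_total : ∀ a ∈ E, ∀ b ∈ E, a.IsW → b.IsW → a.loc = b.loc → a ≠ b → mo a b ∨ mo b a

/-- The relation `R` on the set `A` is prefix-finite. -/
def PrefixFinite {α : Type*} (A : Set α) (R : α → α → Prop) : Prop :=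
  ∀ b ∈ A, {a | R a b}.Finite

/-- The transitive closure of `R` is irreflexive. -/
def ClosureIrrefl {α : Type*} (R : α → α → Prop) : Prop :=
  ∀ a, ¬ Relation.TransGen R a a

namespace EGraph

variable {Tid : Type w} {Loc : Type u} {Val : Type v} [Zero Val] (G : EGraph Tid Loc Val)

/-- Program order. -/
def po (a b : Event Tid Loc Val) : Prop :=
  a ∈ G.E ∧ b ∈ G.E ∧ seqBefore a b

/-- From-read: `(rf⁻¹ ; mo) \ [E]`. -/
def fr (a b : Event Tid Loc Val) : Prop :=
  (∃ e, G.rf e a ∧ G.mo e b) ∧ ¬ (a = b ∧ a ∈ G.E)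

/-- External reads-from. -/
def rfe (a b : Event Tid Loc Val) : Prop :=
  G.rf a b ∧ ¬ G.po a b

/-- Preserved program order. -/
def ppo (a b : Event Tid Loc Val) : Prop :=
  G.po a b ∧ ¬ ((a.IsW ∧ ¬ a.IsRMW) ∧ (b.IsR ∧ ¬ b.IsRMW))

/-- RA-happens-before `(po ∪ rf)⁺`. -/
def hbRA : Event Tid Loc Val → Event Tid Loc Val → Prop :=
  Relation.TransGen fun a b => G.po a b ∨ G.rf a b

/-- `(po ∪ rf ∪ mo ∪ fr)⁺` is irreflexive. -/
def ConsistentSC : Prop :=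
  ClosureIrrefl fun a b => G.po a b ∨ G.rf a b ∨ G.mo a b ∨ G.fr a b

/-- SC per location: `(po|loc ∪ rf ∪ mo ∪ fr)⁺` is irreflexive. -/
def SCPerLoc : Prop :=
  ClosureIrrefl fun a b => (G.po a b ∧ a.loc = b.loc) ∨ G.rf a b ∨ G.mo a b ∨ G.fr a b

/-- `(ppo ∪ rfe ∪ mo ∪ fr)⁺` is irreflexive, and SC per location. -/
def ConsistentTSO : Prop :=
  (ClosureIrrefl fun a b => G.ppo a b ∨ G.rfe a b ∨ G.mo a b ∨ G.fr a b) ∧ G.SCPerLoc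

/-- `(hbRA|loc ∪ rf ∪ mo ∪ fr)⁺` is irreflexive. -/
def ConsistentRA : Prop :=
  ClosureIrrefl fun a b => (G.hbRA a b ∧ a.loc = b.loc) ∨ G.rf a b ∨ G.mo a b ∨ G.fr a b

/-- `hbRA` is irreflexive, and SC per location. -/
def ConsistentStrongCOH : Prop :=
  (∀ a, ¬ G.hbRA a a) ∧ G.SCPerLoc

/-- Fair execution graphs. -/
def Fair : Prop :=
  PrefixFinite G.E G.mo ∧ PrefixFinite G.E G.fr

end EGraph

section Declarative

variable (Tid : Type w) (Loc : Type u) (Val : Type v) [Zero Val]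

/-- The declarative memory systems, as sets of execution graphs. -/
def graphsSC : Set (EGraph Tid Loc Val) := {G | G.ConsistentSC}
def graphsTSO : Set (EGraph Tid Loc Val) := {G | G.ConsistentTSO}
def graphsRA : Set (EGraph Tid Loc Val) := {G | G.ConsistentRA}
def graphsStrongCOH : Set (EGraph Tid Loc Val) := {G | G.ConsistentStrongCOH}

/-- The fair execution graphs. -/
def graphsFair : Set (EGraph Tid Loc Val) := {G | G.Fair}

end Declarative

/-- The behaviors allowed by a declarative memory system. -/
def BehDecl {Tid : Type*} {Loc : Type*} {Val : Type*} [Zero Val] (𝒢 : Set (EGraph Tid Loc Val)) :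
    Set (Behavior Tid Loc Val) :=
  {β | ∃ G ∈ 𝒢, eventsOf β = G.E}

end FairMM

namespace FairMM

/-! ### Subsequences -/

section Subseq

open Classical

variable {α : Type*} {β : Type*} {γ : Type*}

/-! A memory-fair run and a fair consistent graph both describe an ordering of the events in type ω;
each inclusion recovers one description from the other. The link is a schedule, which assigns a
natural number to every event. `mem_BehMF_iff` first replaces runs by infinite runs with stuttering
steps, and `exists_schedule` and `Schedule.isBehavior` translate between behaviors of such runs and
schedules of the event set.

From runs to graphs, `mo` is read off a numerical key: execution time for SC, commit time for TSO,
timestamp for the view-based systems. The source of a read is the write whose value it obtained.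
Consistency holds because every edge of the relevant relation increases the key, or else weakly
increases it while execution time increases. The relation `mo` is prefix-finite because the key is a
natural number and injective at each location. Prefix-finiteness of `fr` says that only finitely
many reads miss a given write. Under SC this is immediate. Under TSO it holds because every buffered
write commits: memory fairness ensures this in an infinite run, and a finite run is extended by
flushing its buffers (`tso_exists_strongly_fair`, `tso_exists_commitTimes`). In the view-based
systems memory fairness eventually raises the view of each of the finitely many threads to the
timestamp of the write (`view_exists_bound`).

From graphs to runs, an acyclic relation that contains enough of the program order of finitely many
threads is well-founded, and if every event has finitely many immediate predecessors, it extends to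
an enumeration in type ω (`wellFounded_of_closureIrrefl`, `exists_enumeration`). For SC the
enumeration is the run. For TSO it is the order of commits, and the executions of writes are
inserted early enough to respect program order (`EGraph.exists_commitTimes`). For RA and StrongCOH
only happens-before is enumerated, and the timestamp of a write is the number of its
`mo`-predecessors, finite by fairness. The invariant `ViewInv` says that no view ever excludes an
event still to come. Propagation steps are interleaved, each one waiting until the finitely many
`mo`- and `fr`-predecessors of its write have been executed (`ViewPlan.mem_behMF`). -/

theorem count_eq_unique {P : ℕ → Prop} [DecidablePred P] {m n : ℕ} (hm : P m) (hn : P n)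
    (h : Nat.count P m = Nat.count P n) : m = n :=
  Nat.count_injective hm hn h

theorem lt_of_count_lt {P : ℕ → Prop} [DecidablePred P] {m n : ℕ}
    (h : Nat.count P m < Nat.count P n) : m < n := by
  by_contra hc
  exact absurd (Nat.count_monotone P (not_lt.1 hc)) (not_le.2 h)

theorem subseq_get?_iff (f : α → Option β) (s : Stream'.Seq α) (k : ℕ) (b : β) :
    (subseq f s).get? k = some b ↔
      ∃ n, Nat.count (Kept f s) n = k ∧ (s.get? n).bind f = some b := by
  have hget : (subseq f s).get? k = if h : ∃ n, Kept f s n ∧ Nat.count (Kept f s) n = k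
      then (s.get? h.choose).bind f else none := rfl
  rw [hget]
  constructor
  · intro h
    split_ifs at h with h'
    exact ⟨_, h'.choose_spec.2, h⟩
  · rintro ⟨n, hn, hb⟩
    have hK : Kept f s n := by simp [Kept, hb]
    have h' : ∃ n, Kept f s n ∧ Nat.count (Kept f s) n = k := ⟨n, hK, hn⟩
    rw [dif_pos h']
    have : h'.choose = n :=
      count_eq_unique h'.choose_spec.1 hK (h'.choose_spec.2.trans hn.symm)
    rw [this, hb]

theorem subseq_get?_count (f : α → Option β) (s : Stream'.Seq α) (n : ℕ) (h : Kept f s n) :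
    (subseq f s).get? (Nat.count (Kept f s) n) = (s.get? n).bind f := by
  obtain ⟨b, hb⟩ := Option.isSome_iff_exists.1 h
  rw [hb, subseq_get?_iff]
  exact ⟨n, rfl, hb⟩

theorem seq_ext_some {s t : Stream'.Seq α} (h : ∀ n a, s.get? n = some a ↔ t.get? n = some a) :
    s = t :=
  Stream'.Seq.ext fun n => Option.ext fun a => h n a

/-- Ranks compose: an index survives the composite exactly if it is kept by `f` and its rank among
those is kept by `g`, so both sides advance at the same indices. -/
theorem count_kept_bind (f : α → Option β) (g : β → Option γ) (s : Stream'.Seq α) (n : ℕ) :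
    Nat.count (Kept (fun a => (f a).bind g) s) n =
      Nat.count (Kept g (subseq f s)) (Nat.count (Kept f s) n) := by
  induction n with
  | zero => simp
  | succ n ih =>
    rw [Nat.count_succ, ih]
    by_cases h : Kept f s n
    · rw [Nat.count_succ (Kept f s), if_pos h, Nat.count_succ (Kept g (subseq f s))]
      have : Kept g (subseq f s) (Nat.count (Kept f s) n) ↔ Kept (fun a => (f a).bind g) s n := by
        change (((subseq f s).get? (Nat.count (Kept f s) n)).bind g).isSome = true ↔
          ((s.get? n).bind fun a => (f a).bind g).isSome = true
        rw [subseq_get?_count f s n h, Option.bind_assoc]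
      simp only [this]
    · rw [Nat.count_succ (Kept f s), if_neg h]
      have : ¬ Kept (fun a => (f a).bind g) s n := by
        intro hk
        apply h
        unfold Kept at hk ⊢
        rw [← Option.bind_assoc] at hk
        cases hb : (s.get? n).bind f <;> simp_all
      rw [if_neg this]
      rfl

theorem subseq_subseq (f : α → Option β) (g : β → Option γ) (s : Stream'.Seq α) :
    subseq g (subseq f s) = subseq (fun a => (f a).bind g) s := by
  refine seq_ext_some fun k c => ?_
  simp only [subseq_get?_iff]
  constructor
  · rintro ⟨j, hj, hc⟩
    obtain ⟨b, hb, hbc⟩ := Option.bind_eq_some_iff.1 hc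
    obtain ⟨n, hn, hnb⟩ := (subseq_get?_iff _ _ _ _).1 hb
    refine ⟨n, ?_, ?_⟩
    · rw [count_kept_bind, hn, hj]
    · rw [← Option.bind_assoc, hnb]
      exact hbc
  · rintro ⟨n, hn, hc⟩
    rw [← Option.bind_assoc] at hc
    have hK : Kept f s n := by
      unfold Kept
      cases hb : (s.get? n).bind f <;> simp_all
    refine ⟨Nat.count (Kept f s) n, ?_, ?_⟩
    · rw [← count_kept_bind, hn]
    · rw [subseq_get?_count f s n hK, hc]

theorem count_of_initial {P : ℕ → Prop} [DecidablePred P] {n : ℕ} (h : ∀ m, m < n → P m) :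
    Nat.count P n = n := by
  rw [Nat.count_iff_forall]
  intro m hm
  exact h m hm

theorem map_eq_subseq (h : α → β) (s : Stream'.Seq α) :
    s.map h = subseq (fun a => some (h a)) s := by
  refine seq_ext_some fun k b => ?_
  rw [subseq_get?_iff, Stream'.Seq.map_get?]
  -- A total function keeps the whole domain, which is an initial segment of ℕ, so rank and index
  -- agree.
  have key : ∀ n b, s.get? n = some b → Nat.count (Kept (fun a => some (h a)) s) n = n := by
    intro n b hn
    refine count_of_initial fun m hm => ?_
    obtain ⟨c, hc⟩ := Stream'.Seq.ge_stable s hm.le hn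
    simp [Kept, hc]
  constructor
  · intro hk
    obtain ⟨a, ha, rfl⟩ := Option.map_eq_some_iff.1 hk
    exact ⟨k, key k a ha, by simp [ha]⟩
  · rintro ⟨n, hn, hb⟩
    obtain ⟨a, ha, hab⟩ := Option.bind_eq_some_iff.1 hb
    rw [key n a ha] at hn
    subst hn
    simpa [ha] using hab

end Subseq

/-! ### Runs with stuttering -/

section Stutter

variable {Q : Type*} {Obs : Type*} {Sil : Type*}

/-- A transition that may also be a stuttering step. -/
def LTS.StepOpt (A : LTS Q Obs Sil) (q : Q) : Option (Obs ⊕ Sil) → Q → Prop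
  | none, q' => q' = q
  | some σ, q' => A.step q σ q'

/-- An infinite run in which stuttering steps, labeled `none`, are allowed. -/
structure LTS.StutterRun (A : LTS Q Obs Sil) (q : ℕ → Q) (l : ℕ → Option (Obs ⊕ Sil)) : Prop where
  start : q 0 = A.init
  step : ∀ n, A.StepOpt (q n) (l n) (q (n + 1))

/-- Memory fairness of a run with stuttering. -/
def LTS.StutterFair (A : LTS Q Obs Sil) (q : ℕ → Q) (l : ℕ → Option (Obs ⊕ Sil)) : Prop :=
  (∃ N, ∀ n, N ≤ n → l n = none) ∨
    ∀ (θ : Sil) (k : ℕ), (∀ j, k ≤ j → A.Enabled (q j) (Sum.inr θ)) →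
      ∃ j, k ≤ j ∧ l j = some (Sum.inr θ)

/-- Dependent choice. `I` is an invariant of the states; `C` records what each step must do, and the
behavior and the fairness of the run are later read off from it. -/
theorem LTS.exists_stutterRun (A : LTS Q Obs Sil) (I : ℕ → Q → Prop)
    (C : ℕ → Q → Option (Obs ⊕ Sil) → Q → Prop) (h0 : I 0 A.init)
    (hs : ∀ n q, I n q → ∃ o q', C n q o q' ∧ A.StepOpt q o q' ∧ I (n + 1) q') :
    ∃ q l, A.StutterRun q l ∧ (∀ n, I n (q n)) ∧ ∀ n, C n (q n) (l n) (q (n + 1)) := by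
  choose o nxt hC hstep hI using hs
  let x : (n : ℕ) → {q // I n q} := fun n =>
    Nat.rec ⟨A.init, h0⟩ (fun n q => ⟨nxt n q.1 q.2, hI n q.1 q.2⟩) n
  refine ⟨fun n => (x n).1, fun n => o n (x n).1 (x n).2, ⟨rfl, fun n => hstep n _ _⟩,
    fun n => (x n).2, fun n => hC n _ _⟩

open Classical in
theorem LTS.StutterRun.state_eq {A : LTS Q Obs Sil} {q : ℕ → Q} {l : ℕ → Option (Obs ⊕ Sil)}
    (h : A.StutterRun q l) {n m : ℕ} (hnm : n ≤ m)
    (hc : Nat.count (fun k => (l k).isSome) n = Nat.count (fun k => (l k).isSome) m) :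
    q m = q n := by
  induction m, hnm using Nat.le_induction with
  | base => rfl
  | succ m hm ih =>
    have h1 := Nat.count_monotone (fun k => (l k).isSome = true) hm
    rw [Nat.count_succ] at hc
    have hl : ¬ (l m).isSome = true := by
      intro hl
      rw [if_pos hl] at hc
      omega
    rw [if_neg hl] at hc
    rw [← ih hc]
    have := h.step m
    have hn : l m = none := by simpa using hl
    rw [hn] at this
    exact this

/-- The sequence of the (optional) transitions of a run with stuttering. -/
def transSeq (q : ℕ → Q) (l : ℕ → Option (Obs ⊕ Sil)) :
    Stream'.Seq (Option (Transition Q Obs Sil)) :=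
  ⟨fun n => some ((l n).map fun σ => ⟨q n, σ, q (n + 1)⟩), fun h => by cases h⟩

theorem transSeq_get? (q : ℕ → Q) (l : ℕ → Option (Obs ⊕ Sil)) (n : ℕ) :
    (transSeq q l).get? n = some ((l n).map fun σ => ⟨q n, σ, q (n + 1)⟩) := rfl

/-- The run obtained by removing the stuttering steps. -/
noncomputable def compress (q : ℕ → Q) (l : ℕ → Option (Obs ⊕ Sil)) :
    Stream'.Seq (Transition Q Obs Sil) :=
  subseq id (transSeq q l)

theorem kept_transSeq (q : ℕ → Q) (l : ℕ → Option (Obs ⊕ Sil)) :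
    Kept id (transSeq q l) = fun n => (l n).isSome = true := by
  funext n
  simp [Kept, transSeq_get?]

open Classical in
theorem compress_get?_iff (q : ℕ → Q) (l : ℕ → Option (Obs ⊕ Sil)) (k : ℕ)
    (t : Transition Q Obs Sil) :
    (compress q l).get? k = some t ↔
      ∃ n, Nat.count (fun n => (l n).isSome) n = k ∧ l n = some t.tlab ∧
        t.src = q n ∧ t.tgt = q (n + 1) := by
  unfold compress
  rw [subseq_get?_iff]
  simp only [kept_transSeq, transSeq_get?]
  refine exists_congr fun n => and_congr Iff.rfl ?_
  obtain ⟨a, b, c⟩ := t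
  cases hl : l n
  · simp
  · simp
    tauto

theorem LTS.StutterRun.isRun_compress {A : LTS Q Obs Sil} {q : ℕ → Q}
    {l : ℕ → Option (Obs ⊕ Sil)} (h : A.StutterRun q l) : A.IsRun (compress q l) := by
  classical
  constructor
  · intro k t ht
    obtain ⟨n, -, hl, h1, h2⟩ := (compress_get?_iff _ _ _ _).1 ht
    have := h.step n
    rw [hl] at this
    rw [h1, h2]
    exact this
  · intro t ht
    obtain ⟨n, hn, hl, h1, h2⟩ := (compress_get?_iff _ _ _ _).1 ht
    rw [h1, ← h.start]
    exact h.state_eq (Nat.zero_le _) (by simpa using hn.symm)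
  · intro k t t' ht ht'
    obtain ⟨n, hn, hl, h1, h2⟩ := (compress_get?_iff _ _ _ _).1 ht
    obtain ⟨n', hn', hl', h1', h2'⟩ := (compress_get?_iff _ _ _ _).1 ht'
    rw [h2, h1']
    have hlt : n < n' := lt_of_count_lt (P := fun n => (l n).isSome) (by rw [hn, hn']; omega)
    refine (h.state_eq hlt ?_).symm
    rw [Nat.count_succ, hn, hn', if_pos (by simp [hl])]

/-- If the compressed run is infinite, every state `q n` is the source of the next genuine
transition. Hence a silent label continuously enabled after compression was already continuously
enabled in the run with stuttering. -/
theorem LTS.StutterRun.memoryFair_compress {A : LTS Q Obs Sil} {q : ℕ → Q}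
    {l : ℕ → Option (Obs ⊕ Sil)} (h : A.StutterRun q l) (hf : A.StutterFair q l) :
    A.MemoryFair (compress q l) := by
  classical
  by_cases ht : (compress q l).Terminates
  · exact Or.inl ht
  have hinf : ∀ k, ∃ t, (compress q l).get? k = some t := by
    intro k
    by_contra hc
    apply ht
    refine ⟨k, ?_⟩
    cases hg : (compress q l).get? k with
    | none => exact hg
    | some t => exact absurd ⟨t, hg⟩ hc
  have hnext : ∀ n, ∃ n' t, n ≤ n' ∧
      (compress q l).get? (Nat.count (fun n => (l n).isSome) n) = some t ∧ t.src = q n ∧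
      l n' = some t.tlab := by
    intro n
    obtain ⟨t, ht⟩ := hinf (Nat.count (fun n => (l n).isSome) n)
    obtain ⟨n', hn', hl, h1, h2⟩ := (compress_get?_iff _ _ _ _).1 ht
    have hle : n ≤ n' := by
      by_contra hc
      have h3 := Nat.count_monotone (fun n => (l n).isSome = true) (show n' + 1 ≤ n by omega)
      rw [Nat.count_succ, if_pos (by simp [hl])] at h3
      omega
    exact ⟨n', t, hle, ht, by rw [h1, h.state_eq hle hn'.symm], hl⟩
  refine Or.inr fun θ k hk => ?_
  rcases hf with ⟨N, hN⟩ | hf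
  · obtain ⟨n', t, hle, -, -, hl⟩ := hnext N
    rw [hN n' hle] at hl
    cases hl
  obtain ⟨t, ht⟩ := hinf k
  obtain ⟨n, hn, hl, h1, h2⟩ := (compress_get?_iff _ _ _ _).1 ht
  obtain ⟨j, hj, hlj⟩ := hf θ n (by
    intro j hj
    obtain ⟨n', t, hle, hg, hs, -⟩ := hnext j
    obtain ⟨t', ht', he⟩ := hk (Nat.count (fun n => (l n).isSome) j) (by
      rw [← hn]; exact Nat.count_monotone _ hj)
    rw [hg] at ht'
    cases ht'
    rwa [← hs])
  refine ⟨Nat.count (fun n => (l n).isSome) j, ⟨q j, Sum.inr θ, q (j + 1)⟩, ?_, ?_, rfl⟩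
  · rw [← hn]; exact Nat.count_monotone _ hj
  · rw [compress_get?_iff]
    exact ⟨j, rfl, hlj, rfl, rfl⟩

/-- The states visited by a run, repeating the last one if the run is finite. -/
def statesOf (A : LTS Q Obs Sil) (μ : Stream'.Seq (Transition Q Obs Sil)) : ℕ → Q
  | 0 => A.init
  | n + 1 => match μ.get? n with
    | some t => t.tgt
    | none => statesOf A μ n

/-- The labels of a run. -/
def labelsOf (μ : Stream'.Seq (Transition Q Obs Sil)) (n : ℕ) : Option (Obs ⊕ Sil) :=
  (μ.get? n).map Transition.tlab

theorem LTS.IsRun.src_eq {A : LTS Q Obs Sil} {μ : Stream'.Seq (Transition Q Obs Sil)}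
    (h : A.IsRun μ) (n : ℕ) (t : Transition Q Obs Sil) (ht : μ.get? n = some t) :
    t.src = statesOf A μ n := by
  cases n with
  | zero => exact h.start t ht
  | succ n =>
    obtain ⟨t', ht'⟩ := Stream'.Seq.ge_stable μ (Nat.le_succ n) ht
    rw [← h.link n t' t ht' ht]
    simp [statesOf, ht']

theorem LTS.IsRun.stutterRun {A : LTS Q Obs Sil} {μ : Stream'.Seq (Transition Q Obs Sil)}
    (h : A.IsRun μ) : A.StutterRun (statesOf A μ) (labelsOf μ) := by
  refine ⟨rfl, fun n => ?_⟩
  cases ht : μ.get? n with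
  | none => simp [labelsOf, ht, statesOf, LTS.StepOpt]
  | some t =>
    have h1 := h.trans n t ht
    rw [h.src_eq n t ht] at h1
    simpa [labelsOf, ht, statesOf, LTS.StepOpt] using h1

theorem LTS.IsRun.stutterFair {A : LTS Q Obs Sil} {μ : Stream'.Seq (Transition Q Obs Sil)}
    (h : A.IsRun μ) (hf : A.MemoryFair μ) : A.StutterFair (statesOf A μ) (labelsOf μ) := by
  by_cases ht : μ.Terminates
  · obtain ⟨N, hN⟩ := ht
    refine Or.inl ⟨N, fun n hn => ?_⟩
    have : μ.get? n = none := Stream'.Seq.le_stable μ hn hN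
    simp [labelsOf, this]
  have hinf : ∀ k, ∃ t, μ.get? k = some t := by
    intro k
    by_contra hc
    apply ht
    refine ⟨k, ?_⟩
    cases hg : μ.get? k with
    | none => exact hg
    | some t => exact absurd ⟨t, hg⟩ hc
  rcases hf with hf | hf
  · exact absurd hf ht
  refine Or.inr fun θ k hk => ?_
  obtain ⟨j, t, hj, hjt, hl⟩ := hf θ k (by
    intro j hj
    obtain ⟨t, ht⟩ := hinf j
    exact ⟨t, ht, by rw [h.src_eq j t ht]; exact hk j hj⟩)
  exact ⟨j, hj, by simp [labelsOf, hjt, hl]⟩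

end Stutter

/-! ### Behaviors of runs with stuttering -/

section StutterBeh

variable {Tid : Type*} {Loc : Type*} {Val : Type*} {Q : Type*} {Sil : Type*}

/-- The label is an observable label of the thread `τ`. -/
def OfThread (l : ℕ → Option ((Tid × ELab Loc Val) ⊕ Sil)) (τ : Tid) (n : ℕ) : Prop :=
  ∃ a, l n = some (Sum.inl (τ, a))

open Classical in
/-- `β` is the behavior induced by the labels `l`. -/
def IsBehavior (l : ℕ → Option ((Tid × ELab Loc Val) ⊕ Sil)) (β : Behavior Tid Loc Val) : Prop :=
  ∀ τ k a, (β τ).get? k = some a ↔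
    ∃ n, Nat.count (OfThread l τ) n = k ∧ l n = some (Sum.inl (τ, a))

theorem IsBehavior.unique {l : ℕ → Option ((Tid × ELab Loc Val) ⊕ Sil)}
    {β β' : Behavior Tid Loc Val} (h : IsBehavior l β) (h' : IsBehavior l β') : β = β' := by
  funext τ
  refine seq_ext_some fun k a => ?_
  rw [h, h']

variable [DecidableEq Tid]

/-- The behavior of a run, compressed or not, is an iterated subsequence. Composing the filters
leaves one partial function, which is the case treated here. -/
theorem isBehavior_subseq {α : Type*} (l : ℕ → Option ((Tid × ELab Loc Val) ⊕ Sil))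
    (s : Stream'.Seq α) (f : α → Option ((Tid × ELab Loc Val) ⊕ Sil))
    (h : ∀ n, (s.get? n).bind f = l n) :
    IsBehavior l (fun τ => subseq (fun a => ((f a).bind Sum.getLeft?).bind
      fun σ => if σ.1 = τ then some σ.2 else none) s) := by
  intro τ k a
  have key : ∀ n a, ((s.get? n).bind fun a => ((f a).bind Sum.getLeft?).bind
      fun σ => if σ.1 = τ then some σ.2 else none) = some a ↔ l n = some (Sum.inl (τ, a)) := by
    intro n a
    rw [← Option.bind_assoc, ← Option.bind_assoc, h]
    rcases l n with _ | ⟨⟨τ', b⟩⟩ | θ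
    · simp
    · by_cases hτ : τ' = τ <;> simp [hτ]
    · simp
  rw [subseq_get?_iff]
  have hK : Kept (fun a => ((f a).bind Sum.getLeft?).bind
      fun σ => if σ.1 = τ then some σ.2 else none) s = OfThread l τ := by
    funext n
    unfold Kept OfThread
    rw [Option.isSome_iff_exists]
    simp only [key]
  simp only [key]
  rw [hK]

theorem isBehavior_labelsOf (μ : Stream'.Seq (Transition Q (Tid × ELab Loc Val) Sil)) :
    IsBehavior (labelsOf μ) (behOf (obsTrace μ)) := by
  have h := isBehavior_subseq (labelsOf μ) μ (fun t => some t.tlab) (by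
    intro n
    unfold labelsOf
    cases μ.get? n <;> rfl)
  convert h using 1
  funext τ
  unfold behOf obsTrace trace
  rw [map_eq_subseq, subseq_subseq, subseq_subseq]
  rfl

theorem isBehavior_compress (q : ℕ → Q) (l : ℕ → Option ((Tid × ELab Loc Val) ⊕ Sil)) :
    IsBehavior l (behOf (obsTrace (compress q l))) := by
  have h := isBehavior_subseq l (transSeq q l) (fun o => o.bind fun t => some t.tlab) (by
    intro n
    rw [transSeq_get?]
    cases l n <;> rfl)
  convert h using 1
  funext τ
  unfold behOf obsTrace trace compress
  rw [map_eq_subseq, subseq_subseq, subseq_subseq, subseq_subseq]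
  simp only [Option.bind_assoc, id]

/-- The interface to the definition of behaviors: all later arguments use states and optional labels
indexed by ℕ, and neither compression nor observable traces occur again. -/
theorem mem_BehMF_iff (A : LTS Q (Tid × ELab Loc Val) Sil) (β : Behavior Tid Loc Val) :
    β ∈ BehMF A ↔ ∃ q l, A.StutterRun q l ∧ A.StutterFair q l ∧ IsBehavior l β := by
  constructor
  · rintro ⟨μ, h, hf, rfl⟩
    exact ⟨_, _, h.stutterRun, h.stutterFair hf, isBehavior_labelsOf μ⟩
  · rintro ⟨q, l, h, hf, hb⟩
    exact ⟨compress q l, h.isRun_compress, h.memoryFair_compress hf,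
      hb.unique (isBehavior_compress q l)⟩

end StutterBeh

/-! ### Acyclicity and enumeration of events -/

section Order

variable {α : Type*} {R : α → α → Prop}

theorem closureIrrefl_of_measure (m : α → ℕ) (h : ∀ a b, R a b → m a < m b) : ClosureIrrefl R := by
  have key : ∀ a b, Relation.TransGen R a b → m a < m b := by
    intro a b hab
    induction hab with
    | single h1 => exact h _ _ h1
    | tail _ h1 ih => exact ih.trans (h _ _ h1)
  exact fun a ha => lt_irrefl _ (key a a ha)

/-- Meant for relations in which `rf` and same-location program order increase the key `κ` only
weakly; execution time `T` then breaks the tie. When `κ` increases strictly, `T` may change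
arbitrarily. -/
theorem closureIrrefl_of_lex (κ T : α → ℕ)
    (h : ∀ a b, R a b → κ a < κ b ∨ (κ a ≤ κ b ∧ T a < T b)) : ClosureIrrefl R := by
  have key : ∀ a b, Relation.TransGen R a b → κ a < κ b ∨ (κ a ≤ κ b ∧ T a < T b) := by
    intro a b hab
    induction hab with
    | single h1 => exact h _ _ h1
    | tail _ h1 ih =>
      have := h _ _ h1
      omega
  intro a ha
  have := key a a ha
  omega

theorem ClosureIrrefl.mono {R' : α → α → Prop} (h : ClosureIrrefl R) (hR : ∀ a b, R' a b → R a b) :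
    ClosureIrrefl R' :=
  fun a ha => h a (Relation.TransGen.mono hR a a ha)

/-- An acyclic relation that contains the orders of finitely many sequences which cover the type is
well-founded. -/
theorem wellFounded_of_closureIrrefl {ι : Type*} [Finite ι] (c : α → ι) (s : α → ℕ)
    (hinj : ∀ a b, c a = c b → s a = s b → a = b) (hlt : ∀ a b, c a = c b → s a < s b → R a b)
    (h : ClosureIrrefl R) : WellFounded R := by
  rw [wellFounded_iff_isEmpty_descending_chain]
  refine ⟨fun ⟨g, hg⟩ => ?_⟩
  have hdesc : ∀ i j, i < j → Relation.TransGen R (g j) (g i) := by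
    intro i j hij
    induction j, hij using Nat.le_induction with
    | base => exact .single (hg i)
    | succ j _ ih => exact .head (hg j) ih
  -- A descending chain meets one of the finitely many sequences infinitely often. Its visit with
  -- the least position, compared with a later visit, closes a cycle.
  obtain ⟨y, hy⟩ := Finite.exists_infinite_fiber (fun n => c (g n))
  have hy' : ((fun n => c (g n)) ⁻¹' {y}).Infinite := Set.infinite_coe_iff.1 hy
  obtain ⟨i, hi, hmin⟩ := WellFounded.has_min (measure fun n => s (g n)).wf
    ((fun n => c (g n)) ⁻¹' {y}) hy'.nonempty
  obtain ⟨j, hj, hij⟩ := hy'.exists_gt i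
  have hc : c (g i) = c (g j) := by
    rw [Set.mem_preimage, Set.mem_singleton_iff] at hi hj
    rw [hi, hj]
  have hle : s (g i) ≤ s (g j) := not_lt.1 (hmin j hj)
  rcases hle.eq_or_lt with he | hl
  · have := hdesc i j hij
    rw [hinj _ _ hc he] at this
    exact h _ this
  · exact h _ ((hdesc i j hij).tail (hlt _ _ hc hl))

/-- A countable type with a well-founded relation under which every element has finitely many
predecessors can be enumerated in an order compatible with the relation. -/
theorem exists_enumeration [Countable α] (hwf : WellFounded R) (hfin : ∀ b, {a | R a b}.Finite) :
    ∃ f : α → ℕ, Function.Injective f ∧ ∀ a b, R a b → f a < f b := by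
  obtain ⟨c, hc⟩ := exists_injective_nat α
  have hD : ∀ b, {a | Relation.ReflTransGen R a b}.Finite := by
    intro b
    induction b using hwf.induction with
    | _ b ih =>
      have : {a | Relation.ReflTransGen R a b} ⊆
          {b} ∪ ⋃ a ∈ {a | R a b}, {d | Relation.ReflTransGen R d a} := by
        intro a ha
        rcases Relation.ReflTransGen.cases_tail ha with rfl | ⟨d, had, hdb⟩
        · exact Or.inl rfl
        · refine Or.inr ?_
          simp only [Set.mem_iUnion]
          exact ⟨d, hdb, had⟩
      exact ((Set.finite_singleton b).union ((hfin b).biUnion fun a ha => ih a ha)).subset this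
  let D : α → Finset α := fun b => (hD b).toFinset
  have hmem : ∀ a b, a ∈ D b ↔ Relation.ReflTransGen R a b := fun a b => by simp [D]
  have hirr : ∀ a, ¬ Relation.TransGen R a a := fun a ha => hwf.transGen.irrefl.irrefl a ha
  -- The binary code of the finite down-set of `b`. Equal codes give equal down-sets, hence equal
  -- elements by acyclicity; a strictly larger down-set has a larger code.
  refine ⟨fun b => ∑ a ∈ D b, 2 ^ c a, ?_, ?_⟩
  · intro a b hab
    have h1 : (D a).map ⟨c, hc⟩ = (D b).map ⟨c, hc⟩ := by
      apply Finset.geomSum_injective (n := 2) le_rfl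
      simpa [Finset.sum_map] using hab
    have h2 : D a = D b := Finset.map_injective _ h1
    have ha : Relation.ReflTransGen R a b := by
      rw [← hmem, ← h2, hmem]
    have hb : Relation.ReflTransGen R b a := by
      rw [← hmem, h2, hmem]
    rcases Relation.reflTransGen_iff_eq_or_transGen.1 ha with h | h
    · exact h.symm
    · exact absurd (Relation.TransGen.trans_left h hb) (hirr a)
  · intro a b hab
    apply Finset.sum_lt_sum_of_subset (i := b)
    · intro d hd
      rw [hmem] at hd ⊢
      exact hd.tail hab
    · rw [hmem]
    · rw [hmem]
      intro h
      exact hirr b (Relation.TransGen.tail' h hab)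
    · positivity
    · intros
      positivity

end Order

/-! ### Events -/

section EventLemmas

variable {Tid : Type*} {Loc : Type*} {Val : Type*}

theorem ELab.isW_iff (a : ELab Loc Val) : a.IsW ↔ ∃ v, a.valW = some v := by
  cases a <;> simp [ELab.IsW, ELab.valW]

theorem ELab.isRMW_iff (a : ELab Loc Val) : a.IsRMW ↔ a.IsR ∧ a.IsW := by
  cases a <;> simp [ELab.IsR, ELab.IsW, ELab.IsRMW]

theorem ELab.isR_or_isW (a : ELab Loc Val) : a.IsR ∨ a.IsW := by
  cases a <;> simp [ELab.IsR, ELab.IsW]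

variable [Zero Val]

theorem isW_of_mem_Init {e : Event Tid Loc Val} (h : e ∈ Init Tid Loc Val) : e.IsW := by
  obtain ⟨x, rfl⟩ := h
  trivial

theorem not_isR_of_mem_Init {e : Event Tid Loc Val} (h : e ∈ Init Tid Loc Val) : ¬ e.IsR := by
  obtain ⟨x, rfl⟩ := h
  exact id

theorem valW_of_mem_Init {e : Event Tid Loc Val} (h : e ∈ Init Tid Loc Val) :
    e.valW = some 0 := by
  obtain ⟨x, rfl⟩ := h
  rfl

theorem tid_of_mem_Init {e : Event Tid Loc Val} (h : e ∈ Init Tid Loc Val) : e.tid = none := by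
  obtain ⟨x, rfl⟩ := h
  rfl

theorem eq_of_mem_Init {a b : Event Tid Loc Val} (ha : a ∈ Init Tid Loc Val)
    (hb : b ∈ Init Tid Loc Val) (h : a.loc = b.loc) : a = b := by
  obtain ⟨x, rfl⟩ := ha
  obtain ⟨y, rfl⟩ := hb
  simp only [Event.loc, ELab.loc] at h
  rw [h]

theorem notMem_Init_of_tid {e : Event Tid Loc Val} {τ : Tid} (h : e.tid = some τ) :
    e ∉ Init Tid Loc Val := by
  rintro ⟨x, rfl⟩
  cases h

theorem mem_eventsOf_iff {β : Behavior Tid Loc Val} {e : Event Tid Loc Val}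
    (he : e ∉ Init Tid Loc Val) :
    e ∈ eventsOf β ↔ ∃ τ k, e.tid = some τ ∧ e.sn = some k ∧ (β τ).get? k = some e.lab := by
  constructor
  · rintro (h | ⟨τ, k, l, h, rfl⟩)
    · exact absurd h he
    · exact ⟨τ, k, rfl, rfl, h⟩
  · rintro ⟨τ, k, h1, h2, h⟩
    refine Or.inr ⟨τ, k, e.lab, h, ?_⟩
    ext1 <;> simp [h1, h2]

theorem wellFormed_eventsOf (β : Behavior Tid Loc Val) : WellFormed (eventsOf β) := by
  refine ⟨fun e he => Or.inl he, ?_, ?_, ?_⟩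
  · rintro e ⟨he, hi⟩
    obtain ⟨τ, k, h1, h2, -⟩ := (mem_eventsOf_iff hi).1 he
    simp [h1, h2]
  · rintro e₁ ⟨he₁, hi₁⟩ e₂ ⟨he₂, hi₂⟩ ht hs
    obtain ⟨τ, k, h1, h2, h3⟩ := (mem_eventsOf_iff hi₁).1 he₁
    obtain ⟨τ', k', h1', h2', h3'⟩ := (mem_eventsOf_iff hi₂).1 he₂
    have : τ = τ' := by rw [ht, h1'] at h1; exact (Option.some.inj h1).symm
    subst this
    have : k = k' := by rw [hs, h2'] at h2; exact (Option.some.inj h2).symm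
    subst this
    rw [h3] at h3'
    ext1
    · exact hs
    · exact ht
    · exact Option.some.inj h3'
  · rintro e ⟨he, hi⟩ n k hn hk
    obtain ⟨τ, k', h1, h2, h3⟩ := (mem_eventsOf_iff hi).1 he
    rw [hn] at h2
    cases h2
    obtain ⟨l, hl⟩ := Stream'.Seq.ge_stable (β τ) hk.le h3
    exact ⟨l, Or.inr ⟨τ, k, l, hl, by rw [h1]⟩⟩

/-- `e` is an event of `E` that is not an initialization event. -/
def Proper (E : Set (Event Tid Loc Val)) (e : Event Tid Loc Val) : Prop :=
  e ∈ E ∧ e ∉ Init Tid Loc Val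

theorem seqBefore.not_init {a b : Event Tid Loc Val} (h : seqBefore a b) :
    b ∉ Init Tid Loc Val := by
  rcases h with h | ⟨-, k, k', -, h, -⟩
  · exact h.2
  · rintro ⟨x, rfl⟩
    cases h

theorem WellFormed.seqBefore_iff {E : Set (Event Tid Loc Val)} {a b : Event Tid Loc Val}
    (ha : Proper E a) :
    seqBefore a b ↔ a.tid = b.tid ∧ ∃ k k' : ℕ, a.sn = some k ∧ b.sn = some k' ∧ k < k' := by
  constructor
  · rintro (h | h)
    · exact absurd h.1 ha.2
    · exact h
  · exact Or.inr

theorem WellFormed.exists_tid_sn {E : Set (Event Tid Loc Val)} (hE : WellFormed E)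
    {e : Event Tid Loc Val} (he : Proper E e) : ∃ τ k, e.tid = some τ ∧ e.sn = some k := by
  obtain ⟨h1, h2⟩ := hE.ne_bot e he
  obtain ⟨τ, hτ⟩ := Option.ne_none_iff_exists'.1 h1
  obtain ⟨k, hk⟩ := Option.ne_none_iff_exists'.1 h2
  exact ⟨τ, k, hτ, hk⟩

theorem WellFormed.seqBefore_trichotomy {E : Set (Event Tid Loc Val)} (hE : WellFormed E)
    {a b : Event Tid Loc Val} (ha : Proper E a) (hb : Proper E b) (h : a.tid = b.tid) :
    seqBefore a b ∨ a = b ∨ seqBefore b a := by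
  obtain ⟨τ, k, h1, h2⟩ := hE.exists_tid_sn ha
  obtain ⟨τ', k', h1', h2'⟩ := hE.exists_tid_sn hb
  rcases lt_trichotomy k k' with hk | hk | hk
  · exact Or.inl (Or.inr ⟨h, k, k', h2, h2', hk⟩)
  · exact Or.inr (Or.inl (hE.inj a ha b hb h (by rw [h2, h2', hk])))
  · exact Or.inr (Or.inr (Or.inr ⟨h.symm, k', k, h2', h2, hk⟩))

theorem seqBefore.trans {a b c : Event Tid Loc Val} (h : seqBefore a b) (h' : seqBefore b c) :
    seqBefore a c := by
  rcases h with h | ⟨ht, k, k', hk, hk', hlt⟩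
  · exact Or.inl ⟨h.1, h'.not_init⟩
  · rcases h' with h' | ⟨ht', j, j', hj, hj', hlt'⟩
    · obtain ⟨x, rfl⟩ := h'.1
      cases hk'
    · rw [hk'] at hj
      cases hj
      exact Or.inr ⟨ht.trans ht', k, j', hk, hj', hlt.trans hlt'⟩

/-! ### Schedules -/

/-- `T` assigns to the events of `E` their position in a total execution order compatible with the
order of each thread; initialization events get position `0`. -/
structure Schedule (E : Set (Event Tid Loc Val)) (T : Event Tid Loc Val → ℕ) : Prop where
  init : ∀ e ∈ Init Tid Loc Val, T e = 0
  pos : ∀ e, Proper E e → 0 < T e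
  inj : ∀ a b, Proper E a → Proper E b → T a = T b → a = b
  mono : ∀ a b, a ∈ E → b ∈ E → seqBefore a b → T a < T b

/-- The optional label `o` of step `n` is observable iff some event is scheduled for this step, and
then it is the label of this event. -/
def ObsSpec {Sil : Type*} (E : Set (Event Tid Loc Val)) (T : Event Tid Loc Val → ℕ) (n : ℕ)
    (o : Option ((Tid × ELab Loc Val) ⊕ Sil)) : Prop :=
  ∀ τ a, o = some (Sum.inl (τ, a)) ↔
    ∃ e, Proper E e ∧ T e = n + 1 ∧ e.tid = some τ ∧ e.lab = a

section Sched

variable {E : Set (Event Tid Loc Val)} {T : Event Tid Loc Val → ℕ}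

theorem Schedule.lt_of_same_thread (hE : WellFormed E) (h : Schedule E T)
    {a b : Event Tid Loc Val} (ha : Proper E a) (hb : Proper E b) (ht : a.tid = b.tid)
    (hlt : T a < T b) : seqBefore a b := by
  rcases hE.seqBefore_trichotomy ha hb ht with h1 | rfl | h1
  · exact h1
  · exact absurd hlt (lt_irrefl _)
  · exact absurd (h.mono b a hb.1 ha.1 h1) (by omega)

theorem Schedule.proper_of_pos (h : Schedule E T) {a : Event Tid Loc Val} (ha : a ∈ E)
    (hp : 0 < T a) : Proper E a :=
  ⟨ha, fun hi => by rw [h.init a hi] at hp; exact lt_irrefl _ hp⟩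

/-- Initialization events all share position `0`, so outside the proper events injectivity needs the
location. -/
theorem Schedule.inj_loc (h : Schedule E T) {a b : Event Tid Loc Val} (ha : a ∈ E) (hb : b ∈ E)
    (hl : a.loc = b.loc) (hT : T a = T b) : a = b := by
  by_cases hi : a ∈ Init Tid Loc Val
  · by_cases hj : b ∈ Init Tid Loc Val
    · exact eq_of_mem_Init hi hj hl
    · have := h.pos b ⟨hb, hj⟩
      rw [h.init a hi] at hT
      omega
  · have h1 := h.pos a ⟨ha, hi⟩
    exact h.inj a b ⟨ha, hi⟩ (h.proper_of_pos hb (by omega)) hT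

theorem Schedule.finite_le (h : Schedule E T) (N : ℕ) : {e | Proper E e ∧ T e ≤ N}.Finite := by
  refine Set.Finite.of_finite_image (f := T) ((Set.finite_le_nat N).subset ?_) ?_
  · rintro _ ⟨e, he, rfl⟩
    exact he.2
  · intro a ha b hb hab
    exact h.inj a b ha.1 hb.1 hab

theorem ObsSpec.of_event {Sil : Type*} {n : ℕ} (h : Schedule E T) {e : Event Tid Loc Val}
    {τ : Tid} (he : Proper E e) (hT : T e = n + 1)
    (hτ : e.tid = some τ) : ObsSpec E T n (some (Sum.inl (τ, e.lab)) :
      Option ((Tid × ELab Loc Val) ⊕ Sil)) := by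
  intro τ' a
  constructor
  · rintro h
    cases h
    exact ⟨e, he, hT, hτ, rfl⟩
  · rintro ⟨e', he', hT', hτ', rfl⟩
    obtain rfl := h.inj e e' he he' (hT.trans hT'.symm)
    rw [hτ] at hτ'
    cases hτ'
    rfl

theorem ObsSpec.of_no_event {Sil : Type*} {n : ℕ} {o : Option ((Tid × ELab Loc Val) ⊕ Sil)}
    (ho : ∀ σ, o ≠ some (Sum.inl σ)) (h : ∀ e, Proper E e → T e ≠ n + 1) : ObsSpec E T n o := by
  intro τ a
  constructor
  · intro h'
    exact absurd h' (ho _)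
  · rintro ⟨e', he', hT', -⟩
    exact absurd hT' (h e' he')

end Sched

/-- The event with serial number `k` of a thread is executed at the step `n` that emits the `k`-th
label of this thread. Its position is `n + 1`, since `0` is reserved for initialization events. -/
theorem exists_schedule {Sil : Type*} {l : ℕ → Option ((Tid × ELab Loc Val) ⊕ Sil)}
    {β : Behavior Tid Loc Val} (h : IsBehavior l β) :
    ∃ T, Schedule (eventsOf β) T ∧ ∀ n, ObsSpec (eventsOf β) T n (l n) := by
  classical
  have hex : ∀ e : Event Tid Loc Val, ∃ t : ℕ, (e ∈ Init Tid Loc Val → t = 0) ∧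
      (Proper (eventsOf β) e → ∃ n τ, t = n + 1 ∧ e.tid = some τ ∧
        e.sn = some (Nat.count (OfThread l τ) n) ∧ l n = some (Sum.inl (τ, e.lab))) := by
    intro e
    by_cases hi : e ∈ Init Tid Loc Val
    · exact ⟨0, fun _ => rfl, fun he => absurd hi he.2⟩
    · by_cases he : e ∈ eventsOf β
      · obtain ⟨τ, k, h1, h2, h3⟩ := (mem_eventsOf_iff hi).1 he
        obtain ⟨n, hn, hl⟩ := (h τ k e.lab).1 h3
        exact ⟨n + 1, fun hi' => absurd hi' hi, fun _ => ⟨n, τ, rfl, h1, by rw [hn, h2], hl⟩⟩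
      · exact ⟨0, fun _ => rfl, fun he' => absurd he'.1 he⟩
  choose T hT0 hT using hex
  have hsch : Schedule (eventsOf β) T := by
    refine ⟨hT0, ?_, ?_, ?_⟩
    · intro e he
      obtain ⟨n, τ, hn, -⟩ := hT e he
      omega
    · intro a b ha hb hab
      obtain ⟨n, τ, hn, h1, h2, h3⟩ := hT a ha
      obtain ⟨n', τ', hn', h1', h2', h3'⟩ := hT b hb
      have : n = n' := by omega
      subst this
      rw [h3] at h3'
      simp only [Option.some.injEq, Sum.inl.injEq, Prod.mk.injEq] at h3'
      obtain ⟨rfl, h4⟩ := h3'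
      ext1
      · rw [h2, h2']
      · rw [h1, h1']
      · exact h4
    · intro a b ha hb hab
      have hb' : Proper (eventsOf β) b := ⟨hb, hab.not_init⟩
      obtain ⟨n', τ', hn', h1', h2', h3'⟩ := hT b hb'
      by_cases hi : a ∈ Init Tid Loc Val
      · rw [hT0 a hi]
        omega
      · have ha' : Proper (eventsOf β) a := ⟨ha, hi⟩
        obtain ⟨n, τ, hn, h1, h2, h3⟩ := hT a ha'
        obtain ⟨ht, k, k', hk, hk', hlt⟩ := (WellFormed.seqBefore_iff ha').1 hab
        rw [h1, h1'] at ht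
        cases ht
        rw [h2] at hk
        rw [h2'] at hk'
        cases hk
        cases hk'
        have := lt_of_count_lt hlt
        omega
  refine ⟨T, hsch, fun n τ a => ⟨?_, ?_⟩⟩
  · intro hl
    have hg := (h τ _ a).2 ⟨n, rfl, hl⟩
    have he : Proper (eventsOf β) ⟨some (Nat.count (OfThread l τ) n), some τ, a⟩ :=
      ⟨Or.inr ⟨τ, _, a, hg, rfl⟩, notMem_Init_of_tid rfl⟩
    refine ⟨_, he, ?_, rfl, rfl⟩
    obtain ⟨n', τ', hn', h1', h2', h3'⟩ := hT _ he
    cases h1'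
    have := count_eq_unique ⟨a, hl⟩ ⟨_, h3'⟩ (Option.some.inj h2')
    omega
  · rintro ⟨e, he, hn, ht, rfl⟩
    obtain ⟨n', τ', hn', h1', h2', h3'⟩ := hT e he
    rw [ht] at h1'
    cases h1'
    have : n = n' := by omega
    rw [this, h3']

/-- The earlier steps of the thread are exactly those of the events with serial numbers below `k`:
these exist by downward closure and have distinct positions because the schedule respects program
order. -/
theorem Schedule.count_eq {Sil : Type*} {l : ℕ → Option ((Tid × ELab Loc Val) ⊕ Sil)}
    {E : Set (Event Tid Loc Val)} {T : Event Tid Loc Val → ℕ} [∀ τ, DecidablePred (OfThread l τ)]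
    (hE : WellFormed E) (h : Schedule E T) (hl : ∀ n, ObsSpec E T n (l n))
    (e : Event Tid Loc Val) (he : Proper E e) (τ : Tid) (k n : ℕ) (hτ : e.tid = some τ)
    (hk : e.sn = some k) (hn : T e = n + 1) : Nat.count (OfThread l τ) n = k := by
  have hex : ∀ j, j < k → ∃ e', Proper E e' ∧ e'.tid = some τ ∧ e'.sn = some j := by
    intro j hj
    obtain ⟨a, ha⟩ := hE.downward e he k j hk hj
    rw [hτ] at ha
    exact ⟨_, ⟨ha, notMem_Init_of_tid rfl⟩, rfl, rfl⟩
  have : Nonempty (Event Tid Loc Val) := ⟨e⟩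
  choose! ev hev1 hev2 hev3 using hex
  have hmono : ∀ i j, i < j → j < k → T (ev i) < T (ev j) := by
    intro i j hij hj
    exact h.mono _ _ (hev1 i (hij.trans hj)).1 (hev1 j hj).1
      (Or.inr ⟨by rw [hev2 i (hij.trans hj), hev2 j hj], i, j,
        hev3 i (hij.trans hj), hev3 j hj, hij⟩)
  rw [Nat.count_eq_card_filter_range]
  have : Finset.filter (OfThread l τ) (Finset.range n) =
      (Finset.range k).image fun j => T (ev j) - 1 := by
    ext m
    simp only [Finset.mem_filter, Finset.mem_range, Finset.mem_image]
    constructor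
    · rintro ⟨hm, a, ha⟩
      obtain ⟨e', he', hT', ht', -⟩ := (hl m τ a).1 ha
      have hs := h.lt_of_same_thread hE he' he (ht'.trans hτ.symm) (by omega)
      obtain ⟨-, j, k', hj, hk', hlt⟩ := (WellFormed.seqBefore_iff he').1 hs
      rw [hk] at hk'
      cases hk'
      refine ⟨j, hlt, ?_⟩
      have : ev j = e' := hE.inj _ (hev1 j hlt) _ he' (by rw [hev2 j hlt, ht'])
        (by rw [hev3 j hlt, hj])
      rw [this]
      omega
    · rintro ⟨j, hj, rfl⟩
      have hp := h.pos _ (hev1 j hj)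
      have hlt := h.mono _ _ (hev1 j hj).1 he.1
        (Or.inr ⟨by rw [hev2 j hj, hτ], j, k, hev3 j hj, hk, hj⟩)
      exact ⟨by omega, (ev j).lab, (hl _ τ _).2 ⟨ev j, hev1 j hj, by omega, hev2 j hj, rfl⟩⟩
  rw [this, Finset.card_image_of_injOn, Finset.card_range]
  intro i hi j hj hij
  simp only [Finset.coe_range, Set.mem_Iio] at hi hj
  have hi' := h.pos _ (hev1 i hi)
  have hj' := h.pos _ (hev1 j hj)
  simp only at hij
  rcases lt_trichotomy i j with hlt | heq | hlt
  · have := hmono i j hlt hj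
    omega
  · exact heq
  · have := hmono j i hlt hi
    omega

theorem Schedule.isBehavior {Sil : Type*} {l : ℕ → Option ((Tid × ELab Loc Val) ⊕ Sil)}
    {β : Behavior Tid Loc Val} {T : Event Tid Loc Val → ℕ} (h : Schedule (eventsOf β) T)
    (hl : ∀ n, ObsSpec (eventsOf β) T n (l n)) : IsBehavior l β := by
  classical
  have hE := wellFormed_eventsOf β
  intro τ k a
  constructor
  · intro hk
    have he : Proper (eventsOf β) ⟨some k, some τ, a⟩ :=
      ⟨Or.inr ⟨τ, k, a, hk, rfl⟩, notMem_Init_of_tid rfl⟩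
    have hp := h.pos _ he
    obtain ⟨n, hn⟩ := Nat.exists_eq_succ_of_ne_zero hp.ne'
    exact ⟨n, h.count_eq hE hl _ he τ k n rfl rfl hn, (hl n τ a).2 ⟨_, he, hn, rfl, rfl⟩⟩
  · rintro ⟨n, hn, hla⟩
    obtain ⟨e, he, hT, hτ, rfl⟩ := (hl n τ a).1 hla
    obtain ⟨τ', k', h1, h2, h3⟩ := (mem_eventsOf_iff he.2).1 he.1
    rw [hτ] at h1
    cases h1
    have := h.count_eq hE hl e he τ k' n hτ h2 hT
    rw [← hn, this, h3]

end EventLemmas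

/-! ### Graphs determined by a key -/

section KeyGraph

variable {Tid : Type*} {Loc : Type*} {Val : Type*} [Zero Val]

/-- The execution graph in which the modification order is given by a numerical key and the
reads-from relation by a function. -/
def keyGraph (E : Set (Event Tid Loc Val)) (hE : WellFormed E) (P : Event Tid Loc Val → ℕ)
    (hP : ∀ a b, a ∈ E → b ∈ E → a.IsW → b.IsW → a.loc = b.loc → P a = P b → a = b)
    (src : Event Tid Loc Val → Event Tid Loc Val)
    (hs : ∀ r, r ∈ E → r.IsR → src r ∈ E ∧ (src r).IsW ∧ (src r).loc = r.loc ∧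
      (src r).valW = r.valR) : EGraph Tid Loc Val where
  E := E
  rf e r := r ∈ E ∧ r.IsR ∧ e = src r
  mo a b := a ∈ E ∧ b ∈ E ∧ a.IsW ∧ b.IsW ∧ a.loc = b.loc ∧ P a < P b
  wf := hE
  rf_mem := by
    rintro e r ⟨h1, h2, rfl⟩
    exact ⟨(hs r h1 h2).1, h1⟩
  rf_match := by
    rintro e r ⟨h1, h2, rfl⟩
    obtain ⟨h3, h4, h5, h6⟩ := hs r h1 h2
    exact ⟨h4, h2, h5, h6⟩
  rf_functional := by
    rintro e₁ e₂ r ⟨-, -, rfl⟩ ⟨-, -, rfl⟩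
    rfl
  rf_total := fun r h1 h2 => ⟨_, h1, h2, rfl⟩
  mo_mem := fun a b h => ⟨h.1, h.2.1⟩
  mo_match := fun a b h => ⟨h.2.2.1, h.2.2.2.1, h.2.2.2.2.1⟩
  mo_irrefl := fun a h => lt_irrefl _ h.2.2.2.2.2
  mo_trans := fun a b c h h' => ⟨h.1, h'.2.1, h.2.2.1, h'.2.2.2.1,
    h.2.2.2.2.1.trans h'.2.2.2.2.1, h.2.2.2.2.2.trans h'.2.2.2.2.2⟩
  mo_total := by
    intro a ha b hb haw hbw hl hne
    rcases lt_trichotomy (P a) (P b) with h | h | h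
    · exact Or.inl ⟨ha, hb, haw, hbw, hl, h⟩
    · exact absurd (hP a b ha hb haw hbw hl h) hne
    · exact Or.inr ⟨hb, ha, hbw, haw, hl.symm, h⟩

theorem keyGraph_mo_finite (E : Set (Event Tid Loc Val)) (hE : WellFormed E)
    (P : Event Tid Loc Val → ℕ)
    (hP : ∀ a b, a ∈ E → b ∈ E → a.IsW → b.IsW → a.loc = b.loc → P a = P b → a = b)
    (src : Event Tid Loc Val → Event Tid Loc Val)
    (hs : ∀ r, r ∈ E → r.IsR → src r ∈ E ∧ (src r).IsW ∧ (src r).loc = r.loc ∧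
      (src r).valW = r.valR) :
    PrefixFinite (keyGraph E hE P hP src hs).E (keyGraph E hE P hP src hs).mo := by
  intro b _
  refine Set.Finite.of_finite_image (f := P) ((Set.finite_lt_nat (P b)).subset ?_) ?_
  · rintro _ ⟨e, he, rfl⟩
    exact he.2.2.2.2.2
  · intro a ha a' ha' h
    exact hP a a' ha.1 ha'.1 ha.2.2.1 ha'.2.2.1 (ha.2.2.2.2.1.trans ha'.2.2.2.2.1.symm) h

end KeyGraph

/-! ### Schedules from acyclic graphs -/

section FromGraph

variable {Tid : Type*} {Loc : Type*} {Val : Type*} [Zero Val]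

/-- There may be infinitely many locations, hence infinitely many initialization events, all before
every other event. Only the proper predecessors are finite in number. -/
theorem WellFormed.finite_seqBefore {E : Set (Event Tid Loc Val)} (hE : WellFormed E)
    (b : Event Tid Loc Val) : {a | Proper E a ∧ seqBefore a b}.Finite := by
  by_cases hb : ∃ k, b.sn = some k
  · obtain ⟨k, hk⟩ := hb
    refine Set.Finite.of_finite_image (f := fun e => e.sn.getD 0)
      ((Set.finite_lt_nat k).subset ?_) ?_
    · rintro _ ⟨e, ⟨he, hs⟩, rfl⟩
      obtain ⟨-, j, k', hj, hk', hlt⟩ := (WellFormed.seqBefore_iff he).1 hs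
      rw [hk] at hk'
      cases hk'
      simpa [hj] using hlt
    · rintro a ⟨ha, hs⟩ a' ⟨ha', hs'⟩ h
      obtain ⟨ht, j, k', hj, hk', hlt⟩ := (WellFormed.seqBefore_iff ha).1 hs
      obtain ⟨ht', j', k', hj', hk', hlt'⟩ := (WellFormed.seqBefore_iff ha').1 hs'
      refine hE.inj a ha a' ha' (ht.trans ht'.symm) ?_
      simp only [hj, hj', Option.getD_some] at h ⊢
      rw [h]
  · convert Set.finite_empty
    ext a
    simp only [Set.mem_ofPred_eq, Set.mem_empty_iff_false, iff_false]
    rintro ⟨ha, hs⟩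
    obtain ⟨-, j, k', hj, hk', hlt⟩ := (WellFormed.seqBefore_iff ha).1 hs
    exact hb ⟨k', hk'⟩

variable [Finite Tid]

theorem WellFormed.countable_proper {E : Set (Event Tid Loc Val)} (hE : WellFormed E) :
    Countable {e // Proper E e} := by
  have : Function.Injective
      (fun e : {e // Proper E e} => ((e.1.tid, e.1.sn) : Option Tid × Option ℕ)) := by
    intro a b h
    simp only [Prod.mk.injEq] at h
    exact Subtype.ext (hE.inj _ a.2 _ b.2 h.1 h.2)
  exact this.countable

/-- A well-founded relation on proper events under which every event has finitely many predecessors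
is compatible with some enumeration of the events. -/
theorem WellFormed.exists_enumeration {E : Set (Event Tid Loc Val)} (hE : WellFormed E)
    (R : Event Tid Loc Val → Event Tid Loc Val → Prop)
    (hwf : WellFounded fun a b : {e // Proper E e} => R a.1 b.1)
    (hfin : ∀ b, Proper E b → {a | Proper E a ∧ R a b}.Finite) :
    ∃ f : Event Tid Loc Val → ℕ, (∀ a b, Proper E a → Proper E b → f a = f b → a = b) ∧
      ∀ a b, Proper E a → Proper E b → R a b → f a < f b := by
  classical
  have := hE.countable_proper
  obtain ⟨f, hf, hR⟩ := FairMM.exists_enumeration hwf (by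
    intro b
    refine Set.Finite.of_finite_image (f := Subtype.val) ((hfin b.1 b.2).subset ?_)
      Subtype.val_injective.injOn
    rintro _ ⟨a, ha, rfl⟩
    exact ⟨a.2, ha⟩)
  refine ⟨fun e => if h : Proper E e then f ⟨e, h⟩ else 0, ?_, ?_⟩
  · intro a b ha hb hab
    simp only [dif_pos ha, dif_pos hb] at hab
    exact congrArg Subtype.val (hf hab)
  · intro a b ha hb hab
    simp only [dif_pos ha, dif_pos hb]
    exact hR _ _ hab

theorem closureIrrefl_subtype {α : Type*} {p : α → Prop} {R : α → α → Prop} (h : ClosureIrrefl R) :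
    ClosureIrrefl fun a b : {e // p e} => R a.1 b.1 := by
  intro a ha
  exact h a.1 (Relation.TransGen.lift Subtype.val (fun _ _ h => h) a a ha)

/-- Program order is required only inside the classes of `cl`. This matters for TSO, where a read
may overtake an earlier write: with the class `IsW`, what remains of program order inside a class is
preserved. -/
theorem WellFormed.wellFounded_of_closureIrrefl {E : Set (Event Tid Loc Val)} (hE : WellFormed E)
    {κ : Type*} [Finite κ] (cl : Event Tid Loc Val → κ)
    {R : Event Tid Loc Val → Event Tid Loc Val → Prop} (h : ClosureIrrefl R)
    (hpo : ∀ a b, Proper E a → Proper E b → cl a = cl b → seqBefore a b → R a b) :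
    WellFounded fun a b : {e // Proper E e} => R a.1 b.1 := by
  refine FairMM.wellFounded_of_closureIrrefl (ι := Option Tid × κ) (fun e => (e.1.tid, cl e.1))
    (fun e => e.1.sn.getD 0) ?_ ?_ (closureIrrefl_subtype h)
  · intro a b ht hs
    obtain ⟨τ, k, h1, h2⟩ := hE.exists_tid_sn a.2
    obtain ⟨τ', k', h1', h2'⟩ := hE.exists_tid_sn b.2
    simp only [h2, h2', Option.getD_some, Prod.mk.injEq] at hs ht
    exact Subtype.ext (hE.inj _ a.2 _ b.2 ht.1 (by rw [h2, h2', hs]))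
  · intro a b ht hs
    obtain ⟨τ, k, h1, h2⟩ := hE.exists_tid_sn a.2
    obtain ⟨τ', k', h1', h2'⟩ := hE.exists_tid_sn b.2
    simp only [h2, h2', Option.getD_some, Prod.mk.injEq] at hs ht
    exact hpo _ _ a.2 b.2 ht.2 (Or.inr ⟨ht.1, k, k', h2, h2', hs⟩)

end FromGraph

/-! ### Memories determined by committed writes -/

section MemInv

variable {Tid : Type*} {Loc : Type*} {Val : Type*}

/-- `w` is the last write to `x` among those that satisfy `D`, in the order given by `P`. -/
def IsLastWrite (E : Set (Event Tid Loc Val)) (P : Event Tid Loc Val → ℕ)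
    (D : Event Tid Loc Val → Prop) (x : Loc) (w : Event Tid Loc Val) : Prop :=
  w ∈ E ∧ w.IsW ∧ w.loc = x ∧ D w ∧ ∀ w' ∈ E, w'.IsW → w'.loc = x → D w' → P w' ≤ P w

/-- The memory `M` is the result of committing, in the order of their keys, all writes whose key is
at most `n`. -/
def MemInv (E : Set (Event Tid Loc Val)) (P : Event Tid Loc Val → ℕ) (n : ℕ) (M : Loc → Val) :
    Prop :=
  ∀ x, ∃ w, IsLastWrite E P (fun w => P w ≤ n) x w ∧ w.valW = some (M x)

theorem IsLastWrite.unique {E : Set (Event Tid Loc Val)} {P : Event Tid Loc Val → ℕ}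
    {D : Event Tid Loc Val → Prop} {x : Loc} {w w' : Event Tid Loc Val}
    (hP : ∀ a b, a ∈ E → b ∈ E → a.IsW → b.IsW → a.loc = b.loc → P a = P b → a = b)
    (h : IsLastWrite E P D x w) (h' : IsLastWrite E P D x w') : w = w' :=
  hP w w' h.1 h'.1 h.2.1 h'.2.1 (h.2.2.1.trans h'.2.2.1.symm)
    (le_antisymm (h'.2.2.2.2 w h.1 h.2.1 h.2.2.1 h.2.2.2.1)
      (h.2.2.2.2 w' h'.1 h'.2.1 h'.2.2.1 h'.2.2.2.1))

variable {E : Set (Event Tid Loc Val)} {P : Event Tid Loc Val → ℕ} {n : ℕ} {M : Loc → Val}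

theorem MemInv.zero [Zero Val] (hE : WellFormed E) (hP : ∀ e ∈ Init Tid Loc Val, P e = 0) :
    MemInv E P 0 (fun _ => 0) := by
  intro x
  refine ⟨⟨none, none, .write x 0⟩, ⟨hE.init_subset ⟨x, rfl⟩, trivial, rfl, ?_, ?_⟩, rfl⟩
  · exact (hP _ ⟨x, rfl⟩).le
  · intro w' _ _ _ h
    omega

theorem MemInv.stay (h : MemInv E P n M) (hn : ∀ w ∈ E, w.IsW → P w ≠ n + 1) :
    MemInv E P (n + 1) M := by
  intro x
  obtain ⟨w, ⟨h1, h2, h3, h4, h5⟩, h6⟩ := h x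
  refine ⟨w, ⟨h1, h2, h3, Nat.le_succ_of_le h4, ?_⟩, h6⟩
  intro w' h1' h2' h3' h4'
  have := hn w' h1' h2'
  exact h5 w' h1' h2' h3' (by omega)

theorem MemInv.write [DecidableEq Loc] (h : MemInv E P n M) {e : Event Tid Loc Val} {a : Val}
    (he : e ∈ E) (hW : e.IsW) (hP : P e = n + 1) (ha : e.valW = some a)
    (hn : ∀ w ∈ E, w.IsW → P w = n + 1 → w = e) :
    MemInv E P (n + 1) (Function.update M e.loc a) := by
  intro x
  by_cases hx : x = e.loc
  · subst hx
    refine ⟨e, ⟨he, hW, rfl, hP.le, ?_⟩, by simp [ha]⟩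
    intro w' _ _ _ h
    omega
  · obtain ⟨w, ⟨h1, h2, h3, h4, h5⟩, h6⟩ := h x
    refine ⟨w, ⟨h1, h2, h3, Nat.le_succ_of_le h4, ?_⟩, by simpa [hx] using h6⟩
    intro w' h1' h2' h3' h4'
    refine h5 w' h1' h2' h3' ?_
    rcases Nat.lt_or_ge n (P w') with hlt | hle
    · have : w' = e := hn w' h1' h2' (by omega)
      rw [this] at h3'
      exact absurd h3'.symm hx
    · exact hle

end MemInv

/-! ### Sequential consistency -/

section SC

variable {Tid : Type*} {Loc : Type*} {Val : Type*} [DecidableEq Loc]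

theorem sc_read_value {M M' : Loc → Val} {τ : Tid} {a : ELab Loc Val} (hR : a.IsR)
    (h : scStep M (Sum.inl (τ, a)) M') : a.valR = some (M a.loc) := by
  cases a with
  | read x v => simp [ELab.valR, ELab.loc, h.1]
  | write x v => exact hR.elim
  | rmw x v v' =>
    obtain ⟨M₁, ⟨h1, -⟩, -⟩ := h
    simp [ELab.valR, ELab.loc, h1]

theorem sc_exists_step {M : Loc → Val} (τ : Tid) {a : ELab Loc Val}
    (h : a.IsR → a.valR = some (M a.loc)) :
    scStep M (Sum.inl (τ, a)) (match a.valW with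
      | some v => Function.update M a.loc v
      | none => M) := by
  cases a with
  | read x v => exact ⟨(Option.some.inj (h trivial)).symm, rfl⟩
  | write x v => exact rfl
  | rmw x v v' => exact ⟨M, ⟨(Option.some.inj (h trivial)).symm, rfl⟩, rfl⟩

variable [Zero Val]

theorem sc_memInv {q : ℕ → Loc → Val} {l : ℕ → Option ((Tid × ELab Loc Val) ⊕ Empty)}
    (hr : (memSC Tid Loc Val).StutterRun q l) {E : Set (Event Tid Loc Val)} (hE : WellFormed E)
    {T : Event Tid Loc Val → ℕ} (hT : Schedule E T) (hl : ∀ n, ObsSpec E T n (l n)) (n : ℕ) :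
    MemInv E T n (q n) := by
  induction n with
  | zero =>
    rw [hr.start]
    exact MemInv.zero hE hT.init
  | succ n ih =>
    have hstep := hr.step n
    have hun : ∀ e, Proper E e → T e = n + 1 → ∀ w ∈ E, w.IsW → T w = n + 1 → w = e :=
      fun e he hTe w hw _ hTw => hT.inj w e (hT.proper_of_pos hw (by omega)) he (by omega)
    rcases hln : l n with _ | ⟨⟨τ, a⟩⟩ | θ
    · rw [hln] at hstep
      rw [show q (n + 1) = q n from hstep]
      refine ih.stay fun w hw _ hTw => ?_
      have hw' := hT.proper_of_pos hw (by omega)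
      obtain ⟨τ, k, h1, -⟩ := hE.exists_tid_sn hw'
      have := (hl n τ w.lab).2 ⟨w, hw', hTw, h1, rfl⟩
      rw [hln] at this
      cases this
    · obtain ⟨e, he, hTe, hτ, rfl⟩ := (hl n τ a).1 hln
      rw [hln] at hstep
      change scStep (q n) (Sum.inl (τ, e.lab)) (q (n + 1)) at hstep
      cases he' : e.lab with
      | read x v =>
        rw [he'] at hstep
        rw [show q (n + 1) = q n from hstep.2]
        refine ih.stay fun w hw hW hTw => ?_
        rw [hun e he hTe w hw hW hTw] at hW
        simp [Event.IsW, he', ELab.IsW] at hW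
      | write x v =>
        rw [he'] at hstep
        have := ih.write (e := e) (a := v) he.1 (by simp [Event.IsW, he', ELab.IsW]) hTe
          (by simp [Event.valW, he', ELab.valW]) (hun e he hTe)
        rw [show q (n + 1) = Function.update (q n) x v from hstep]
        simpa [Event.loc, he', ELab.loc] using this
      | rmw x v v' =>
        rw [he'] at hstep
        obtain ⟨M₁, ⟨-, rfl⟩, h2⟩ := hstep
        have := ih.write (e := e) (a := v') he.1 (by simp [Event.IsW, he', ELab.IsW]) hTe
          (by simp [Event.valW, he', ELab.valW]) (hun e he hTe)
        rw [show q (n + 1) = Function.update (q n) x v' from h2]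
        simpa [Event.loc, he', ELab.loc] using this
    · exact θ.elim

/-- Execution time is the modification order, and a read takes the last write before it. All four
relations then increase execution time, which yields both acyclicity and prefix-finiteness. -/
theorem sc_behMF_subset [DecidableEq Tid] :
    BehMF (memSC Tid Loc Val) ⊆ BehDecl (graphsSC Tid Loc Val ∩ graphsFair Tid Loc Val) := by
  intro β hβ
  obtain ⟨q, l, hr, -, hb⟩ := (mem_BehMF_iff _ _).1 hβ
  obtain ⟨T, hT, hl⟩ := exists_schedule hb
  have hE := wellFormed_eventsOf β
  change ∃ G : EGraph Tid Loc Val, G ∈ _ ∧ eventsOf β = G.E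
  generalize eventsOf β = E at *
  have hinv := sc_memInv hr hE hT hl
  have hex : ∀ r, ∃ e, r ∈ E → r.IsR → IsLastWrite E T (fun w => T w < T r) r.loc e ∧
      e.valW = r.valR := by
    intro r
    by_cases h : r ∈ E ∧ r.IsR
    · have hr' : Proper E r := ⟨h.1, fun hi => not_isR_of_mem_Init hi h.2⟩
      obtain ⟨n, hn⟩ := Nat.exists_eq_succ_of_ne_zero (hT.pos r hr').ne'
      obtain ⟨τ, k, h1, -⟩ := hE.exists_tid_sn hr'
      have hln := (hl n τ r.lab).2 ⟨r, hr', hn, h1, rfl⟩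
      have hstep := hr.step n
      rw [hln] at hstep
      obtain ⟨w, hw, hv⟩ := hinv n r.loc
      refine ⟨w, fun _ _ => ⟨?_, ?_⟩⟩
      · simpa only [hn, Nat.lt_succ_iff] using hw
      · rw [hv]
        exact (sc_read_value h.2 hstep).symm
    · exact ⟨r, fun h1 h2 => absurd ⟨h1, h2⟩ h⟩
  choose src hsrc using hex
  have hs : ∀ r, r ∈ E → r.IsR → src r ∈ E ∧ (src r).IsW ∧ (src r).loc = r.loc ∧
      (src r).valW = r.valR := fun r h1 h2 =>
    ⟨(hsrc r h1 h2).1.1, (hsrc r h1 h2).1.2.1, (hsrc r h1 h2).1.2.2.1, (hsrc r h1 h2).2⟩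
  have hP : ∀ a b, a ∈ E → b ∈ E → a.IsW → b.IsW → a.loc = b.loc → T a = T b → a = b :=
    fun a b ha hb _ _ h h' => hT.inj_loc ha hb h h'
  let G := keyGraph E hE T hP src hs
  have hfr : ∀ a b, G.fr a b → Proper E a ∧ T a < T b := by
    rintro a b ⟨⟨e, ⟨haE, haR, rfl⟩, hmo⟩, hne⟩
    have ha' : Proper E a := ⟨haE, fun hi => not_isR_of_mem_Init hi haR⟩
    refine ⟨ha', ?_⟩
    obtain ⟨-, hbE, -, hbW, hloc, hlt⟩ := hmo
    obtain ⟨⟨-, -, h3, h4, h5⟩, -⟩ := hsrc a haE haR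
    by_contra hc
    rcases (not_lt.1 hc).eq_or_lt with h | h
    -- Equal times mean that `b` is the update `a` itself, a pair that `fr` excludes.
    · exact hne ⟨hT.inj a b ha' (hT.proper_of_pos hbE (by omega)) h.symm, haE⟩
    · have := h5 b hbE hbW (hloc.symm.trans h3) h
      omega
  refine ⟨G, ⟨?_, keyGraph_mo_finite E hE T hP src hs, ?_⟩, rfl⟩
  · refine closureIrrefl_of_measure T fun a b h => ?_
    rcases h with h | ⟨h1, h2, rfl⟩ | h | h
    · exact hT.mono a b h.1 h.2.1 h.2.2
    · exact (hsrc b h1 h2).1.2.2.2.1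
    · exact h.2.2.2.2.2
    · exact (hfr a b h).2
  · intro b _
    exact (hT.finite_le (T b)).subset fun a ha => ⟨(hfr a b ha).1, (hfr a b ha).2.le⟩

end SC

/-! ### Schedules and last writes in a given graph -/

section GraphLemmas

variable {Tid : Type*} {Loc : Type*} {Val : Type*} [Zero Val] {G : EGraph Tid Loc Val}

theorem EGraph.proper_of_isR {r : Event Tid Loc Val} (h : r ∈ G.E) (hR : r.IsR) : Proper G.E r :=
  ⟨h, fun hi => not_isR_of_mem_Init hi hR⟩

/-- Schedules from enumerations of the proper events. -/
theorem exists_schedule_of_enumeration {E : Set (Event Tid Loc Val)} {f : Event Tid Loc Val → ℕ}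
    (hinj : ∀ a b, Proper E a → Proper E b → f a = f b → a = b)
    (hmono : ∀ a b, Proper E a → Proper E b → seqBefore a b → f a < f b) :
    ∃ T, Schedule E T ∧ ∀ e, Proper E e → T e = f e + 1 := by
  classical
  refine ⟨fun e => if e ∈ Init Tid Loc Val then 0 else f e + 1, ⟨?_, ?_, ?_, ?_⟩, ?_⟩
  · intro e he
    simp [he]
  · intro e he
    simp [he.2]
  · intro a b ha hb h
    simp only [ha.2, hb.2, if_false] at h
    exact hinj a b ha hb (by omega)
  · intro a b ha hb h
    have hb' := h.not_init
    by_cases hi : a ∈ Init Tid Loc Val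
    · simp [hi, hb']
    · have := hmono a b ⟨ha, hi⟩ ⟨hb, hb'⟩ h
      simpa [hi, hb'] using this
  · intro e he
    simp [he.2]

/-- Initialization writes come first in the modification order. -/
theorem EGraph.SCPerLoc.not_mo_init (h : G.SCPerLoc) {a b : Event Tid Loc Val}
    (hb : b ∈ Init Tid Loc Val) : ¬ G.mo a b := by
  intro hmo
  have hl := (G.mo_match a b hmo).2.2
  have ha : a ∉ Init Tid Loc Val := by
    intro ha
    have := eq_of_mem_Init ha hb hl
    subst this
    exact G.mo_irrefl _ hmo
  refine h a (.tail (.single (Or.inr (Or.inr (Or.inl hmo)))) (Or.inl ⟨?_, hl.symm⟩))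
  exact ⟨(G.mo_mem a b hmo).2, (G.mo_mem a b hmo).1, Or.inl ⟨hb, ha⟩⟩

theorem EGraph.ConsistentSC.scPerLoc (h : G.ConsistentSC) : G.SCPerLoc :=
  ClosureIrrefl.mono h fun _ _ h => h.imp (fun h => h.1) id

theorem EGraph.finite_rf (G : EGraph Tid Loc Val) (b : Event Tid Loc Val) : {a | G.rf a b}.Finite :=
  Set.Subsingleton.finite fun a ha a' ha' => G.rf_functional a a' b ha ha'

/-- The source of a read is the last of the writes that satisfy `D` if `D` holds of no write that
comes after the read in `fr`. -/
theorem EGraph.isLastWrite_of_rf {P : Event Tid Loc Val → ℕ} {D : Event Tid Loc Val → Prop}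
    {e r : Event Tid Loc Val} (hrf : G.rf e r) (hD : D e)
    (hmo : ∀ a b, G.mo a b → P a ≤ P b)
    (hfr : ∀ w, G.fr r w → ¬ D w) (hr : ¬ (r.IsW ∧ D r)) :
    IsLastWrite G.E P D r.loc e := by
  obtain ⟨h1, h2, h3, h4⟩ := G.rf_match e r hrf
  refine ⟨(G.rf_mem e r hrf).1, h1, h3, hD, fun w hw hW hl hDw => ?_⟩
  by_cases hwe : w = e
  · rw [hwe]
  rcases G.mo_total w hw e (G.rf_mem e r hrf).1 hW h1 (hl.trans h3.symm) hwe with h | h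
  · exact hmo _ _ h
  · refine absurd hDw (hfr w ⟨⟨e, hrf, h⟩, ?_⟩)
    rintro ⟨rfl, -⟩
    exact hr ⟨hW, hDw⟩

end GraphLemmas

/-! ### Sequential consistency: from graphs to runs -/

section SC

variable {Tid : Type*} {Loc : Type*} {Val : Type*} [Zero Val] [DecidableEq Loc]

/-- Fairness supplies finitely many `mo`- and `fr`-predecessors; `rf` and program order contribute
finitely many proper ones anyway. Along the resulting enumeration the memory holds the `mo`-last
executed write to each location, and for a read this is its source: later writes are `fr`-after it
and not yet executed. -/
theorem sc_behDecl_subset [DecidableEq Tid] [Finite Tid] :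
    BehDecl (graphsSC Tid Loc Val ∩ graphsFair Tid Loc Val) ⊆ BehMF (memSC Tid Loc Val) := by
  classical
  rintro β ⟨G, ⟨hG, hfmo, hffr⟩, hβ⟩
  have hG' : G.ConsistentSC := hG
  let R := fun a b => G.po a b ∨ G.rf a b ∨ G.mo a b ∨ G.fr a b
  obtain ⟨f, hf, hfR⟩ := G.wf.exists_enumeration R
    (G.wf.wellFounded_of_closureIrrefl (fun _ => ()) hG
      fun a b ha hb _ h => Or.inl ⟨ha.1, hb.1, h⟩)
    (by
      intro b hb
      refine ((G.wf.finite_seqBefore b).union ((G.finite_rf b).union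
        ((hfmo b hb.1).union (hffr b hb.1)))).subset ?_
      rintro a ⟨ha, h | h | h | h⟩
      · exact Or.inl ⟨ha, h.2.2⟩
      · exact Or.inr (Or.inl h)
      · exact Or.inr (Or.inr (Or.inl h))
      · exact Or.inr (Or.inr (Or.inr h)))
  obtain ⟨T, hT, hTf⟩ := exists_schedule_of_enumeration hf
    fun a b ha hb h => hfR a b ha hb (Or.inl ⟨ha.1, hb.1, h⟩)
  have hTR : ∀ a b, a ∈ G.E → Proper G.E b → R a b → T a < T b := by
    intro a b ha hb h
    by_cases hi : a ∈ Init Tid Loc Val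
    · rw [hT.init a hi]
      exact hT.pos b hb
    · rw [hTf a ⟨ha, hi⟩, hTf b hb]
      exact Nat.succ_lt_succ (hfR a b ⟨ha, hi⟩ hb h)
  have hmoP : ∀ a b, G.mo a b → Proper G.E b := fun a b h =>
    ⟨(G.mo_mem a b h).2, fun hi => hG'.scPerLoc.not_mo_init hi h⟩
  have hTmo : ∀ a b, G.mo a b → T a < T b := fun a b h =>
    hTR a b (G.mo_mem a b h).1 (hmoP a b h) (Or.inr (Or.inr (Or.inl h)))
  rw [mem_BehMF_iff]
  obtain ⟨q, l, hrun, -, hl⟩ := (memSC Tid Loc Val).exists_stutterRun (MemInv G.E T)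
    (fun n _ o _ => ObsSpec G.E T n o) (MemInv.zero G.wf hT.init) (by
      intro n M hM
      by_cases hex : ∃ e, Proper G.E e ∧ T e = n + 1
      · obtain ⟨e, he, hTe⟩ := hex
        obtain ⟨τ, k, hτ, -⟩ := G.wf.exists_tid_sn he
        have hread : e.IsR → e.valR = some (M e.loc) := by
          intro hR
          obtain ⟨w, hrf⟩ := G.rf_total e he.1 hR
          have h1 : IsLastWrite G.E T (fun w => T w ≤ n) e.loc w := by
            refine EGraph.isLastWrite_of_rf hrf ?_ (fun a b h => (hTmo a b h).le) ?_ ?_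
            · have := hTR w e (G.rf_mem w e hrf).1 he (Or.inr (Or.inl hrf))
              omega
            · intro w' hfr
              obtain ⟨d, -, hd⟩ := hfr.1
              have := hTR e w' he.1 (hmoP _ _ hd) (Or.inr (Or.inr (Or.inr hfr)))
              omega
            · rintro ⟨-, h⟩
              omega
          obtain ⟨w', hw', hv⟩ := hM e.loc
          have : w = w' :=
            IsLastWrite.unique (fun a b ha hb _ _ h h' => hT.inj_loc ha hb h h') h1 hw'
          rw [← (G.rf_match w e hrf).2.2.2, this, hv]
        refine ⟨some (Sum.inl (τ, e.lab)), _, ObsSpec.of_event hT he hTe hτ,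
          sc_exists_step τ hread, ?_⟩
        have hun : ∀ w ∈ G.E, w.IsW → T w = n + 1 → w = e :=
          fun w hw _ hTw => hT.inj w e (hT.proper_of_pos hw (by omega)) he (by omega)
        cases hv : e.lab.valW with
        | none =>
          refine hM.stay fun w hw hW hTw => ?_
          rw [hun w hw hW hTw] at hW
          obtain ⟨v, hv'⟩ := (ELab.isW_iff _).1 hW
          rw [hv] at hv'
          cases hv'
        | some v => exact hM.write he.1 ((ELab.isW_iff _).2 ⟨v, hv⟩) hTe hv hun
      · refine ⟨none, M, ObsSpec.of_no_event (by simp) fun e he hTe => hex ⟨e, he, hTe⟩, rfl, ?_⟩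
        exact hM.stay fun w hw _ hTw => hex ⟨w, hT.proper_of_pos hw (by omega), hTw⟩)
  refine ⟨q, l, hrun, Or.inr fun θ => θ.elim, ?_⟩
  rw [← hβ] at hT hl
  exact hT.isBehavior hl

end SC

/-! ### Total store order: states determined by commit times -/

section CommitTimes

variable {Tid : Type*} {Loc : Type*} {Val : Type*} [Zero Val]

/-- Commit times `P` of the events of `E` scheduled by `T`: the events other than plain writes
commit when they are executed, plain writes commit later, and different actions take place at different
times. -/
structure CommitTimes (E : Set (Event Tid Loc Val)) (T P : Event Tid Loc Val → ℕ) : Prop where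
  wf : WellFormed E
  sched : Schedule E T
  init : ∀ e ∈ Init Tid Loc Val, P e = 0
  eq : ∀ e, e.IsR → P e = T e
  lt : ∀ e, Proper E e → ¬ e.IsR → T e < P e
  inj : ∀ a b, Proper E a → Proper E b → P a = P b → a = b
  cross : ∀ a b, Proper E a → Proper E b → T a = P b → a = b
  fifo : ∀ a b, Proper E a → Proper E b → seqBefore a b → b.IsW → P a < P b

/-- The buffer `b` of the thread `τ` holds the writes executed but not yet committed. -/
def BufInv (E : Set (Event Tid Loc Val)) (T P : Event Tid Loc Val → ℕ) (n : ℕ) (τ : Tid)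
    (b : List (Loc × Val)) : Prop :=
  ∃ L : List (Event Tid Loc Val), L.map Event.lab = b.map (fun p => ELab.write p.1 p.2) ∧
    L.Pairwise (fun a b => T b < T a) ∧
    ∀ w, w ∈ L ↔ Proper E w ∧ w.tid = some τ ∧ T w ≤ n ∧ n < P w

/-- The state `q` is determined by the events executed and committed up to step `n`. -/
structure TSOInv (E : Set (Event Tid Loc Val)) (T P : Event Tid Loc Val → ℕ) (n : ℕ)
    (q : TSOState Tid Loc Val) : Prop where
  mem : MemInv E P n q.mem
  buf : ∀ τ, BufInv E T P n τ (q.buf τ)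

variable {E : Set (Event Tid Loc Val)} {T P : Event Tid Loc Val → ℕ} {n : ℕ}

theorem CommitTimes.le (K : CommitTimes E T P) {e : Event Tid Loc Val} (he : e ∈ E) :
    T e ≤ P e := by
  by_cases hi : e ∈ Init Tid Loc Val
  · rw [K.sched.init e hi]
    exact Nat.zero_le _
  · by_cases hR : e.IsR
    · exact (K.eq e hR).ge
    · exact (K.lt e ⟨he, hi⟩ hR).le

theorem CommitTimes.proper_of_pos (K : CommitTimes E T P) {e : Event Tid Loc Val} (he : e ∈ E)
    (h : 0 < P e) : Proper E e :=
  ⟨he, fun hi => by rw [K.init e hi] at h; exact lt_irrefl _ h⟩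

theorem CommitTimes.pos (K : CommitTimes E T P) {e : Event Tid Loc Val} (he : Proper E e) :
    0 < P e :=
  (K.sched.pos e he).trans_le (K.le he.1)

theorem CommitTimes.inj_loc (K : CommitTimes E T P) (a b : Event Tid Loc Val) (ha : a ∈ E)
    (hb : b ∈ E) (_ : a.IsW) (_ : b.IsW) (hl : a.loc = b.loc) (h : P a = P b) : a = b := by
  by_cases hi : a ∈ Init Tid Loc Val
  · by_cases hj : b ∈ Init Tid Loc Val
    · exact eq_of_mem_Init hi hj hl
    · have := K.pos ⟨hb, hj⟩
      rw [K.init a hi] at h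
      omega
  · have h1 := K.pos ⟨ha, hi⟩
    exact K.inj a b ⟨ha, hi⟩ (K.proper_of_pos hb (by omega)) h

/-- An event that is executed and committed in the same step never enters the buffer. The two
hypotheses say that no event of the thread does only one of these in this step. -/
theorem BufInv.congr {τ : Tid} {b : List (Loc × Val)} (h : BufInv E T P n τ b)
    (hn : ∀ w, Proper E w → w.tid = some τ → T w ≠ n + 1 ∨ P w = n + 1)
    (hn' : ∀ w, Proper E w → w.tid = some τ → P w = n + 1 → T w = n + 1) :
    BufInv E T P (n + 1) τ b := by
  obtain ⟨L, h1, h2, h3⟩ := h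
  refine ⟨L, h1, h2, fun w => (h3 w).trans ?_⟩
  refine and_congr_right fun hw => and_congr_right fun ht => ?_
  have h4 := hn w hw ht
  have h5 := hn' w hw ht
  omega

theorem BufInv.eq_nil {τ : Tid} {b : List (Loc × Val)} (h : BufInv E T P n τ b)
    (hn : ∀ w, Proper E w → w.tid = some τ → T w ≤ n → P w ≤ n) : b = [] := by
  obtain ⟨L, h1, h2, h3⟩ := h
  have : L = [] := by
    rw [List.eq_nil_iff_forall_not_mem]
    intro w hw
    obtain ⟨h4, h5, h6, h7⟩ := (h3 w).1 hw
    have := hn w h4 h5 h6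
    omega
  subst this
  simpa using h1.symm

theorem TSOInv.zero (K : CommitTimes E T P) :
    TSOInv E T P 0 ⟨fun _ => 0, fun _ => []⟩ := by
  refine ⟨MemInv.zero K.wf K.init, fun τ => ⟨[], rfl, List.Pairwise.nil, fun w => ?_⟩⟩
  simp only [List.not_mem_nil, false_iff]
  rintro ⟨h1, -, h2, -⟩
  have := K.sched.pos w h1
  omega

variable {q : TSOState Tid Loc Val}

theorem TSOInv.stay (h : TSOInv E T P n q) (K : CommitTimes E T P)
    (hT : ∀ e, Proper E e → T e ≠ n + 1) (hP : ∀ e, Proper E e → P e ≠ n + 1) :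
    TSOInv E T P (n + 1) q := by
  refine ⟨h.mem.stay fun w hw _ hPw => hP w (K.proper_of_pos hw (by omega)) hPw, fun τ => ?_⟩
  exact (h.buf τ).congr (fun w hw _ => Or.inl (hT w hw)) fun w hw _ hPw => absurd hPw (hP w hw)

theorem TSOInv.read (h : TSOInv E T P n q) (K : CommitTimes E T P) {e : Event Tid Loc Val}
    (he : Proper E e) (hT : T e = n + 1) (hW : ¬ e.IsW) : TSOInv E T P (n + 1) q := by
  have hR : e.IsR := (ELab.isR_or_isW e.lab).resolve_right hW
  have hun : ∀ w, Proper E w → P w = n + 1 → w = e := fun w hw hPw =>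
    (K.cross e w he hw (by omega)).symm
  have hun' : ∀ w, Proper E w → T w = n + 1 → w = e := fun w hw hTw =>
    K.sched.inj w e hw he (by omega)
  refine ⟨h.mem.stay fun w hw hWw hPw => ?_, fun τ => ?_⟩
  · rw [hun w (K.proper_of_pos hw (by omega)) hPw] at hWw
    exact hW hWw
  · refine (h.buf τ).congr (fun w hw _ => ?_) fun w hw _ hPw => ?_
    · by_cases hTw : T w = n + 1
      · rw [hun' w hw hTw, K.eq e hR]
        exact Or.inr hT
      · exact Or.inl hTw
    · rw [hun w hw hPw, hT]

theorem TSOInv.write [DecidableEq Tid] (h : TSOInv E T P n q) (K : CommitTimes E T P)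
    {e : Event Tid Loc Val} (he : Proper E e) (hT : T e = n + 1) {τ : Tid} (hτ : e.tid = some τ)
    {x : Loc} {v : Val} (hl : e.lab = .write x v) :
    TSOInv E T P (n + 1) ⟨q.mem, Function.update q.buf τ ((x, v) :: q.buf τ)⟩ := by
  have hR : ¬ e.IsR := by simp [Event.IsR, hl, ELab.IsR]
  have hlt := K.lt e he hR
  have hun : ∀ w, Proper E w → P w ≠ n + 1 := by
    intro w hw hPw
    have := K.cross e w he hw (by omega)
    subst this
    omega
  have hun' : ∀ w, Proper E w → T w = n + 1 → w = e := fun w hw hTw =>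
    K.sched.inj w e hw he (by omega)
  refine ⟨h.mem.stay fun w hw _ hPw => hun w (K.proper_of_pos hw (by omega)) hPw, fun τ' => ?_⟩
  by_cases hττ : τ' = τ
  · subst hττ
    obtain ⟨L, h1, h2, h3⟩ := h.buf τ'
    refine ⟨e :: L, by simp [h1, hl], ?_, fun w => ?_⟩
    · rw [List.pairwise_cons]
      refine ⟨fun w hw => ?_, h2⟩
      have := ((h3 w).1 hw).2.2.1
      omega
    · rw [List.mem_cons, h3]
      constructor
      · rintro (rfl | ⟨h4, h5, h6, h7⟩)
        · exact ⟨he, hτ, hT.le, by omega⟩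
        · have := hun w h4
          exact ⟨h4, h5, by omega, by omega⟩
      · rintro ⟨h4, h5, h6, h7⟩
        by_cases hTw : T w = n + 1
        · exact Or.inl (hun' w h4 hTw)
        · exact Or.inr ⟨h4, h5, by omega, by omega⟩
  · simp only [Function.update_of_ne hττ]
    refine (h.buf τ').congr (fun w hw ht => Or.inl fun hTw => ?_)
      fun w hw _ hPw => absurd hPw (hun w hw)
    rw [hun' w hw hTw, hτ] at ht
    exact hττ (Option.some.inj ht).symm

variable [DecidableEq Loc]

theorem TSOInv.rmw (h : TSOInv E T P n q) (K : CommitTimes E T P) {e : Event Tid Loc Val}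
    (he : Proper E e) (hT : T e = n + 1) {x : Loc} {v v' : Val} (hl : e.lab = .rmw x v v') :
    TSOInv E T P (n + 1) ⟨Function.update q.mem x v', q.buf⟩ := by
  have hR : e.IsR := by simp [Event.IsR, hl, ELab.IsR]
  have hun : ∀ w, Proper E w → P w = n + 1 → w = e := fun w hw hPw =>
    (K.cross e w he hw (by omega)).symm
  have hun' : ∀ w, Proper E w → T w = n + 1 → w = e := fun w hw hTw =>
    K.sched.inj w e hw he (by omega)
  refine ⟨?_, fun τ => ?_⟩
  · have := h.mem.write (e := e) (a := v') he.1 (by simp [Event.IsW, hl, ELab.IsW])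
      ((K.eq e hR).trans hT) (by simp [Event.valW, hl, ELab.valW])
      (fun w hw _ hPw => hun w (K.proper_of_pos hw (by omega)) hPw)
    simpa [Event.loc, hl, ELab.loc] using this
  · refine (h.buf τ).congr (fun w hw _ => ?_) fun w hw _ hPw => ?_
    · by_cases hTw : T w = n + 1
      · rw [hun' w hw hTw, K.eq e hR]
        exact Or.inr hT
      · exact Or.inl hTw
    · rw [hun w hw hPw, hT]

/-- The write due for commit is the oldest entry: by `fifo` an older entry would have committed
before it, but everything in the buffer is still uncommitted. -/
theorem TSOInv.prop [DecidableEq Tid] (h : TSOInv E T P n q) (K : CommitTimes E T P)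
    {e : Event Tid Loc Val} (he : Proper E e) (hP : P e = n + 1) (hR : ¬ e.IsR) {τ : Tid}
    (hτ : e.tid = some τ) :
    ∃ b x v, q.buf τ = b ++ [(x, v)] ∧
      TSOInv E T P (n + 1) ⟨Function.update q.mem x v, Function.update q.buf τ b⟩ := by
  have hW : e.IsW := (ELab.isR_or_isW e.lab).resolve_left hR
  have hlt := K.lt e he hR
  obtain ⟨x, v, hl⟩ : ∃ x v, e.lab = .write x v := by
    cases hl : e.lab with
    | read x v => simp [Event.IsR, hl, ELab.IsR] at hR
    | write x v => exact ⟨x, v, rfl⟩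
    | rmw x v v' => simp [Event.IsR, hl, ELab.IsR] at hR
  have hun : ∀ w, Proper E w → P w = n + 1 → w = e := fun w hw hPw =>
    K.inj w e hw he (by omega)
  have hun' : ∀ w, Proper E w → T w ≠ n + 1 := by
    intro w hw hTw
    have := K.cross w e hw he (by omega)
    subst this
    omega
  obtain ⟨L, h1, h2, h3⟩ := h.buf τ
  have heL : e ∈ L := (h3 e).2 ⟨he, hτ, by omega, by omega⟩
  obtain ⟨L', d, rfl⟩ : ∃ L' d, L = L' ++ [d] := by
    rcases List.eq_nil_or_concat L with rfl | ⟨L', d, h⟩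
    · simp at heL
    · exact ⟨L', d, by simpa using h⟩
  rw [List.pairwise_append] at h2
  obtain ⟨h2, -, h4⟩ := h2
  have hed : e = d := by
    rcases List.mem_append.1 heL with he' | he'
    · obtain ⟨h5, h6, h7, h8⟩ := (h3 d).1 (by simp)
      have h9 := h4 e he' d (by simp)
      have hs := K.sched.lt_of_same_thread K.wf h5 he (h6.trans hτ.symm) h9
      have := K.fifo d e h5 he hs hW
      omega
    · simpa using he'
  subst hed
  rw [List.map_append] at h1
  obtain ⟨b, b', hb, hb1, hb2⟩ := List.map_eq_append_iff.1 h1.symm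
  obtain ⟨p, rfl, hp⟩ : ∃ p, b' = [p] ∧ ELab.write p.1 p.2 = e.lab := by
    rcases b' with _ | ⟨p, _ | ⟨p', b'⟩⟩
    · simp at hb2
    · exact ⟨p, rfl, by simpa using hb2⟩
    · simp at hb2
  rw [hl] at hp
  cases hp
  refine ⟨b, p.1, p.2, hb, ?_, fun τ' => ?_⟩
  · have := h.mem.write (e := e) (a := p.2) he.1 hW hP (by simp [Event.valW, hl, ELab.valW])
      (fun w hw _ hPw => hun w (K.proper_of_pos hw (by omega)) hPw)
    simpa [Event.loc, hl, ELab.loc] using this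
  · by_cases hττ : τ' = τ
    · subst hττ
      simp only [Function.update_self]
      refine ⟨L', hb1.symm, h2, fun w => ?_⟩
      have h5 := h3 w
      rw [List.mem_append, List.mem_singleton] at h5
      constructor
      · intro hw
        obtain ⟨h6, h7, h8, h9⟩ := h5.1 (Or.inl hw)
        have h10 := h4 w hw e (by simp)
        have : P w ≠ n + 1 := by
          intro hPw
          rw [hun w h6 hPw] at h10
          omega
        exact ⟨h6, h7, by omega, by omega⟩
      · rintro ⟨h6, h7, h8, h9⟩
        have := hun' w h6
        rcases h5.2 ⟨h6, h7, by omega, by omega⟩ with h10 | rfl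
        · exact h10
        · omega
    · simp only [Function.update_of_ne hττ]
      refine (h.buf τ').congr (fun w hw _ => Or.inl (hun' w hw)) fun w hw ht hPw => ?_
      rw [hun w hw hPw, hτ] at ht
      exact absurd (Option.some.inj ht).symm hττ

/-- Buffered writes commit after everything already in memory, and by `fifo` they commit in buffer
order. Applying the buffer to the memory therefore finds the visible write with the largest commit
time. -/
theorem TSOInv.exists_lastWrite (h : TSOInv E T P n q) (K : CommitTimes E T P) (τ : Tid)
    (x : Loc) :
    ∃ w, IsLastWrite E P (fun w => P w ≤ n ∨ (w.tid = some τ ∧ T w ≤ n)) x w ∧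
      w.valW = some (applyBuffer q.mem (q.buf τ) x) := by
  obtain ⟨L, h1, h2, h3⟩ := h.buf τ
  have key : ∀ (L : List (Event Tid Loc Val)) (b : List (Loc × Val)),
      L.map Event.lab = b.map (fun p => ELab.write p.1 p.2) →
      L.Pairwise (fun a b => T b < T a) →
      (∀ w ∈ L, Proper E w ∧ w.tid = some τ ∧ n < P w) →
      ∃ w, IsLastWrite E P (fun w => P w ≤ n ∨ w ∈ L) x w ∧
        w.valW = some (applyBuffer q.mem b x) := by
    intro L
    induction L with
    | nil =>
      intro b hb _ _
      have : b = [] := by simpa using hb.symm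
      subst this
      obtain ⟨w, hw, hv⟩ := h.mem x
      exact ⟨w, by simpa using hw, hv⟩
    | cons e L ih =>
      intro b hb hp hL
      rcases b with _ | ⟨p, b⟩
      · simp at hb
      rw [List.map_cons, List.map_cons, List.cons.injEq] at hb
      rw [List.pairwise_cons] at hp
      obtain ⟨w, hw, hv⟩ := ih b hb.2 hp.2 fun w hw => hL w (List.mem_cons_of_mem _ hw)
      obtain ⟨he, hτ, hn⟩ := hL e List.mem_cons_self
      have hW : e.IsW := by simp [Event.IsW, hb.1, ELab.IsW]
      have hloc : e.loc = p.1 := by simp [Event.loc, hb.1, ELab.loc]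
      have happ : applyBuffer q.mem (p :: b) =
        Function.update (applyBuffer q.mem b) p.1 p.2 := rfl
      by_cases hx : p.1 = x
      · refine ⟨e, ⟨he.1, hW, hloc.trans hx, Or.inr List.mem_cons_self, ?_⟩, ?_⟩
        · rintro w' - - - (h' | h')
          · omega
          · rcases List.mem_cons.1 h' with rfl | h'
            · exact le_rfl
            · obtain ⟨h4, h5, h6⟩ := hL w' (List.mem_cons_of_mem _ h')
              exact (K.fifo w' e h4 he (K.sched.lt_of_same_thread K.wf h4 he
                (h5.trans hτ.symm) (hp.1 w' h')) hW).le
        · rw [happ, ← hx]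
          simp [Event.valW, hb.1, ELab.valW]
      · obtain ⟨h4, h5, h6, h7, h8⟩ := hw
        refine ⟨w, ⟨h4, h5, h6, h7.imp_right (List.mem_cons_of_mem _), ?_⟩, ?_⟩
        · rintro w' hE' hW' hl' h'
          refine h8 w' hE' hW' hl' (h'.imp_right fun h' => ?_)
          rcases List.mem_cons.1 h' with rfl | h'
          · exact absurd (hloc.symm.trans hl') hx
          · exact h'
        · rw [happ, Function.update_of_ne (Ne.symm hx), hv]
  obtain ⟨w, ⟨h4, h5, h6, h7, h8⟩, hv⟩ := key L _ h1 h2 fun w hw =>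
    ⟨((h3 w).1 hw).1, ((h3 w).1 hw).2.1, ((h3 w).1 hw).2.2.2⟩
  refine ⟨w, ⟨h4, h5, h6, h7.imp_right fun h => ⟨((h3 w).1 h).2.1, ((h3 w).1 h).2.2.1⟩, ?_⟩, hv⟩
  intro w' hE' hW' hl' h'
  refine h8 w' hE' hW' hl' ?_
  by_cases hP : P w' ≤ n
  · exact Or.inl hP
  · have h'' := h'.resolve_left hP
    exact Or.inr ((h3 w').2 ⟨⟨hE', notMem_Init_of_tid h''.1⟩, h''.1, h''.2, not_le.1 hP⟩)

end CommitTimes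

/-! ### Total store order: from runs to graphs -/

section TSOGraph

variable {Tid : Type*} {Loc : Type*} {Val : Type*} [Zero Val]

/-- The write `w` is visible to the event `r`. -/
def Visible (T P : Event Tid Loc Val → ℕ) (r w : Event Tid Loc Val) : Prop :=
  P w < T r ∨ (w.tid = r.tid ∧ T w < T r)

/-- Commit order is taken as `mo`. Commit time increases along `ppo`, `rfe`, `mo` and `fr`, but not
along all of `po` and `rf`, since a read may take a value from its own buffer before that write
commits. For SC per location a plain read is therefore given the commit time of its source, and
execution time breaks ties. -/
theorem CommitTimes.exists_graph {E : Set (Event Tid Loc Val)} {T P : Event Tid Loc Val → ℕ}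
    (K : CommitTimes E T P) (src : Event Tid Loc Val → Event Tid Loc Val)
    (hsrc : ∀ r ∈ E, r.IsR → IsLastWrite E P (Visible T P r) r.loc (src r) ∧
      (src r).valW = r.valR) :
    ∃ G ∈ graphsTSO Tid Loc Val ∩ graphsFair Tid Loc Val, E = G.E := by
  classical
  have hs : ∀ r, r ∈ E → r.IsR → src r ∈ E ∧ (src r).IsW ∧ (src r).loc = r.loc ∧
      (src r).valW = r.valR := fun r h1 h2 =>
    ⟨(hsrc r h1 h2).1.1, (hsrc r h1 h2).1.2.1, (hsrc r h1 h2).1.2.2.1, (hsrc r h1 h2).2⟩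
  let G := keyGraph E K.wf P K.inj_loc src hs
  have hproper : ∀ r ∈ E, r.IsR → Proper E r := fun r h1 h2 =>
    ⟨h1, fun hi => not_isR_of_mem_Init hi h2⟩
  have hpo : ∀ a b, a ∈ E → b ∈ E → seqBefore a b → b.IsW → P a < P b := by
    intro a b ha hb h hW
    have hb' : Proper E b := ⟨hb, h.not_init⟩
    by_cases hi : a ∈ Init Tid Loc Val
    · rw [K.init a hi]
      exact K.pos hb'
    · exact K.fifo a b ⟨ha, hi⟩ hb' h hW
  have hsame : ∀ a b, a ∈ E → Proper E b → a.tid = b.tid → T a < T b → seqBefore a b := by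
    intro a b ha hb ht hlt
    have ha' : Proper E a := by
      refine ⟨ha, fun hi => ?_⟩
      obtain ⟨τ, k, h1, -⟩ := K.wf.exists_tid_sn hb
      rw [tid_of_mem_Init hi, h1] at ht
      cases ht
    exact K.sched.lt_of_same_thread K.wf ha' hb ht hlt
  have hsrcT : ∀ r ∈ E, r.IsR → T (src r) < T r := by
    intro r h1 h2
    obtain ⟨h3, -, -, h4, -⟩ := (hsrc r h1 h2).1
    rcases h4 with h4 | h4
    · exact (K.le h3).trans_lt h4
    · exact h4.2
  have hfr : ∀ a b, G.fr a b → Proper E a ∧ a.IsR ∧ b.IsW ∧ P (src a) < P b ∧ T a < P b := by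
    rintro a b ⟨⟨e, ⟨haE, haR, rfl⟩, hmo⟩, hne⟩
    have ha' := hproper a haE haR
    obtain ⟨-, hbE, -, hbW, hloc, hlt⟩ := hmo
    obtain ⟨⟨-, -, h3, h4, h5⟩, -⟩ := hsrc a haE haR
    refine ⟨ha', haR, hbW, hlt, ?_⟩
    by_contra hc
    rcases (not_lt.1 hc).eq_or_lt with h | h
    · exact hne ⟨K.cross a b ha' (K.proper_of_pos hbE (by omega)) h.symm, haE⟩
    · have := h5 b hbE hbW (hloc.symm.trans h3) (Or.inl h)
      omega
  refine ⟨G, ⟨⟨?_, ?_⟩, keyGraph_mo_finite E K.wf P K.inj_loc src hs, ?_⟩, rfl⟩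
  · refine closureIrrefl_of_measure P fun a b h => ?_
    rcases h with ⟨⟨ha, hb, h⟩, hp⟩ | ⟨⟨h1, h2, rfl⟩, hp⟩ | h | h
    · by_cases hW : b.IsW
      · exact hpo a b ha hb h hW
      · have hbR : b.IsR := (ELab.isR_or_isW b.lab).resolve_right hW
        have haR : a.IsR := by
          by_contra hR
          refine hp ⟨⟨(ELab.isR_or_isW a.lab).resolve_left hR, fun h => ?_⟩, hbR, fun h => ?_⟩
          · exact hR ((ELab.isRMW_iff _).1 h).1
          · exact hW ((ELab.isRMW_iff _).1 h).2
        rw [K.eq a haR, K.eq b hbR]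
        exact K.sched.mono a b ha hb h
    · obtain ⟨h3, -, -, h4, -⟩ := (hsrc b h1 h2).1
      rw [K.eq b h2]
      rcases h4 with h4 | h4
      · exact h4
      -- A source visible only through the buffer belongs to the thread of the read and precedes it
      -- in program order, so the edge is not external.
      · exact absurd ⟨h3, h1, hsame _ b h3 (hproper b h1 h2) h4.1 h4.2⟩ hp
    · exact h.2.2.2.2.2
    · obtain ⟨-, h2, -, -, h4⟩ := hfr a b h
      rwa [K.eq a h2]
  · refine closureIrrefl_of_lex (fun e => if e.IsW then P e else P (src e)) T fun a b h => ?_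
    rcases h with ⟨⟨ha, hb, h⟩, hl⟩ | ⟨h1, h2, rfl⟩ | h | h
    · refine Or.inr ⟨?_, K.sched.mono a b ha hb h⟩
      have hT := K.sched.mono a b ha hb h
      have hb' : Proper E b := ⟨hb, h.not_init⟩
      by_cases hbW : b.IsW
      · by_cases haW : a.IsW
        · simpa only [if_pos haW, if_pos hbW] using (hpo a b ha hb h hbW).le
        · have haR : a.IsR := (ELab.isR_or_isW a.lab).resolve_right haW
          simp only [if_neg haW, if_pos hbW]
          obtain ⟨h3, -, -, h4, -⟩ := (hsrc a ha haR).1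
          have hab : a.tid = b.tid := ((WellFormed.seqBefore_iff (hproper a ha haR)).1 h).1
          rcases h4 with h4 | h4
          · have := K.le hb
            omega
          · exact (hpo _ b h3 hb (hsame _ b h3 hb' (h4.1.trans hab) (by omega)) hbW).le
      · have hbR : b.IsR := (ELab.isR_or_isW b.lab).resolve_right hbW
        obtain ⟨-, -, -, -, h5⟩ := (hsrc b hb hbR).1
        simp only [if_neg hbW]
        by_cases haW : a.IsW
        · simp only [if_pos haW]
          refine h5 a ha haW hl ?_
          rcases h with h | h
          · exact Or.inl (by rw [K.init a h.1]; exact K.sched.pos b hb')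
          · exact Or.inr ⟨h.1, hT⟩
        · have haR : a.IsR := (ELab.isR_or_isW a.lab).resolve_right haW
          simp only [if_neg haW]
          obtain ⟨h3, h3', h3'', h4, -⟩ := (hsrc a ha haR).1
          have hab : a.tid = b.tid := ((WellFormed.seqBefore_iff (hproper a ha haR)).1 h).1
          refine h5 _ h3 h3' (h3''.trans hl) ?_
          rcases h4 with h4 | h4
          · exact Or.inl (h4.trans hT)
          · exact Or.inr ⟨h4.1.trans hab, h4.2.trans hT⟩
    · refine Or.inr ⟨?_, hsrcT b h1 h2⟩
      obtain ⟨h3, h3', -, h4, -⟩ := (hsrc b h1 h2).1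
      simp only [if_pos h3']
      by_cases hbW : b.IsW
      · simp only [if_pos hbW]
        rcases h4 with h4 | h4
        · rw [K.eq b h2]
          exact h4.le
        · exact (hpo _ b h3 h1 (hsame _ b h3 (hproper b h1 h2) h4.1 h4.2) hbW).le
      · simp only [if_neg hbW, le_refl]
    · obtain ⟨-, -, h1, h2, -, h3⟩ := h
      simp only [if_pos h1, if_pos h2]
      exact Or.inl h3
    · obtain ⟨-, h2, h3, h4, h5⟩ := hfr a b h
      refine Or.inl ?_
      simp only [if_pos h3]
      by_cases haW : a.IsW
      · simp only [if_pos haW]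
        rwa [K.eq a h2]
      · simp only [if_neg haW]
        exact h4
  · intro b _
    exact (K.sched.finite_le (P b)).subset fun a ha => ⟨(hfr a b ha).1, (hfr a b ha).2.2.2.2.le⟩

end TSOGraph

/-! ### Flushing of buffers and commit times of a run -/

section TSORun

variable {Tid : Type*} {Loc : Type*} {Val : Type*}

theorem IsBehavior.congr {Sil : Type*} {l l' : ℕ → Option ((Tid × ELab Loc Val) ⊕ Sil)}
    {β : Behavior Tid Loc Val} (h : IsBehavior l β)
    (hl : ∀ n σ, l' n = some (Sum.inl σ) ↔ l n = some (Sum.inl σ)) : IsBehavior l' β := by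
  have : ∀ τ, OfThread l' τ = OfThread l τ := by
    intro τ
    funext n
    simp only [OfThread, hl]
  intro τ k a
  rw [this, h τ k a]
  simp only [hl]

theorem tso_enabled_prop [DecidableEq Tid] [DecidableEq Loc] [Zero Val]
    {q : TSOState Tid Loc Val} {τ : Tid} :
    (memTSO Tid Loc Val).Enabled q (Sum.inr τ) ↔ q.buf τ ≠ [] := by
  constructor
  · rintro ⟨q', b, x, a, h, -⟩ hn
    rw [hn] at h
    simp at h
  · intro h
    rcases List.eq_nil_or_concat (q.buf τ) with h' | ⟨b, p, h'⟩
    · exact absurd h' h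
    · exact ⟨_, b, p.1, p.2, by simpa using h', rfl⟩

/-- A run that eventually only stutters can be extended by propagation steps such that it becomes
fair also when regarded as an infinite run. -/
theorem tso_flush [DecidableEq Tid] [DecidableEq Loc] [Zero Val] [Fintype Tid]
    {β : Behavior Tid Loc Val} (s : ℕ) :
    ∀ (N : ℕ) (q : ℕ → TSOState Tid Loc Val) (l : ℕ → Option ((Tid × ELab Loc Val) ⊕ Tid)),
      (memTSO Tid Loc Val).StutterRun q l → (∀ n, N ≤ n → l n = none) → IsBehavior l β →
      ∑ τ, ((q N).buf τ).length = s →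
      ∃ q l, (memTSO Tid Loc Val).StutterRun q l ∧ IsBehavior l β ∧
        ∀ (τ : Tid) (k : ℕ), (∀ j, k ≤ j → (q j).buf τ ≠ []) →
          ∃ j, k ≤ j ∧ l j = some (Sum.inr τ) := by
  induction s with
  | zero =>
    intro N q l hr hN hb hs
    refine ⟨q, l, hr, hb, fun τ k hk => ?_⟩
    have hq : ∀ n, N ≤ n → q n = q N := by
      intro n hn
      induction n, hn using Nat.le_induction with
      | base => rfl
      | succ n hn ih =>
        have := hr.step n
        rw [hN n hn] at this
        rw [← ih]
        exact this
    have h0 : ((q N).buf τ).length = 0 := by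
      rw [Finset.sum_eq_zero_iff] at hs
      exact hs τ (Finset.mem_univ τ)
    refine absurd (List.length_eq_zero_iff.1 h0) ?_
    have := hk (max k N) (le_max_left _ _)
    rwa [hq _ (le_max_right _ _)] at this
  | succ s ih =>
    intro N q l hr hN hb hs
    obtain ⟨τ, hτ⟩ : ∃ τ, (q N).buf τ ≠ [] := by
      by_contra hc
      push Not at hc
      simp [hc] at hs
    obtain ⟨q', b, x, a, hbuf, hq'⟩ := tso_enabled_prop.2 hτ
    have hl : ∀ n, n ≠ N → Function.update l N (some (Sum.inr τ)) n = l n :=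
      fun n hn => Function.update_of_ne hn _ _
    -- The stuttering step `N` is replaced by a propagation, which shortens the buffers by one entry
    -- in total and leaves the observable labels unchanged.
    refine ih (N + 1) (fun n => if n ≤ N then q n else q')
      (Function.update l N (some (Sum.inr τ))) ⟨?_, ?_⟩ ?_ ?_ ?_
    · simp [hr.start]
    · intro n
      rcases lt_trichotomy n N with h | rfl | h
      · rw [hl n h.ne]
        simpa [h.le, Nat.succ_le_of_lt h] using hr.step n
      · simp only [Function.update_self, le_refl, if_true, Nat.not_succ_le_self, if_false]
        exact ⟨b, x, a, hbuf, hq'⟩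
      · rw [hl n h.ne', hN n h.le]
        simp [LTS.StepOpt, show ¬ n ≤ N by omega, show ¬ n + 1 ≤ N by omega]
    · intro n hn
      rw [hl n (by omega), hN n (by omega)]
    · refine hb.congr fun n σ => ?_
      by_cases h : n = N
      · subst h
        simp [hN n le_rfl]
      · rw [hl n h]
    · simp only [Nat.not_succ_le_self, if_false]
      have h1 : ∀ τ', ((q N).buf τ').length =
          (q'.buf τ').length + if τ' = τ then 1 else 0 := by
        intro τ'
        rw [hq']
        by_cases h : τ' = τ
        · subst h
          simp [hbuf]
        · simp [h]
      simp only [h1, Finset.sum_add_distrib, Finset.sum_ite_eq', Finset.mem_univ, if_true] at hs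
      omega

/-- A finite run is memory-fair even if it ends with pending writes, whereas every write needs a
commit time. Such runs are flushed first. -/
theorem tso_exists_strongly_fair [DecidableEq Tid] [DecidableEq Loc] [Zero Val] [Finite Tid]
    {β : Behavior Tid Loc Val} (h : β ∈ BehMF (memTSO Tid Loc Val)) :
    ∃ q l, (memTSO Tid Loc Val).StutterRun q l ∧ IsBehavior l β ∧
        ∀ (τ : Tid) (k : ℕ), (∀ j, k ≤ j → (q j).buf τ ≠ []) →
          ∃ j, k ≤ j ∧ l j = some (Sum.inr τ) := by
  have := Fintype.ofFinite Tid
  obtain ⟨q, l, hr, hf, hb⟩ := (mem_BehMF_iff _ _).1 h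
  rcases hf with ⟨N, hN⟩ | hf
  · exact tso_flush _ N q l hr hN hb rfl
  · exact ⟨q, l, hr, hb, fun τ k hk => hf τ k fun j hj => tso_enabled_prop.2 (hk j hj)⟩

/-- Step `n` is a plain write of the thread `τ`. -/
def WriteStep (l : ℕ → Option ((Tid × ELab Loc Val) ⊕ Tid)) (τ : Tid) (n : ℕ) : Prop :=
  ∃ x v, l n = some (Sum.inl (τ, ELab.write x v))

/-- Step `n` is a propagation step of the thread `τ`. -/
def PropStep (l : ℕ → Option ((Tid × ELab Loc Val) ⊕ Tid)) (τ : Tid) (n : ℕ) : Prop :=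
  l n = some (Sum.inr τ)

-- Writes add one entry and propagations remove one. This count suffices to match propagations with
-- writes without following the buffer contents.
open Classical in
theorem tso_buffer_length [DecidableEq Tid] [DecidableEq Loc] [Zero Val]
    {q : ℕ → TSOState Tid Loc Val} {l : ℕ → Option ((Tid × ELab Loc Val) ⊕ Tid)}
    (hr : (memTSO Tid Loc Val).StutterRun q l) (τ : Tid) (n : ℕ) :
    ((q n).buf τ).length + Nat.count (PropStep l τ) n = Nat.count (WriteStep l τ) n := by
  induction n with
  | zero =>
    rw [hr.start]
    simp [memTSO]
  | succ n ih =>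
    have hstep := hr.step n
    rw [Nat.count_succ, Nat.count_succ]
    rcases hl : l n with _ | ⟨⟨τ', a⟩⟩ | τ'
    · rw [hl] at hstep
      simp only [PropStep, WriteStep, hl]
      rw [show q (n + 1) = q n from hstep]
      simpa using ih
    · rw [hl] at hstep
      change tsoStep (q n) (Sum.inl (τ', a)) (q (n + 1)) at hstep
      simp only [PropStep, WriteStep, hl]
      cases a with
      | read x v =>
        rw [hstep.2]
        simpa using ih
      | write x v =>
        rw [show q (n + 1) = _ from hstep]
        by_cases h : τ' = τ
        · subst h
          simp
          omega
        · simpa [h, Function.update_of_ne (Ne.symm h)] using ih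
      | rmw x v v' =>
        rw [hstep.2.2]
        simpa using ih
    · rw [hl] at hstep
      obtain ⟨b, x, v, hb, hq⟩ := hstep
      simp only [PropStep, WriteStep, hl]
      rw [hq]
      by_cases h : τ' = τ
      · subst h
        rw [hb] at ih
        simp at ih ⊢
        omega
      · simpa [h, Function.update_of_ne (Ne.symm h)] using ih

theorem unbounded_count {p : ℕ → Prop} [DecidablePred p] {m : ℕ}
    (h : ∀ k, m ≤ k → ∃ j, k ≤ j ∧ p j) (c : ℕ) : ∃ n, m ≤ n ∧ c ≤ Nat.count p n := by
  induction c with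
  | zero => exact ⟨m, le_rfl, Nat.zero_le _⟩
  | succ c ih =>
    obtain ⟨n, hn, hc⟩ := ih
    obtain ⟨j, hj, hp⟩ := h n hn
    refine ⟨j + 1, by omega, ?_⟩
    rw [Nat.count_succ, if_pos hp]
    have := Nat.count_monotone p hj
    omega

/-- Because buffers are FIFO, a plain write commits at the propagation step of its thread that has
the same rank among propagations as the write has among plain writes. -/
theorem tso_exists_commitTimes [DecidableEq Tid] [DecidableEq Loc] [Zero Val]
    {q : ℕ → TSOState Tid Loc Val} {l : ℕ → Option ((Tid × ELab Loc Val) ⊕ Tid)}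
    (hr : (memTSO Tid Loc Val).StutterRun q l)
    (hf : ∀ (τ : Tid) (k : ℕ), (∀ j, k ≤ j → (q j).buf τ ≠ []) →
      ∃ j, k ≤ j ∧ l j = some (Sum.inr τ))
    {E : Set (Event Tid Loc Val)} (hE : WellFormed E)
    {T : Event Tid Loc Val → ℕ} (hT : Schedule E T) (hl : ∀ n, ObsSpec E T n (l n)) :
    ∃ P, CommitTimes E T P ∧
      (∀ n τ, l n = some (Sum.inr τ) → ∃ w, Proper E w ∧ ¬ w.IsR ∧ w.tid = some τ ∧ P w = n + 1) ∧
      ∀ w, Proper E w → ¬ w.IsR → ∀ n, P w = n + 1 → ∃ τ, l n = some (Sum.inr τ) := by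
  classical
  have hlen := tso_buffer_length hr
  have hwstep : ∀ e, Proper E e → ¬ e.IsR → ∃ m τ, e.tid = some τ ∧ T e = m + 1 ∧
      WriteStep l τ m := by
    intro e he hR
    obtain ⟨m, hm⟩ := Nat.exists_eq_succ_of_ne_zero (hT.pos e he).ne'
    obtain ⟨τ, k, hτ, -⟩ := hE.exists_tid_sn he
    refine ⟨m, τ, hτ, hm, ?_⟩
    have := (hl m τ e.lab).2 ⟨e, he, hm, hτ, rfl⟩
    cases hlab : e.lab with
    | read x v => simp [Event.IsR, hlab, ELab.IsR] at hR
    | write x v => exact ⟨x, v, by rw [this, hlab]⟩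
    | rmw x v v' => simp [Event.IsR, hlab, ELab.IsR] at hR
  -- Without a matching propagation the buffer would stay nonempty forever after the write, so by
  -- fairness there would be infinitely many propagations, exceeding the rank of the write.
  have hex : ∀ τ m, WriteStep l τ m →
      ∃ n, PropStep l τ n ∧ Nat.count (PropStep l τ) n = Nat.count (WriteStep l τ) m := by
    intro τ m hm
    by_contra hc
    have hle : ∀ n, Nat.count (PropStep l τ) n ≤ Nat.count (WriteStep l τ) m := by
      intro n
      by_contra hlt
      obtain ⟨n', h1, h2⟩ := exists_count_eq (PropStep l τ) _ n (not_le.1 hlt)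
      exact hc ⟨n', h1, h2⟩
    have hne : ∀ j, m + 1 ≤ j → (q j).buf τ ≠ [] := by
      intro j hj h0
      have h1 := hlen τ j
      have h2 := Nat.count_monotone (WriteStep l τ) hj
      rw [Nat.count_succ, if_pos hm] at h2
      have h3 := hle j
      rw [h0] at h1
      simp only [List.length_nil] at h1
      omega
    obtain ⟨n, -, hn⟩ := unbounded_count (p := PropStep l τ) (m := m + 1)
      (fun k hk => hf τ k fun j hj => hne j (by omega)) (Nat.count (WriteStep l τ) m + 1)
    have := hle n
    omega
  have hexP : ∀ e : Event Tid Loc Val, ∃ p, (e ∈ Init Tid Loc Val → p = 0) ∧ (e.IsR → p = T e) ∧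
      (Proper E e → ¬ e.IsR → ∃ n m τ, p = n + 1 ∧ e.tid = some τ ∧ T e = m + 1 ∧
        WriteStep l τ m ∧ PropStep l τ n ∧
        Nat.count (PropStep l τ) n = Nat.count (WriteStep l τ) m) := by
    intro e
    by_cases hi : e ∈ Init Tid Loc Val
    · exact ⟨0, fun _ => rfl, fun hR => absurd hR (not_isR_of_mem_Init hi),
        fun he => absurd hi he.2⟩
    · by_cases h : Proper E e ∧ ¬ e.IsR
      · obtain ⟨m, τ, h1, h2, h3⟩ := hwstep e h.1 h.2
        obtain ⟨n, h4, h5⟩ := hex τ m h3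
        exact ⟨n + 1, fun hi' => absurd hi' hi, fun hR => absurd hR h.2,
          fun _ _ => ⟨n, m, τ, rfl, h1, h2, h3, h4, h5⟩⟩
      · exact ⟨T e, fun hi' => absurd hi' hi, fun _ => rfl, fun h1 h2 => absurd ⟨h1, h2⟩ h⟩
  choose P hP0 hPR hPW using hexP
  have hnonempty : ∀ τ n, PropStep l τ n →
      Nat.count (PropStep l τ) n < Nat.count (WriteStep l τ) n := by
    intro τ n hn
    have hstep := hr.step n
    rw [hn] at hstep
    have h1 := tso_enabled_prop.1 ⟨_, hstep⟩
    have h2 := hlen τ n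
    have := List.length_pos_iff.2 h1
    omega
  have hRstep : ∀ e, Proper E e → ∃ m τ, T e = m + 1 ∧ l m = some (Sum.inl (τ, e.lab)) := by
    intro e he
    obtain ⟨m, hm⟩ := Nat.exists_eq_succ_of_ne_zero (hT.pos e he).ne'
    obtain ⟨τ, k, hτ, -⟩ := hE.exists_tid_sn he
    exact ⟨m, τ, hm, (hl m τ e.lab).2 ⟨e, he, hm, hτ, rfl⟩⟩
  have hlt : ∀ e, Proper E e → ¬ e.IsR → T e < P e := by
    intro e he hR
    obtain ⟨n, m, τ, h1, h2, h3, h4, h5, h6⟩ := hPW e he hR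
    have := hnonempty τ n h5
    rw [h6] at this
    have := lt_of_count_lt this
    omega
  have hcross : ∀ a b, Proper E a → Proper E b → T a = P b → a = b := by
    intro a b ha hb hab
    by_cases hbR : b.IsR
    · exact hT.inj a b ha hb (by rw [hab, hPR b hbR])
    · obtain ⟨n, m, τ, h1, h2, h3, h4, h5, h6⟩ := hPW b hb hbR
      obtain ⟨m', τ', h7, h8⟩ := hRstep a ha
      have : m' = n := by omega
      subst this
      rw [show l m' = some (Sum.inr τ) from h5] at h8
      cases h8
  refine ⟨P, ⟨hE, hT, hP0, hPR, hlt, ?_, hcross, ?_⟩, ?_, ?_⟩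
  · intro a b ha hb hab
    by_cases haR : a.IsR
    · exact hcross a b ha hb (by rw [← hPR a haR, hab])
    · by_cases hbR : b.IsR
      · exact (hcross b a hb ha (by rw [← hPR b hbR, hab])).symm
      · obtain ⟨n, m, τ, h1, h2, h3, h4, h5, h6⟩ := hPW a ha haR
        obtain ⟨n', m', τ', h1', h2', h3', h4', h5', h6'⟩ := hPW b hb hbR
        have hn : n = n' := by omega
        subst hn
        have hτ : τ = τ' := by
          rw [PropStep, show l n = some (Sum.inr τ) from h5] at h5'
          simpa using h5'
        subst hτ
        have hm := count_eq_unique h4 h4' (h6.symm.trans h6')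
        exact hT.inj a b ha hb (by omega)
  · intro a b ha hb hab hbW
    have hTab := hT.mono a b ha.1 hb.1 hab
    have hbTP : T b ≤ P b := by
      by_cases hbR : b.IsR
      · exact (hPR b hbR).ge
      · exact (hlt b hb hbR).le
    by_cases haR : a.IsR
    · rw [hPR a haR]
      omega
    · obtain ⟨n, m, τ, h1, h2, h3, h4, h5, h6⟩ := hPW a ha haR
      have htid : b.tid = some τ := by
        rw [← ((WellFormed.seqBefore_iff ha).1 hab).1, h2]
      by_cases hbR : b.IsR
      · obtain ⟨m', hm'⟩ := Nat.exists_eq_succ_of_ne_zero (hT.pos b hb).ne'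
        have hlb := (hl m' τ b.lab).2 ⟨b, hb, hm', htid, rfl⟩
        have hstep := hr.step m'
        rw [hlb] at hstep
        cases hlab : b.lab with
        | read x v => simp [Event.IsW, hlab, ELab.IsW] at hbW
        | write x v => simp [Event.IsR, hlab, ELab.IsR] at hbR
        | rmw x v v' =>
          rw [hlab] at hstep
          -- An update requires an empty buffer, so all earlier plain writes of its thread have been
          -- propagated by then.
          have hnil : (q m').buf τ = [] := hstep.1
          have h7 := hlen τ m'
          rw [hnil] at h7
          have h8 := Nat.count_monotone (WriteStep l τ) (show m + 1 ≤ m' by omega)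
          rw [Nat.count_succ, if_pos h4] at h8
          simp only [List.length_nil] at h7
          have h9 : n < m' := lt_of_count_lt (P := PropStep l τ) (by omega)
          rw [hPR b hbR]
          omega
      · obtain ⟨n', m', τ', h1', h2', h3', h4', h5', h6'⟩ := hPW b hb hbR
        rw [htid] at h2'
        cases h2'
        have h7 := Nat.count_strict_mono h4 (show m < m' by omega)
        have h9 : n < n' := lt_of_count_lt (P := PropStep l τ) (by omega)
        omega
  · intro n τ hn
    have h1 := hnonempty τ n hn
    obtain ⟨m, h2, h3⟩ := exists_count_eq (WriteStep l τ) _ n h1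
    obtain ⟨x, v, h4⟩ := h2
    obtain ⟨e, he, hTe, hτ, hlab⟩ := (hl m τ _).1 h4
    have heR : ¬ e.IsR := by simp [Event.IsR, hlab, ELab.IsR]
    refine ⟨e, he, heR, hτ, ?_⟩
    obtain ⟨n', m', τ', h1', h2', h3', h4', h5', h6'⟩ := hPW e he heR
    rw [hτ] at h2'
    cases h2'
    have : m' = m := by omega
    subst this
    have := count_eq_unique h5' hn (h6'.trans h3)
    omega
  · intro w hw hR n hn
    obtain ⟨n', m', τ', h1', h2', h3', h4', h5', h6'⟩ := hPW w hw hR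
    have : n = n' := by omega
    subst this
    exact ⟨τ', h5'⟩

theorem tso_inv [DecidableEq Tid] [DecidableEq Loc] [Zero Val]
    {q : ℕ → TSOState Tid Loc Val} {l : ℕ → Option ((Tid × ELab Loc Val) ⊕ Tid)}
    (hr : (memTSO Tid Loc Val).StutterRun q l)
    {E : Set (Event Tid Loc Val)} {T P : Event Tid Loc Val → ℕ} (K : CommitTimes E T P)
    (hl : ∀ n, ObsSpec E T n (l n))
    (hP : ∀ n τ, l n = some (Sum.inr τ) →
      ∃ w, Proper E w ∧ ¬ w.IsR ∧ w.tid = some τ ∧ P w = n + 1)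
    (hP' : ∀ w, Proper E w → ¬ w.IsR → ∀ n, P w = n + 1 → ∃ τ, l n = some (Sum.inr τ)) (n : ℕ) :
    TSOInv E T P n (q n) := by
  induction n with
  | zero =>
    rw [hr.start]
    exact TSOInv.zero K
  | succ n ih =>
    have hstep := hr.step n
    rcases hln : l n with _ | ⟨⟨τ, a⟩⟩ | τ
    · rw [hln] at hstep
      rw [show q (n + 1) = q n from hstep]
      have hTn : ∀ e, Proper E e → T e ≠ n + 1 := by
        intro e he hTe
        obtain ⟨τ, k, h1, -⟩ := K.wf.exists_tid_sn he
        have := (hl n τ e.lab).2 ⟨e, he, hTe, h1, rfl⟩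
        rw [hln] at this
        cases this
      refine ih.stay K hTn fun e he hPe => ?_
      by_cases hR : e.IsR
      · exact hTn e he (by rw [← K.eq e hR, hPe])
      · obtain ⟨τ, h⟩ := hP' e he hR n hPe
        rw [hln] at h
        cases h
    · obtain ⟨e, he, hTe, hτ, rfl⟩ := (hl n τ a).1 hln
      rw [hln] at hstep
      change tsoStep (q n) (Sum.inl (τ, e.lab)) (q (n + 1)) at hstep
      cases hlab : e.lab with
      | read x v =>
        rw [hlab] at hstep
        rw [hstep.2]
        exact ih.read K he hTe (by simp [Event.IsW, hlab, ELab.IsW])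
      | write x v =>
        rw [hlab] at hstep
        rw [show q (n + 1) = _ from hstep]
        exact ih.write K he hTe hτ hlab
      | rmw x v v' =>
        rw [hlab] at hstep
        rw [hstep.2.2]
        exact ih.rmw K he hTe hlab
    · rw [hln] at hstep
      obtain ⟨w, hw, hR, hτ, hPw⟩ := hP n τ hln
      obtain ⟨b, x, v, hb, hinv⟩ := ih.prop K hw hPw hR hτ
      obtain ⟨b', x', v', hb', hq'⟩ := hstep
      rw [hb] at hb'
      obtain ⟨rfl, h2⟩ := List.append_inj' hb' rfl
      simp only [List.cons.injEq, Prod.mk.injEq, and_true] at h2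
      obtain ⟨rfl, rfl⟩ := h2
      rw [hq']
      exact hinv

theorem tso_read_value [DecidableEq Tid] [DecidableEq Loc] {q q' : TSOState Tid Loc Val} {τ : Tid}
    {a : ELab Loc Val} (hR : a.IsR) (h : tsoStep q (Sum.inl (τ, a)) q') :
    a.valR = some (applyBuffer q.mem (q.buf τ) a.loc) := by
  cases a with
  | read x v => simp [ELab.valR, ELab.loc, h.1]
  | write x v => exact hR.elim
  | rmw x v v' =>
    obtain ⟨h1, h2, -⟩ := h
    rw [h1]
    simp [ELab.valR, ELab.loc, applyBuffer, h2]

theorem tso_behMF_subset [DecidableEq Tid] [DecidableEq Loc] [Zero Val] [Finite Tid] :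
    BehMF (memTSO Tid Loc Val) ⊆ BehDecl (graphsTSO Tid Loc Val ∩ graphsFair Tid Loc Val) := by
  intro β hβ
  obtain ⟨q, l, hr, hb, hf⟩ := tso_exists_strongly_fair hβ
  obtain ⟨T, hT, hl⟩ := exists_schedule hb
  have hE := wellFormed_eventsOf β
  change ∃ G ∈ graphsTSO Tid Loc Val ∩ graphsFair Tid Loc Val, eventsOf β = G.E
  generalize eventsOf β = E at *
  obtain ⟨P, K, hP, hP'⟩ := tso_exists_commitTimes hr hf hE hT hl
  have hinv := tso_inv hr K hl hP hP'
  have hex : ∀ r, ∃ e, r ∈ E → r.IsR → IsLastWrite E P (Visible T P r) r.loc e ∧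
      e.valW = r.valR := by
    intro r
    by_cases h : r ∈ E ∧ r.IsR
    · have hr' : Proper E r := ⟨h.1, fun hi => not_isR_of_mem_Init hi h.2⟩
      obtain ⟨n, hn⟩ := Nat.exists_eq_succ_of_ne_zero (hT.pos r hr').ne'
      obtain ⟨τ, k, h1, -⟩ := hE.exists_tid_sn hr'
      have hln := (hl n τ r.lab).2 ⟨r, hr', hn, h1, rfl⟩
      have hstep := hr.step n
      rw [hln] at hstep
      obtain ⟨w, hw, hv⟩ := (hinv n).exists_lastWrite K τ r.loc
      refine ⟨w, fun _ _ => ⟨?_, ?_⟩⟩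
      · have : Visible T P r = fun w => P w ≤ n ∨ (w.tid = some τ ∧ T w ≤ n) := by
          funext w
          simp only [Visible, hn, Nat.lt_succ_iff, h1]
        rwa [this]
      · rw [hv]
        exact (tso_read_value h.2 hstep).symm
    · exact ⟨r, fun h1 h2 => absurd ⟨h1, h2⟩ h⟩
  choose src hsrc using hex
  exact K.exists_graph src hsrc

end TSORun

/-! ### Total store order: from graphs to runs -/

section TSOGraphToRun

variable {Tid : Type*} {Loc : Type*} {Val : Type*} [Zero Val]

theorem EGraph.ppo_of_isR {G : EGraph Tid Loc Val} {a b : Event Tid Loc Val} (h : G.po a b)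
    (ha : a.IsR) : G.ppo a b :=
  ⟨h, fun hc => hc.1.2 ((ELab.isRMW_iff _).2 ⟨ha, hc.1.1⟩)⟩

theorem EGraph.ppo_of_isW {G : EGraph Tid Loc Val} {a b : Event Tid Loc Val} (h : G.po a b)
    (hb : b.IsW) : G.ppo a b :=
  ⟨h, fun hc => hc.2.2 ((ELab.isRMW_iff _).2 ⟨hc.2.1, hb⟩)⟩

/-- Given commit positions `f` compatible with `ppo`, there are execution times `T` and commit times
`P` such that the commit times are ordered like `f`. A write is executed just before the first
commit of itself or of a later event of its thread. -/
theorem EGraph.exists_commitTimes [Finite Tid] (G : EGraph Tid Loc Val)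
    {f : Event Tid Loc Val → ℕ} (hf : ∀ a b, Proper G.E a → Proper G.E b → f a = f b → a = b)
    (hfp : ∀ a b, Proper G.E a → Proper G.E b → G.ppo a b → f a < f b) :
    ∃ T P, CommitTimes G.E T P ∧
      ∀ a b, Proper G.E a → Proper G.E b → f a < f b → P a < P b := by
  classical
  have hE := G.wf
  -- A read after `e` in its thread may have an earlier position in `f` than the write `e`, yet `e`
  -- must be executed first. `I e` is the least position among `e` and its program-order successors.
  set I : Event Tid Loc Val → ℕ :=
    fun e => sInf {n | ∃ e', Proper G.E e' ∧ (e' = e ∨ seqBefore e e') ∧ f e' = n} with hI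
  have hIle : ∀ e e', Proper G.E e' → (e' = e ∨ seqBefore e e') → I e ≤ f e' :=
    fun e e' h1 h2 => Nat.sInf_le ⟨e', h1, h2, rfl⟩
  have hImem : ∀ e, Proper G.E e →
      ∃ e', Proper G.E e' ∧ (e' = e ∨ seqBefore e e') ∧ f e' = I e := fun e he =>
    Nat.sInf_mem (s := {n | ∃ e', Proper G.E e' ∧ (e' = e ∨ seqBefore e e') ∧ f e' = n})
      ⟨f e, e, he, Or.inl rfl, rfl⟩
  have hImono : ∀ a b, Proper G.E b → seqBefore a b → I a ≤ I b := by
    intro a b hb hab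
    obtain ⟨e', h1, h2, h3⟩ := hImem b hb
    rw [← h3]
    refine hIle a e' h1 (Or.inr ?_)
    rcases h2 with rfl | h2
    · exact hab
    · exact hab.trans h2
  -- Program order out of a read or update is fully preserved, so no successor has an earlier
  -- position.
  have hIR : ∀ e, Proper G.E e → e.IsR → I e = f e := by
    intro e he hR
    obtain ⟨e', h1, h2, h3⟩ := hImem e he
    refine le_antisymm (hIle e e he (Or.inl rfl)) ?_
    rw [← h3]
    rcases h2 with rfl | h2
    · exact le_rfl
    · exact (hfp e e' he h1 (EGraph.ppo_of_isR ⟨he.1, h1.1, h2⟩ hR)).le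
  have hffin : ∀ N, {e | Proper G.E e ∧ f e ≤ N}.Finite := by
    intro N
    refine Set.Finite.of_finite_image (f := f) ((Set.finite_le_nat N).subset ?_) ?_
    · rintro _ ⟨e, he, rfl⟩
      exact he.2
    · intro a ha b hb hab
      exact hf a b ha.1 hb.1 hab
  have hIfin : ∀ N, {e | Proper G.E e ∧ I e ≤ N}.Finite := by
    intro N
    refine ((hffin N).biUnion (t := fun e' => {e'} ∪ {e | Proper G.E e ∧ seqBefore e e'})
      fun e' _ => (Set.finite_singleton e').union (hE.finite_seqBefore e')).subset ?_
    rintro e ⟨he, hle⟩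
    obtain ⟨e', h1, h2, h3⟩ := hImem e he
    simp only [Set.mem_iUnion]
    refine ⟨e', ⟨h1, by omega⟩, ?_⟩
    rcases h2 with rfl | h2
    · exact Or.inl rfl
    · exact Or.inr ⟨he, h2⟩
  let A := {e // Proper G.E e} × Bool
  -- The flag `true` marks a commit, `false` an execution. Doubling places executions with `I = N`
  -- just before the commit with `f = N`; the serial number orders executions of one thread that
  -- share the same `I`.
  let key : A → ℕ × ℕ := fun x =>
    if x.2 then (2 * f x.1.1 + 1, 0) else (2 * I x.1.1, x.1.1.sn.getD 0)
  have := hE.countable_proper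
  obtain ⟨g, hg, hgk⟩ := exists_enumeration (α := A)
    (R := fun x y => Prod.Lex (· < ·) (· < ·) (key x) (key y))
    (InvImage.wf key (WellFounded.prod_lex wellFounded_lt wellFounded_lt)) (by
      intro y
      have h1 : {x : A | (key x).1 ≤ (key y).1}.Finite := by
        refine Set.Finite.of_finite_image
          (f := fun x : A => ((x.1.1, x.2) : Event Tid Loc Val × Bool))
          ((((hffin (key y).1).union (hIfin (key y).1)).prod
            (Set.finite_univ (α := Bool))).subset ?_) ?_
        · rintro _ ⟨⟨⟨e, he⟩, b⟩, hx, rfl⟩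
          refine ⟨?_, trivial⟩
          cases b with
          | false =>
            have hx' : 2 * I e ≤ (key y).1 := hx
            exact Or.inr ⟨he, (by omega : I e ≤ (key y).1)⟩
          | true =>
            have hx' : 2 * f e + 1 ≤ (key y).1 := hx
            exact Or.inl ⟨he, (by omega : f e ≤ (key y).1)⟩
        · rintro ⟨⟨e, he⟩, b⟩ _ ⟨⟨e', he'⟩, b'⟩ _ h
          simp only [Prod.mk.injEq] at h
          obtain ⟨rfl, rfl⟩ := h
          rfl
      refine h1.subset fun x hx => ?_
      rcases (Prod.lex_def).1 hx with h | h
      · exact h.le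
      · exact h.1.le)
  let gi : Event Tid Loc Val → ℕ := fun e => if h : Proper G.E e then g (⟨e, h⟩, false) else 0
  let gc : Event Tid Loc Val → ℕ := fun e => if h : Proper G.E e then g (⟨e, h⟩, true) else 0
  have hgi : ∀ e (h : Proper G.E e), gi e = g (⟨e, h⟩, false) := fun e h => dif_pos h
  have hgc : ∀ e (h : Proper G.E e), gc e = g (⟨e, h⟩, true) := fun e h => dif_pos h
  have hgii : ∀ a b, Proper G.E a → Proper G.E b → seqBefore a b → gi a < gi b := by
    intro a b ha hb hab
    rw [hgi a ha, hgi b hb]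
    apply hgk
    obtain ⟨-, k, k', hk, hk', hlt⟩ := (WellFormed.seqBefore_iff ha).1 hab
    rw [Prod.lex_def]
    have := hImono a b hb hab
    simp only [key, hk, hk', Option.getD_some, Bool.false_eq_true, if_false]
    omega
  have hgic : ∀ a b, Proper G.E a → Proper G.E b → I a ≤ f b → gi a < gc b := by
    intro a b ha hb hab
    rw [hgi a ha, hgc b hb]
    apply hgk
    rw [Prod.lex_def]
    simp only [key, Bool.false_eq_true, if_false, if_true]
    omega
  have hgci : ∀ a b, Proper G.E a → Proper G.E b → f a < I b → gc a < gi b := by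
    intro a b ha hb hab
    rw [hgc a ha, hgi b hb]
    apply hgk
    rw [Prod.lex_def]
    simp only [key, Bool.false_eq_true, if_false, if_true]
    omega
  have hgcc : ∀ a b, Proper G.E a → Proper G.E b → f a < f b → gc a < gc b := by
    intro a b ha hb hab
    rw [hgc a ha, hgc b hb]
    apply hgk
    rw [Prod.lex_def]
    simp only [key, if_true]
    omega
  have hgiinj : ∀ a b, Proper G.E a → Proper G.E b → gi a = gi b → a = b := by
    intro a b ha hb hab
    rw [hgi a ha, hgi b hb] at hab
    exact congrArg (fun x : A => x.1.1) (hg hab)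
  have hgcinj : ∀ a b, Proper G.E a → Proper G.E b → gc a = gc b → a = b := by
    intro a b ha hb hab
    rw [hgc a ha, hgc b hb] at hab
    exact congrArg (fun x : A => x.1.1) (hg hab)
  have hgne : ∀ a b, Proper G.E a → Proper G.E b → gi a ≠ gc b := by
    intro a b ha hb hab
    rw [hgi a ha, hgc b hb] at hab
    exact Bool.false_ne_true (congrArg (fun x : A => x.2) (hg hab))
  obtain ⟨T, hT, hTg⟩ := exists_schedule_of_enumeration hgiinj hgii
  -- Reads and updates commit when they are executed; their commit slots in `g` stay unused.
  let P : Event Tid Loc Val → ℕ := fun e =>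
    if e.IsR then T e else if e ∈ Init Tid Loc Val then 0 else gc e + 1
  have hPR : ∀ e, e.IsR → P e = T e := fun e h => if_pos h
  have hPW : ∀ e, Proper G.E e → ¬ e.IsR → P e = gc e + 1 := fun e he h => by
    simp [P, h, he.2]
  have hPf : ∀ a b, Proper G.E a → Proper G.E b → f a < f b → P a < P b := by
    intro a b ha hb hab
    have hIa := hIle a a ha (Or.inl rfl)
    by_cases haR : a.IsR
    · have hIa' := hIR a ha haR
      rw [hPR a haR, hTg a ha]
      by_cases hbR : b.IsR
      · have hIb := hIR b hb hbR
        rw [hPR b hbR, hTg b hb]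
        have h1 := hgic a a ha ha hIa
        have h2 := hgci a b ha hb (by omega)
        omega
      · rw [hPW b hb hbR]
        have := hgic a b ha hb (by omega)
        omega
    · rw [hPW a ha haR]
      by_cases hbR : b.IsR
      · have hIb := hIR b hb hbR
        rw [hPR b hbR, hTg b hb]
        have := hgci a b ha hb (by omega)
        omega
      · rw [hPW b hb hbR]
        have := hgcc a b ha hb hab
        omega
  refine ⟨T, P, ⟨hE, hT, ?_, hPR, ?_, ?_, ?_, ?_⟩, hPf⟩
  · intro e he
    simp [P, not_isR_of_mem_Init he, he]
  · intro e he hR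
    rw [hPW e he hR, hTg e he]
    have := hgic e e he he (hIle e e he (Or.inl rfl))
    omega
  · intro a b ha hb hab
    by_contra hne
    rcases lt_trichotomy (f a) (f b) with h | h | h
    · have := hPf a b ha hb h
      omega
    · exact hne (hf a b ha hb h)
    · have := hPf b a hb ha h
      omega
  · intro a b ha hb hab
    rw [hTg a ha] at hab
    by_cases hbR : b.IsR
    · rw [hPR b hbR, hTg b hb] at hab
      exact hgiinj a b ha hb (by omega)
    · rw [hPW b hb hbR] at hab
      exact absurd (by omega) (hgne a b ha hb)
  · intro a b ha hb hab hW
    exact hPf a b ha hb (hfp a b ha hb (EGraph.ppo_of_isW ⟨ha.1, hb.1, hab⟩ hW))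

/-- The enumeration of the TSO order prescribes the commits. A source that is program-order before
its read is visible in the buffer or the memory, and any other source is related by `rfe` and hence
already committed. Nothing visible is newer than the source: for committed writes because of `fr`,
for own buffered writes because of SC per location. -/
theorem tso_behDecl_subset [DecidableEq Tid] [DecidableEq Loc] [Finite Tid] :
    BehDecl (graphsTSO Tid Loc Val ∩ graphsFair Tid Loc Val) ⊆ BehMF (memTSO Tid Loc Val) := by
  classical
  rintro β ⟨G, ⟨⟨hG, hloc⟩, hfmo, hffr⟩, hβ⟩
  obtain ⟨f, hf, hfR⟩ := G.wf.exists_enumeration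
    (fun a b => G.ppo a b ∨ G.rfe a b ∨ G.mo a b ∨ G.fr a b)
    (G.wf.wellFounded_of_closureIrrefl (fun e => e.IsW) hG (by
      intro a b ha hb hab h
      refine Or.inl ⟨⟨ha.1, hb.1, h⟩, fun hc => hc.2.2 ((ELab.isRMW_iff _).2 ⟨hc.2.1, ?_⟩)⟩
      exact hab.mp hc.1.1))
    (by
      intro b hb
      refine ((G.wf.finite_seqBefore b).union ((G.finite_rf b).union
        ((hfmo b hb.1).union (hffr b hb.1)))).subset ?_
      rintro a ⟨ha, h | h | h | h⟩
      · exact Or.inl ⟨ha, h.1.2.2⟩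
      · exact Or.inr (Or.inl h.1)
      · exact Or.inr (Or.inr (Or.inl h))
      · exact Or.inr (Or.inr (Or.inr h)))
  obtain ⟨T, P, K, hPf⟩ := G.exists_commitTimes hf fun a b ha hb h => hfR a b ha hb (Or.inl h)
  have hT := K.sched
  have hPR : ∀ a b, a ∈ G.E → Proper G.E b →
      (G.ppo a b ∨ G.rfe a b ∨ G.mo a b ∨ G.fr a b) → P a < P b := by
    intro a b ha hb h
    by_cases hi : a ∈ Init Tid Loc Val
    · rw [K.init a hi]
      exact K.pos hb
    · exact hPf a b ⟨ha, hi⟩ hb (hfR a b ⟨ha, hi⟩ hb h)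
  have hmoP : ∀ a b, G.mo a b → Proper G.E b := fun a b h =>
    ⟨(G.mo_mem a b h).2, fun hi => hloc.not_mo_init hi h⟩
  have hPmo : ∀ a b, G.mo a b → P a < P b := fun a b h =>
    hPR a b (G.mo_mem a b h).1 (hmoP a b h) (Or.inr (Or.inr (Or.inl h)))
  have hread : ∀ n q, TSOInv G.E T P n q → ∀ e τ, Proper G.E e → T e = n + 1 → e.tid = some τ →
      e.IsR → e.valR = some (applyBuffer q.mem (q.buf τ) e.loc) := by
    intro n q hq e τ he hTe hτ hR
    have hPe := K.eq e hR
    obtain ⟨w, hrf⟩ := G.rf_total e he.1 hR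
    have hwE := (G.rf_mem w e hrf).1
    obtain ⟨w', hw', hv⟩ := hq.exists_lastWrite K τ e.loc
    have h1 : IsLastWrite G.E P (fun w => P w ≤ n ∨ (w.tid = some τ ∧ T w ≤ n)) e.loc w := by
      refine EGraph.isLastWrite_of_rf hrf ?_ (fun a b h => (hPmo a b h).le) ?_ ?_
      · by_cases hpo : G.po w e
        · have hTw := hT.mono w e hwE he.1 hpo.2.2
          rcases hpo.2.2 with h | h
          · exact Or.inl (by rw [K.init w h.1]; exact Nat.zero_le _)
          · exact Or.inr ⟨h.1.trans hτ, by omega⟩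
        · have := hPR w e hwE he (Or.inr (Or.inl ⟨hrf, hpo⟩))
          exact Or.inl (by omega)
      · intro d hfr hd
        obtain ⟨c, hc, hmo⟩ := hfr.1
        have hdP := hmoP _ _ hmo
        have hlt := hPR e d he.1 hdP (Or.inr (Or.inr (Or.inr hfr)))
        rcases hd with hd | hd
        · omega
        · have hs := hT.lt_of_same_thread G.wf hdP he (hd.1.trans hτ.symm) (by omega)
          have hld : d.loc = e.loc :=
            (G.mo_match _ _ hmo).2.2.symm.trans (G.rf_match _ _ hc).2.2.1
          -- A write `d` of the same thread before `e` and `fr`-after `e` closes a cycle of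
          -- same-location program order and `fr`.
          exact hloc d (.tail (.single (Or.inl ⟨⟨hdP.1, he.1, hs⟩, hld⟩))
            (Or.inr (Or.inr (Or.inr hfr))))
      · rintro ⟨-, h | h⟩
        · omega
        · omega
    have : w = w' := IsLastWrite.unique K.inj_loc h1 hw'
    rw [← (G.rf_match w e hrf).2.2.2, this, hv]
  rw [mem_BehMF_iff]
  obtain ⟨q, l, hrun, hinv, hl⟩ := (memTSO Tid Loc Val).exists_stutterRun (TSOInv G.E T P)
    (fun n _ o _ => ObsSpec G.E T n o ∧ ∀ w τ, Proper G.E w → ¬ w.IsR → w.tid = some τ →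
      P w = n + 1 → o = some (Sum.inr τ)) (TSOInv.zero K) (by
      intro n q hq
      by_cases hex : ∃ e, Proper G.E e ∧ T e = n + 1
      · obtain ⟨e, he, hTe⟩ := hex
        obtain ⟨τ, k, hτ, -⟩ := G.wf.exists_tid_sn he
        have hobs : ObsSpec (Sil := Tid) G.E T n (some (Sum.inl (τ, e.lab))) :=
          ObsSpec.of_event hT he hTe hτ
        have hno : ∀ w τ', Proper G.E w → ¬ w.IsR → w.tid = some τ' → P w = n + 1 →
            (some (Sum.inl (τ, e.lab)) : Option ((Tid × ELab Loc Val) ⊕ Tid)) =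
              some (Sum.inr τ') := by
          intro w τ' hw hwR _ hPw
          have := K.cross e w he hw (by omega)
          subst this
          have := K.lt e he hwR
          omega
        have hval := hread n q hq e τ he hTe hτ
        cases hlab : e.lab with
        | read x v =>
          refine ⟨_, q, ⟨hobs, hno⟩, ?_, hq.read K he hTe (by simp [Event.IsW, hlab, ELab.IsW])⟩
          rw [hlab]
          have := hval (by simp [Event.IsR, hlab, ELab.IsR])
          simp only [Event.valR, Event.loc, hlab, ELab.valR, ELab.loc, Option.some.injEq] at this
          exact ⟨this.symm, rfl⟩
        | write x v =>
          refine ⟨_, _, ⟨hobs, hno⟩, ?_, hq.write K he hTe hτ hlab⟩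
          rw [hlab]
          rfl
        | rmw x v v' =>
          have hR : e.IsR := by simp [Event.IsR, hlab, ELab.IsR]
          refine ⟨_, _, ⟨hobs, hno⟩, ?_, hq.rmw K he hTe hlab⟩
          have hnil : q.buf τ = [] := by
            refine (hq.buf τ).eq_nil fun w hw hwt hTw => ?_
            have hs := hT.lt_of_same_thread G.wf hw he (hwt.trans hτ.symm) (by omega)
            have := K.fifo w e hw he hs (by simp [Event.IsW, hlab, ELab.IsW])
            rw [K.eq e hR] at this
            omega
          have := hval hR
          rw [hlab]
          simp only [Event.valR, Event.loc, hlab, ELab.valR, ELab.loc, Option.some.injEq,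
            hnil] at this
          exact ⟨hnil, this.symm, rfl⟩
      · have hex' : ∀ e, Proper G.E e → T e ≠ n + 1 := fun e he hTe => hex ⟨e, he, hTe⟩
        by_cases hexP : ∃ w, Proper G.E w ∧ P w = n + 1
        · obtain ⟨w, hw, hPw⟩ := hexP
          have hR : ¬ w.IsR := fun hR => hex' w hw (by rw [← K.eq w hR, hPw])
          obtain ⟨τ, k, hτ, -⟩ := G.wf.exists_tid_sn hw
          obtain ⟨b, x, v, hb, hinv⟩ := hq.prop K hw hPw hR hτ
          refine ⟨some (Sum.inr τ), _, ⟨ObsSpec.of_no_event (by simp) hex', ?_⟩,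
            ⟨b, x, v, hb, rfl⟩, hinv⟩
          intro w' τ' hw' _ hτ' hPw'
          have := K.inj w w' hw hw' (by omega)
          subst this
          rw [hτ] at hτ'
          cases hτ'
          rfl
        · refine ⟨none, q, ⟨ObsSpec.of_no_event (by simp) hex', ?_⟩, rfl,
            hq.stay K hex' fun e he hPe => hexP ⟨e, he, hPe⟩⟩
          intro w τ hw _ _ hPw
          exact absurd ⟨w, hw, hPw⟩ hexP)
  refine ⟨q, l, hrun, Or.inr fun τ k hk => ?_, ?_⟩
  -- A nonempty buffer at step `k` contains a write whose commit lies ahead, and the step of that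
  -- commit is a propagation of the same thread.
  · have hne := tso_enabled_prop.1 (hk k le_rfl)
    obtain ⟨w, hw, hτ, hTw, hPw⟩ : ∃ w, Proper G.E w ∧ w.tid = some τ ∧ T w ≤ k ∧ k < P w := by
      by_contra hc
      refine hne (((hinv k).buf τ).eq_nil fun w hw hwt hTw => ?_)
      by_contra hP
      exact hc ⟨w, hw, hwt, hTw, not_le.1 hP⟩
    have hR : ¬ w.IsR := by
      intro hR
      rw [K.eq w hR] at hPw
      omega
    exact ⟨P w - 1, by omega, (hl (P w - 1)).2 w τ hw hR hτ (by omega)⟩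
  · have hl' : ∀ n, ObsSpec G.E T n (l n) := fun n => (hl n).1
    rw [← hβ] at hT hl'
    exact hT.isBehavior hl'

end TSOGraphToRun

/-! ### View-based systems: from runs to graphs -/

section ViewSystem

variable {Tid : Type*} {Loc : Type*} {Val : Type*}

/-- Reading a message whose view records its own timestamp increases the view of the thread, and
sets its entry for the location of the message to the timestamp of the message. -/
def Advances (upd : View Loc → Msg Loc Val → View Loc) : Prop :=
  ∀ V m, V m.loc ≤ m.ts → m.view m.loc = m.ts → upd V m m.loc = m.ts ∧ V ≤ upd V m

theorem advances_join : Advances (fun (V : View Loc) (m : Msg Loc Val) => V ⊔ m.view) := by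
  intro V m h h'
  refine ⟨?_, le_sup_left⟩
  simp [h', h]

variable [DecidableEq Tid] [DecidableEq Loc]

/-- The view-based memory system in which `upd` describes the effect of reading a message. -/
def memView [Zero Val] (upd : View Loc → Msg Loc Val → View Loc) :
    LTS (VState Tid Loc Val) (Tid × ELab Loc Val) (Tid × Msg Loc Val) where
  init := viewInit
  step := viewStep upd

theorem advances_update :
    Advances (fun (V : View Loc) (m : Msg Loc Val) => Function.update V m.loc m.ts) := by
  intro V m h _
  refine ⟨by simp, fun y => ?_⟩
  by_cases hy : y = m.loc
  · subst hy
    simpa using h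
  · simp [hy]

/-- The effect of an observable step of a view-based system. -/
structure ViewEffect (upd : View Loc → Msg Loc Val → View Loc) (τ : Tid) (a : ELab Loc Val)
    (q q' : VState Tid Loc Val) : Prop where
  other : ∀ τ', τ' ≠ τ → q'.tview τ' = q.tview τ'
  mono : q.tview τ ≤ q'.tview τ
  mem_read : ¬ a.IsW → q'.mem = q.mem
  mem_write : ∀ v, a.valW = some v →
    q'.mem = q.mem ∪ {⟨a.loc, v, q'.tview τ a.loc, q'.tview τ⟩} ∧
      ¬ ∃ m ∈ q.mem, m.loc = a.loc ∧ m.ts = q'.tview τ a.loc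
  read : a.IsR → ∃ m ∈ q.mem, m.loc = a.loc ∧ some m.val = a.valR ∧ q.tview τ a.loc ≤ m.ts ∧
    upd (q.tview τ) m ≤ q'.tview τ ∧ (¬ a.IsW → q'.tview τ a.loc = m.ts) ∧
    (a.IsW → q'.tview τ a.loc = m.ts + 1)

theorem le_update_of_le {V : View Loc} {x : Loc} {t : ℕ} (h : V x ≤ t) :
    V ≤ Function.update V x t := by
  intro y
  by_cases hy : y = x
  · subst hy
    simpa using h
  · simp [hy]

/-- Since each message view records the message's own timestamp, joining with that view and updating
a single entry agree at the location read. This is what allows RA and StrongCOH to share one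
argument. -/
theorem viewStep_effect {upd : View Loc → Msg Loc Val → View Loc} (hupd : Advances upd)
    {τ : Tid} {a : ELab Loc Val} {q q' : VState Tid Loc Val}
    (hq : ∀ m ∈ q.mem, m.view m.loc = m.ts) (h : viewStep upd q (Sum.inl (τ, a)) q') :
    ViewEffect upd τ a q q' := by
  cases a with
  | read x v =>
    obtain ⟨m, hm, rfl, rfl, hle, rfl⟩ := h
    obtain ⟨h1, h2⟩ := hupd (q.tview τ) m hle (hq m hm)
    refine ⟨fun τ' hτ' => by simp [hτ'], by simpa using h2, fun _ => rfl, ?_, ?_⟩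
    · intro v hv
      simp [ELab.valW] at hv
    · intro _
      refine ⟨m, hm, rfl, rfl, hle, by simp, fun _ => ?_, fun hW => absurd hW id⟩
      simpa [ELab.loc] using h1
  | write x v =>
    obtain ⟨t, hfresh, hlt, htv, hmem⟩ := h
    have hx : q'.tview τ = Function.update (q.tview τ) x t := by rw [htv]; simp
    refine ⟨fun τ' hτ' => by rw [htv]; simp [hτ'], ?_, fun hW => absurd trivial hW, ?_,
      fun hR => ?_⟩
    · rw [hx]
      exact le_update_of_le hlt.le
    · intro v' hv
      simp only [ELab.valW, Option.some.injEq] at hv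
      subst hv
      simp only [ELab.loc]
      have ht : q'.tview τ x = t := by rw [hx]; simp
      rw [ht]
      exact ⟨hmem, hfresh⟩
    · exact absurd hR id
  | rmw x vR vW =>
    obtain ⟨q₁, ⟨m, hm, rfl, rfl, hle, rfl⟩, ⟨t, hfresh, hlt, htv, hmem⟩, hinc⟩ := h
    obtain ⟨h1, h2⟩ := hupd (q.tview τ) m hle (hq m hm)
    simp only [Function.update_self] at hlt htv hinc
    have hx : q'.tview τ = Function.update (upd (q.tview τ) m) m.loc t := by rw [htv]; simp
    have ht : q'.tview τ m.loc = t := by rw [hx]; simp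
    have h3 : upd (q.tview τ) m ≤ q'.tview τ := by
      rw [hx]
      exact le_update_of_le hlt.le
    refine ⟨fun τ' hτ' => by rw [htv]; simp [hτ'], h2.trans h3, fun hW => absurd trivial hW, ?_,
      fun _ => ?_⟩
    · intro v' hv
      simp only [ELab.valW, Option.some.injEq] at hv
      subst hv
      simp only [ELab.loc]
      rw [ht]
      exact ⟨hmem, hfresh⟩
    · refine ⟨m, hm, rfl, rfl, hle, h3, fun hW => absurd trivial hW, fun _ => ?_⟩
      simp only [ELab.loc]
      rw [hinc, h1]

end ViewSystem

/-! ### Views and timestamps of events in a run -/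

section ViewRun

variable {Tid : Type*} {Loc : Type*} {Val : Type*}

/-- The view of the thread of `e` after the execution of `e`. -/
def eventView (q : ℕ → VState Tid Loc Val) (T : Event Tid Loc Val → ℕ) (e : Event Tid Loc Val) :
    View Loc :=
  match e.tid with
  | none => fun _ => 0
  | some τ => (q (T e)).tview τ

/-- The timestamp of `e`. -/
def eventTs (q : ℕ → VState Tid Loc Val) (T : Event Tid Loc Val → ℕ) (e : Event Tid Loc Val) : ℕ :=
  eventView q T e e.loc

/-- `m` is the message of the write `w`. -/
def IsMsgOf (q : ℕ → VState Tid Loc Val) (T : Event Tid Loc Val → ℕ) (w : Event Tid Loc Val)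
    (m : Msg Loc Val) : Prop :=
  m.loc = w.loc ∧ some m.val = w.valW ∧ m.ts = eventTs q T w ∧ m.view = eventView q T w

theorem eventView_of_tid {q : ℕ → VState Tid Loc Val} {T : Event Tid Loc Val → ℕ}
    {e : Event Tid Loc Val} {τ : Tid} (h : e.tid = some τ) :
    eventView q T e = (q (T e)).tview τ := by
  simp [eventView, h]

theorem IsMsgOf.view_loc {q : ℕ → VState Tid Loc Val} {T : Event Tid Loc Val → ℕ}
    {w : Event Tid Loc Val} {m : Msg Loc Val} (h : IsMsgOf q T w m) : m.view m.loc = m.ts := by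
  obtain ⟨h1, -, h3, h4⟩ := h
  rw [h4, h3, h1, eventTs]

variable [Zero Val]

theorem eventView_of_init {q : ℕ → VState Tid Loc Val} {T : Event Tid Loc Val → ℕ}
    {e : Event Tid Loc Val} (h : e ∈ Init Tid Loc Val) : eventView q T e = fun _ => 0 := by
  simp [eventView, tid_of_mem_Init h]

variable [DecidableEq Tid] [DecidableEq Loc]
  {upd : View Loc → Msg Loc Val → View Loc} {q : ℕ → VState Tid Loc Val}
  {l : ℕ → Option ((Tid × ELab Loc Val) ⊕ (Tid × Msg Loc Val))}
  {E : Set (Event Tid Loc Val)} {T : Event Tid Loc Val → ℕ}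

theorem view_mem_iff (hupd : Advances upd) (hr : (memView upd).StutterRun q l) (hE : WellFormed E)
    (hT : Schedule E T) (hl : ∀ n, ObsSpec E T n (l n)) (n : ℕ) :
    ∀ m, m ∈ (q n).mem ↔ ∃ w ∈ E, w.IsW ∧ T w ≤ n ∧ IsMsgOf q T w m := by
  induction n with
  | zero =>
    intro m
    rw [hr.start]
    constructor
    · rintro ⟨x, rfl⟩
      have hi : (⟨none, none, .write x 0⟩ : Event Tid Loc Val) ∈ Init Tid Loc Val := ⟨x, rfl⟩
      refine ⟨_, hE.init_subset hi, isW_of_mem_Init hi, (hT.init _ hi).le, rfl, rfl, ?_, ?_⟩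
      · rw [eventTs, eventView_of_init hi]
      · rw [eventView_of_init hi]
    · rintro ⟨w, hw, hW, hTw, h1, h2, h3, h4⟩
      have hi : w ∈ Init Tid Loc Val := by
        by_contra hi
        have := hT.pos w ⟨hw, hi⟩
        omega
      rw [valW_of_mem_Init hi] at h2
      rw [eventTs, eventView_of_init hi] at h3
      rw [eventView_of_init hi] at h4
      refine ⟨w.loc, ?_⟩
      obtain ⟨a, b, c, d⟩ := m
      simp only [Option.some.injEq] at h1 h2 h3 h4
      rw [h1, h2, h3, h4]
  | succ n ih =>
    have hstep := hr.step n
    have hnone : (∀ σ, l n ≠ some (Sum.inl σ)) → (q (n + 1)).mem = (q n).mem →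
        ∀ m, m ∈ (q (n + 1)).mem ↔ ∃ w ∈ E, w.IsW ∧ T w ≤ n + 1 ∧ IsMsgOf q T w m := by
      intro hln hmem m
      rw [hmem, ih]
      refine exists_congr fun w => and_congr_right fun hw => and_congr_right fun _ =>
        and_congr_left fun _ => ⟨fun h => by omega, fun h => ?_⟩
      by_contra hc
      have hw' := hT.proper_of_pos hw (by omega)
      obtain ⟨τ, k, h1, -⟩ := hE.exists_tid_sn hw'
      exact hln _ ((hl n τ w.lab).2 ⟨w, hw', by omega, h1, rfl⟩)
    rcases hln : l n with _ | ⟨⟨τ, a⟩⟩ | ⟨τ, m⟩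
    · rw [hln] at hstep
      refine hnone (by simp [hln]) ?_
      rw [show q (n + 1) = q n from hstep]
    · obtain ⟨e, he, hTe, hτ, rfl⟩ := (hl n τ a).1 hln
      rw [hln] at hstep
      have heff := viewStep_effect hupd (fun m hm => by
        obtain ⟨w, -, -, -, h⟩ := (ih m).1 hm
        exact h.view_loc) hstep
      have hun : ∀ w ∈ E, T w = n + 1 → w = e := fun w hw hTw =>
        hT.inj w e (hT.proper_of_pos hw (by omega)) he (by omega)
      intro m
      by_cases hW : e.IsW
      · obtain ⟨v, hv⟩ := (ELab.isW_iff _).1 hW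
        obtain ⟨hmem, -⟩ := heff.mem_write v hv
        have hview : (q (n + 1)).tview τ = eventView q T e := by
          rw [eventView_of_tid hτ, hTe]
        rw [hmem, Set.mem_union, Set.mem_singleton_iff, ih]
        constructor
        · rintro (⟨w, h1, h2, h3, h4⟩ | rfl)
          · exact ⟨w, h1, h2, by omega, h4⟩
          · refine ⟨e, he.1, hW, hTe.le, rfl, hv.symm, ?_, hview⟩
            rw [eventTs, hview]
        · rintro ⟨w, h1, h2, h3, h4⟩
          by_cases hTw : T w = n + 1
          · right
            rw [hun w h1 hTw] at h4
            obtain ⟨h5, h6, h7, h8⟩ := h4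
            rw [Event.valW, hv] at h6
            obtain ⟨a, b, c, d⟩ := m
            simp only [Option.some.injEq] at h5 h6 h7 h8
            rw [hview, h5, h6, h7, h8, eventTs]
          · exact Or.inl ⟨w, h1, h2, by omega, h4⟩
      · rw [heff.mem_read hW, ih]
        refine exists_congr fun w => and_congr_right fun hw => and_congr_right fun hWw =>
          and_congr_left fun _ => ⟨fun h => by omega, fun h => ?_⟩
        by_contra hc
        rw [hun w hw (by omega)] at hWw
        exact hW hWw
    · rw [hln] at hstep
      refine hnone (by simp [hln]) ?_
      rw [hstep.2.2]

theorem view_effect (hupd : Advances upd) (hr : (memView upd).StutterRun q l) (hE : WellFormed E)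
    (hT : Schedule E T) (hl : ∀ n, ObsSpec E T n (l n)) {e : Event Tid Loc Val}
    (he : Proper E e) {n : ℕ} (hn : T e = n + 1) {τ : Tid} (hτ : e.tid = some τ) :
    ViewEffect upd τ e.lab (q n) (q (n + 1)) := by
  have hln := (hl n τ e.lab).2 ⟨e, he, hn, hτ, rfl⟩
  have hstep := hr.step n
  rw [hln] at hstep
  refine viewStep_effect hupd (fun m hm => ?_) hstep
  obtain ⟨w, -, -, -, h⟩ := (view_mem_iff hupd hr hE hT hl n m).1 hm
  exact h.view_loc

theorem view_mono (hupd : Advances upd) (hr : (memView upd).StutterRun q l) (hE : WellFormed E)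
    (hT : Schedule E T) (hl : ∀ n, ObsSpec E T n (l n)) (τ : Tid) :
    Monotone fun n => (q n).tview τ := by
  refine monotone_nat_of_le_succ fun n => ?_
  have hstep := hr.step n
  rcases hln : l n with _ | ⟨⟨τ', a⟩⟩ | ⟨τ', m⟩
  · rw [hln] at hstep
    rw [show q (n + 1) = q n from hstep]
  · obtain ⟨e, he, hTe, hτ, rfl⟩ := (hl n τ' a).1 hln
    have heff := view_effect hupd hr hE hT hl he hTe hτ
    by_cases h : τ = τ'
    · subst h
      exact heff.mono
    · rw [heff.other τ h]
  · rw [hln] at hstep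
    obtain ⟨-, h2, h3⟩ := hstep
    rw [h3]
    by_cases h : τ = τ'
    · subst h
      simpa using le_update_of_le h2.le
    · simp [h]

theorem eventView_mono_po (hupd : Advances upd) (hr : (memView upd).StutterRun q l)
    (hE : WellFormed E) (hT : Schedule E T) (hl : ∀ n, ObsSpec E T n (l n))
    {a b : Event Tid Loc Val} (ha : a ∈ E) (hb : b ∈ E) (h : seqBefore a b) :
    eventView q T a ≤ eventView q T b := by
  by_cases hi : a ∈ Init Tid Loc Val
  · rw [eventView_of_init hi]
    exact fun _ => Nat.zero_le _
  · obtain ⟨τ, k, hτ, -⟩ := hE.exists_tid_sn ⟨ha, hi⟩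
    have ht := ((WellFormed.seqBefore_iff (E := E) ⟨ha, hi⟩).1 h).1
    rw [eventView_of_tid hτ, eventView_of_tid (ht.symm.trans hτ)]
    exact view_mono hupd hr hE hT hl τ (hT.mono a b ha hb h).le

/-- Of two writes to one location, the later picks an unused timestamp while the message of the
earlier is still in memory. -/
theorem eventTs_inj (hupd : Advances upd) (hr : (memView upd).StutterRun q l)
    (hE : WellFormed E) (hT : Schedule E T) (hl : ∀ n, ObsSpec E T n (l n))
    (a b : Event Tid Loc Val) (ha : a ∈ E) (hb : b ∈ E) (haW : a.IsW) (hbW : b.IsW)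
    (hloc : a.loc = b.loc) (hts : eventTs q T a = eventTs q T b) : a = b := by
  have key : ∀ a b : Event Tid Loc Val, a ∈ E → b ∈ E → a.IsW → b.IsW → a.loc = b.loc →
      eventTs q T a = eventTs q T b → ¬ T a < T b := by
    intro a b ha hb haW hbW hloc hts hlt
    have hb' := hT.proper_of_pos hb (by omega)
    obtain ⟨n, hn⟩ := Nat.exists_eq_succ_of_ne_zero (hT.pos b hb').ne'
    obtain ⟨τ, k, hτ, -⟩ := hE.exists_tid_sn hb'
    have heff := view_effect hupd hr hE hT hl hb' hn hτ
    obtain ⟨v, hv⟩ := (ELab.isW_iff _).1 hbW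
    obtain ⟨v', hv'⟩ := (ELab.isW_iff _).1 haW
    refine (heff.mem_write v hv).2 ⟨⟨a.loc, v', eventTs q T a, eventView q T a⟩, ?_, hloc, ?_⟩
    · rw [view_mem_iff hupd hr hE hT hl]
      exact ⟨a, ha, haW, by omega, rfl, hv'.symm, rfl, rfl⟩
    · simp only
      rw [hts, eventTs, eventView_of_tid hτ, hn]
  refine hT.inj_loc ha hb hloc ?_
  rcases lt_trichotomy (T a) (T b) with h | h | h
  · exact absurd h (key a b ha hb haW hbW hloc hts)
  · exact h
  · exact absurd h (key b a hb ha hbW haW hloc.symm hts.symm)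

/-- Here memory fairness is used. As long as the view stays below the timestamp of `b`, propagating
the message of `b` is enabled; were this so forever, the step would be taken and would raise the
view. -/
theorem view_exists_bound (hupd : Advances upd) (hr : (memView upd).StutterRun q l)
    (hf : ∀ (θ : Tid × Msg Loc Val) (k : ℕ),
      (∀ j, k ≤ j → (memView upd).Enabled (q j) (Sum.inr θ)) →
        ∃ j, k ≤ j ∧ l j = some (Sum.inr θ))
    (hE : WellFormed E) (hT : Schedule E T) (hl : ∀ n, ObsSpec E T n (l n))
    {b : Event Tid Loc Val} (hb : b ∈ E) (hbW : b.IsW) (τ : Tid) :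
    ∃ N, ∀ n, N ≤ n → eventTs q T b ≤ (q n).tview τ b.loc := by
  by_contra hc
  push Not at hc
  have hlt : ∀ n, (q n).tview τ b.loc < eventTs q T b := by
    intro n
    obtain ⟨n', hn', h⟩ := hc n
    exact (view_mono hupd hr hE hT hl τ hn' b.loc).trans_lt h
  obtain ⟨v, hv⟩ := (ELab.isW_iff _).1 hbW
  obtain ⟨j, hj, hlj⟩ := hf (τ, ⟨b.loc, v, eventTs q T b, eventView q T b⟩) (T b) (by
    intro j hj
    refine ⟨_, ?_, hlt j, rfl⟩
    rw [view_mem_iff hupd hr hE hT hl]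
    exact ⟨b, hb, hbW, hj, rfl, hv.symm, rfl, rfl⟩)
  have hstep := hr.step j
  rw [hlj] at hstep
  have h1 := hlt (j + 1)
  rw [hstep.2.2] at h1
  simp at h1

/-- Timestamps order `mo`, and the pair of timestamp and execution time decreases along no edge. The
relation `H` is left open because views grow along happens-before in RA but only along program order
in StrongCOH. A thread whose view has reached the timestamp of `b` reads no older message of that
location, so with finitely many threads `fr` is prefix-finite. -/
theorem view_exists_graph [Finite Tid] (hupd : Advances upd) (hr : (memView upd).StutterRun q l)
    (hf : (memView upd).StutterFair q l)
    (hE : WellFormed E) (hT : Schedule E T) (hl : ∀ n, ObsSpec E T n (l n)) :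
    ∃ G : EGraph Tid Loc Val, E = G.E ∧ G.Fair ∧
      (∀ a b, G.po a b → eventView q T a ≤ eventView q T b ∧ T a < T b) ∧
      (∀ a b, G.rf a b → T a < T b) ∧
      ((∀ V m, m.view ≤ upd V m) → ∀ a b, G.rf a b → eventView q T a ≤ eventView q T b) ∧
      ∀ H : Event Tid Loc Val → Event Tid Loc Val → Prop,
        (∀ a b, H a b → eventView q T a ≤ eventView q T b ∧ T a < T b) →
        ClosureIrrefl fun a b => (H a b ∧ a.loc = b.loc) ∨ G.rf a b ∨ G.mo a b ∨ G.fr a b := by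
  have hex : ∀ r, ∃ e, r ∈ E → r.IsR → e ∈ E ∧ e.IsW ∧ e.loc = r.loc ∧ e.valW = r.valR ∧
      T e < T r ∧ (¬ r.IsW → eventTs q T r = eventTs q T e) ∧
      (r.IsW → eventTs q T r = eventTs q T e + 1) ∧
      (∀ n τ, r.tid = some τ → T r = n + 1 → (q n).tview τ r.loc ≤ eventTs q T e) ∧
      ((∀ V m, m.view ≤ upd V m) → eventView q T e ≤ eventView q T r) := by
    intro r
    by_cases h : r ∈ E ∧ r.IsR
    · have hr' : Proper E r := ⟨h.1, fun hi => not_isR_of_mem_Init hi h.2⟩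
      obtain ⟨n, hn⟩ := Nat.exists_eq_succ_of_ne_zero (hT.pos r hr').ne'
      obtain ⟨τ, k, hτ, -⟩ := hE.exists_tid_sn hr'
      have heff := view_effect hupd hr hE hT hl hr' hn hτ
      obtain ⟨m, hm, h1, h2, h3, h4, h5, h6⟩ := heff.read h.2
      obtain ⟨w, hw, hW, hTw, h7, h8, h9, h10⟩ := (view_mem_iff hupd hr hE hT hl n m).1 hm
      have hts : eventTs q T r = (q (n + 1)).tview τ r.loc := by
        rw [eventTs, eventView_of_tid hτ, hn]
      refine ⟨w, fun _ _ => ⟨hw, hW, h7.symm.trans h1, h8.symm.trans h2, by omega, ?_, ?_, ?_, ?_⟩⟩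
      · intro hrW
        rw [hts, ← h9]
        exact h5 hrW
      · intro hrW
        rw [hts, ← h9]
        exact h6 hrW
      · intro n' τ' hτ' hn'
        have : n' = n := by omega
        subst this
        rw [hτ] at hτ'
        cases hτ'
        rw [← h9]
        exact h3
      · intro hjoin
        rw [← h10, eventView_of_tid hτ, hn]
        exact (hjoin _ _).trans h4
    · exact ⟨r, fun h1 h2 => absurd ⟨h1, h2⟩ h⟩
  choose src hsrc using hex
  have hs : ∀ r, r ∈ E → r.IsR → src r ∈ E ∧ (src r).IsW ∧ (src r).loc = r.loc ∧
      (src r).valW = r.valR := fun r h1 h2 => by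
    obtain ⟨h3, h4, h5, h6, -⟩ := hsrc r h1 h2
    exact ⟨h3, h4, h5, h6⟩
  have hP := eventTs_inj hupd hr hE hT hl
  let G := keyGraph E hE (eventTs q T) hP src hs
  have hfr : ∀ a b, G.fr a b → Proper E a ∧ b ∈ E ∧ b.IsW ∧ a.IsR ∧ a.loc = b.loc ∧
      eventTs q T (src a) < eventTs q T b ∧ eventTs q T a < eventTs q T b := by
    rintro a b ⟨⟨e, ⟨haE, haR, rfl⟩, hmo⟩, hne⟩
    obtain ⟨-, hbE, -, hbW, hloc, hlt⟩ := hmo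
    obtain ⟨h3, h4, h5, h6, h7, h8, h9, -⟩ := hsrc a haE haR
    refine ⟨⟨haE, fun hi => not_isR_of_mem_Init hi haR⟩, hbE, hbW, haR, h5.symm.trans hloc, hlt, ?_⟩
    -- An update takes the timestamp directly after that of its source. The write `b` is later than
    -- the source and differs from the update, so it is later than the update as well.
    by_cases haW : a.IsW
    · have h10 := h9 haW
      have : eventTs q T a ≠ eventTs q T b := fun h =>
        hne ⟨hP a b haE hbE haW hbW (h5.symm.trans hloc) h, haE⟩
      omega
    · rw [h8 haW]
      exact hlt
  refine ⟨G, rfl, ⟨keyGraph_mo_finite E hE _ hP src hs, ?_⟩, ?_, ?_, ?_, ?_⟩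
  · intro b _
    -- A run that eventually only stutters executes finitely many events, so `view_exists_bound` is
    -- needed only in the other case.
    rcases hf with ⟨N, hN⟩ | hf
    · refine (hT.finite_le N).subset fun a ha => ?_
      have ha' := (hfr a b ha).1
      refine ⟨ha', ?_⟩
      by_contra hc
      obtain ⟨n, hn⟩ := Nat.exists_eq_succ_of_ne_zero (hT.pos a ha').ne'
      obtain ⟨τ, k, hτ, -⟩ := hE.exists_tid_sn ha'
      have hln := (hl n τ a.lab).2 ⟨a, ha', hn, hτ, rfl⟩
      rw [hN n (by omega)] at hln
      cases hln
    · by_cases hb : b ∈ E ∧ b.IsW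
      · choose N hN using view_exists_bound hupd hr hf hE hT hl hb.1 hb.2
        refine (Set.finite_iUnion fun τ => hT.finite_le (N τ)).subset fun a ha => ?_
        obtain ⟨ha', -, -, haR, hloc, h1, -⟩ := hfr a b ha
        obtain ⟨n, hn⟩ := Nat.exists_eq_succ_of_ne_zero (hT.pos a ha').ne'
        obtain ⟨τ, k, hτ, -⟩ := hE.exists_tid_sn ha'
        rw [Set.mem_iUnion]
        refine ⟨τ, ha', ?_⟩
        by_contra hc
        obtain ⟨-, -, -, -, -, -, -, h2, -⟩ := hsrc a ha'.1 haR
        have h3 := h2 n τ hτ hn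
        have h4 := hN τ n (by omega)
        rw [hloc] at h3
        omega
      · refine Set.finite_empty.subset fun a ha => ?_
        obtain ⟨-, h1, h2, -⟩ := hfr a b ha
        exact hb ⟨h1, h2⟩
  · rintro a b ⟨ha, hb, h⟩
    exact ⟨eventView_mono_po hupd hr hE hT hl ha hb h, hT.mono a b ha hb h⟩
  · rintro a b ⟨h1, h2, rfl⟩
    exact (hsrc b h1 h2).2.2.2.2.1
  · rintro hjoin a b ⟨h1, h2, rfl⟩
    exact (hsrc b h1 h2).2.2.2.2.2.2.2.2 hjoin
  · intro H hH
    refine closureIrrefl_of_lex (eventTs q T) T fun a b h => ?_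
    rcases h with ⟨h, hloc⟩ | ⟨h1, h2, rfl⟩ | h | h
    · refine Or.inr ⟨?_, (hH a b h).2⟩
      rw [eventTs, eventTs, ← hloc]
      exact (hH a b h).1 _
    · obtain ⟨-, -, -, -, h7, h8, h9, -⟩ := hsrc b h1 h2
      refine Or.inr ⟨?_, h7⟩
      by_cases hW : b.IsW
      · have := h9 hW
        omega
      · exact (h8 hW).ge
    · exact Or.inl h.2.2.2.2.2
    · exact Or.inl (hfr a b h).2.2.2.2.2.2

end ViewRun

/-! ### Behaviors of RA and StrongCOH runs as behaviors of graphs -/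

section ViewBeh

variable {Tid : Type*} {Loc : Type*} {Val : Type*} [Zero Val] [DecidableEq Tid] [DecidableEq Loc]
  [Finite Tid]

theorem ra_behMF_subset :
    BehMF (memRA Tid Loc Val) ⊆ BehDecl (graphsRA Tid Loc Val ∩ graphsFair Tid Loc Val) := by
  intro β hβ
  obtain ⟨q, l, hr, hf, hb⟩ := (mem_BehMF_iff _ _).1 hβ
  obtain ⟨T, hT, hl⟩ := exists_schedule hb
  obtain ⟨G, hGE, hfair, hpo, hrf, hrfV, hG⟩ :=
    view_exists_graph advances_join hr hf (wellFormed_eventsOf β) hT hl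
  refine ⟨G, ⟨hG _ fun a b hab => ?_, hfair⟩, hGE⟩
  have hrf' := hrfV fun V m => le_sup_right
  have hstep : ∀ a b, (G.po a b ∨ G.rf a b) →
      eventView q T a ≤ eventView q T b ∧ T a < T b := by
    rintro a b (h | h)
    · exact hpo a b h
    · exact ⟨hrf' a b h, hrf a b h⟩
  induction hab with
  | single h => exact hstep _ _ h
  | tail _ h ih => exact ⟨ih.1.trans (hstep _ _ h).1, ih.2.trans (hstep _ _ h).2⟩

/-- Reads transfer no other entry of the message view, so coherence is obtained for `H = po` only.
Acyclicity of happens-before comes from execution time alone. -/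
theorem strongCOH_behMF_subset :
    BehMF (memStrongCOH Tid Loc Val) ⊆
      BehDecl (graphsStrongCOH Tid Loc Val ∩ graphsFair Tid Loc Val) := by
  intro β hβ
  obtain ⟨q, l, hr, hf, hb⟩ := (mem_BehMF_iff _ _).1 hβ
  obtain ⟨T, hT, hl⟩ := exists_schedule hb
  obtain ⟨G, hGE, hfair, hpo, hrf, -, hG⟩ :=
    view_exists_graph advances_update hr hf (wellFormed_eventsOf β) hT hl
  refine ⟨G, ⟨⟨?_, hG _ hpo⟩, hfair⟩, hGE⟩
  refine closureIrrefl_of_measure T ?_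
  rintro a b (h | h)
  · exact (hpo a b h).2
  · exact hrf a b h

end ViewBeh

/-! ### View-based systems: from graphs to runs -/

section Timestamps

variable {Tid : Type*} {Loc : Type*} {Val : Type*} [Zero Val] {G : EGraph Tid Loc Val}

/-- The position of a write in the modification order. -/
noncomputable def EGraph.ts (G : EGraph Tid Loc Val) (w : Event Tid Loc Val) : ℕ :=
  {a | G.mo a w}.ncard

theorem EGraph.ts_lt (hf : PrefixFinite G.E G.mo) {a b : Event Tid Loc Val} (h : G.mo a b) :
    G.ts a < G.ts b := by
  refine Set.ncard_lt_ncard ?_ (hf b (G.mo_mem a b h).2)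
  exact (Set.ssubset_iff_of_subset (s := {c | G.mo c a}) (t := {c | G.mo c b})
    fun c hc => G.mo_trans c a b hc h).2 ⟨a, h, G.mo_irrefl a⟩

theorem EGraph.ts_inj (hf : PrefixFinite G.E G.mo) {a b : Event Tid Loc Val} (ha : a ∈ G.E)
    (hb : b ∈ G.E) (haW : a.IsW) (hbW : b.IsW) (hl : a.loc = b.loc) (h : G.ts a = G.ts b) :
    a = b := by
  by_contra hne
  rcases G.mo_total a ha b hb haW hbW hl hne with h' | h'
  · exact (EGraph.ts_lt hf h').ne h
  · exact (EGraph.ts_lt hf h').ne' h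

theorem EGraph.ts_le_of_not_mo (hf : PrefixFinite G.E G.mo) {a b : Event Tid Loc Val}
    (ha : a ∈ G.E) (hb : b ∈ G.E) (haW : a.IsW) (hbW : b.IsW) (hl : a.loc = b.loc)
    (h : ¬ G.mo b a) : G.ts a ≤ G.ts b := by
  by_cases hne : a = b
  · rw [hne]
  · exact (EGraph.ts_lt hf ((G.mo_total a ha b hb haW hbW hl hne).resolve_right h)).le

theorem EGraph.ts_init (hs : G.SCPerLoc) {a : Event Tid Loc Val} (ha : a ∈ Init Tid Loc Val) :
    G.ts a = 0 := by
  have : {b | G.mo b a} = ∅ := by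
    ext b
    exact ⟨fun h => hs.not_mo_init ha h, fun h => absurd h (Set.notMem_empty b)⟩
  rw [EGraph.ts, this, Set.ncard_empty]

theorem EGraph.ts_pos (hf : PrefixFinite G.E G.mo) (hs : G.SCPerLoc) {a : Event Tid Loc Val}
    (ha : Proper G.E a) (haW : a.IsW) : 0 < G.ts a := by
  have hi : (⟨none, none, .write a.loc 0⟩ : Event Tid Loc Val) ∈ Init Tid Loc Val := ⟨a.loc, rfl⟩
  have hne : (⟨none, none, .write a.loc 0⟩ : Event Tid Loc Val) ≠ a := fun h => ha.2 (h ▸ hi)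
  rcases G.mo_total _ (G.wf.init_subset hi) a ha.1 trivial haW rfl hne with h | h
  · exact (Nat.zero_le _).trans_lt (EGraph.ts_lt hf h)
  · exact absurd h (hs.not_mo_init hi)

/-- No write lies in `mo` strictly between the source and the update: being `mo`-after the source
makes it `fr`-after the update, and an `mo` edge to the update would close a cycle. This matches the
exact increment by `1` demanded of updates. -/
theorem EGraph.ts_rmw (hf : PrefixFinite G.E G.mo) (hs : G.SCPerLoc) {e u : Event Tid Loc Val}
    (h : G.rf e u) (hu : u.IsW) : G.ts u = G.ts e + 1 := by
  obtain ⟨heE, huE⟩ := G.rf_mem e u h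
  obtain ⟨heW, -, hl, -⟩ := G.rf_match e u h
  have hrf : (fun a b => (G.po a b ∧ a.loc = b.loc) ∨ G.rf a b ∨ G.mo a b ∨ G.fr a b) e u :=
    Or.inr (Or.inl h)
  have hne : e ≠ u := by
    rintro rfl
    exact hs e (.single hrf)
  have hmo : G.mo e u := (G.mo_total e heE u huE heW hu hl hne).resolve_right fun h' =>
    hs e (.tail (.single hrf) (Or.inr (Or.inr (Or.inl h'))))
  have : {a | G.mo a u} = insert e {a | G.mo a e} := by
    ext a
    constructor
    · intro ha
      by_cases hae : a = e
      · exact Or.inl hae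
      · refine Or.inr ((G.mo_total a (G.mo_mem a u ha).1 e heE (G.mo_match a u ha).1 heW
          ((G.mo_match a u ha).2.2.trans hl.symm) hae).resolve_right fun h' => ?_)
        have hfr : G.fr u a := ⟨⟨e, h, h'⟩, fun hc => G.mo_irrefl u (by
          have := ha
          rwa [← hc.1] at this)⟩
        exact hs u (.tail (.single (Or.inr (Or.inr (Or.inr hfr)))) (Or.inr (Or.inr (Or.inl ha))))
    · rintro (rfl | ha)
      · exact hmo
      · exact G.mo_trans a e u ha hmo
  rw [EGraph.ts, EGraph.ts, this,
    Set.ncard_insert_of_notMem (s := {a | G.mo a e}) (G.mo_irrefl e) (hf e heE)]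

end Timestamps

/-! ### Simulation of a graph by a view-based system -/

section ViewGraphToRun

variable {Tid : Type*} {Loc : Type*} {Val : Type*} [Zero Val]

/-- A thread with view `V` may still execute the event `a`. -/
def ViewOk (G : EGraph Tid Loc Val) (V : View Loc) (a : Event Tid Loc Val) : Prop :=
  (∀ d, G.rf d a → V a.loc ≤ G.ts d) ∧ (a.IsW → V a.loc < G.ts a)

/-- The states reached after `n` steps of the simulation of a graph. -/
structure ViewInv (G : EGraph Tid Loc Val) (H : Event Tid Loc Val → Event Tid Loc Val → Prop)
    (T : Event Tid Loc Val → ℕ) (n : ℕ) (q : VState Tid Loc Val) : Prop where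
  msg : ∀ m ∈ q.mem, m.view m.loc = m.ts ∧ ∃ w ∈ G.E, w.IsW ∧ T w ≤ n ∧ m.loc = w.loc ∧
    some m.val = w.valW ∧ m.ts = G.ts w ∧ ∀ a, H w a → ViewOk G m.view a
  mem : ∀ w ∈ G.E, w.IsW → T w ≤ n → ∃ m ∈ q.mem, m.loc = w.loc ∧ m.ts = G.ts w
  thread : ∀ τ b a, Proper G.E b → b.tid = some τ → n < T b → (b = a ∨ H b a) →
    ViewOk G (q.tview τ) a

variable {G : EGraph Tid Loc Val} {H : Event Tid Loc Val → Event Tid Loc Val → Prop}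
  {T : Event Tid Loc Val → ℕ} {n : ℕ} {q : VState Tid Loc Val}

theorem ViewOk.congr {V V' : View Loc} {a : Event Tid Loc Val} (h : ViewOk G V a)
    (hV : V' a.loc ≤ V a.loc) : ViewOk G V' a :=
  ⟨fun d hd => hV.trans (h.1 d hd), fun hW => hV.trans_lt (h.2 hW)⟩

/-- No event is executed at step `n`, and the view of at most one thread changes. -/
theorem ViewInv.silent [DecidableEq Tid] (h : ViewInv G H T n q)
    (hn : ∀ e, Proper G.E e → T e ≠ n + 1) (hpos : Schedule G.E T) {τ : Tid} {V : View Loc}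
    (hV : ∀ b a, Proper G.E b → b.tid = some τ → n + 1 < T b → (b = a ∨ H b a) → ViewOk G V a) :
    ViewInv G H T (n + 1) ⟨q.mem, Function.update q.tview τ V⟩ := by
  refine ⟨fun m hm => ?_, fun w hw hW hTw => ?_, fun τ' b a hb hτ hTb hba => ?_⟩
  · obtain ⟨h3, w', h4, h5, h6, h7⟩ := h.msg m hm
    exact ⟨h3, w', h4, h5, by omega, h7⟩
  · refine h.mem w hw hW ?_
    by_contra hc
    exact hn w (hpos.proper_of_pos hw (by omega)) (by omega)
  · by_cases hττ : τ' = τ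
    · subst hττ
      simpa using hV b a hb hτ hTb hba
    · simpa [hττ] using h.thread τ' b a hb hτ (by omega) hba

theorem ViewInv.stay (h : ViewInv G H T n q) (hn : ∀ e, Proper G.E e → T e ≠ n + 1)
    (hpos : Schedule G.E T) : ViewInv G H T (n + 1) q := by
  refine ⟨fun m hm => ?_, fun w hw hW hTw => ?_, fun τ' b a hb hτ hTb hba => ?_⟩
  · obtain ⟨h3, w', h4, h5, h6, h7⟩ := h.msg m hm
    exact ⟨h3, w', h4, h5, by omega, h7⟩
  · refine h.mem w hw hW ?_
    by_contra hc
    exact hn w (hpos.proper_of_pos hw (by omega)) (by omega)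
  · exact h.thread τ' b a hb hτ (by omega) hba

/-- The assumptions under which a graph is simulated by a view-based system: `H` is the order along
which views are propagated, and `T` is a schedule of the events. -/
structure ViewPlan (G : EGraph Tid Loc Val) (upd : View Loc → Msg Loc Val → View Loc)
    (H : Event Tid Loc Val → Event Tid Loc Val → Prop) (T : Event Tid Loc Val → ℕ)
    [DecidableEq Loc] : Prop where
  fair : G.Fair
  sched : Schedule G.E T
  po_le : ∀ a b, G.po a b → H a b
  trans : ∀ a b c, H a b → H b c → H a c
  proper : ∀ a b, H a b → Proper G.E b
  acyclic : ClosureIrrefl fun a b => (H a b ∧ a.loc = b.loc) ∨ G.rf a b ∨ G.mo a b ∨ G.fr a b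
  mono : ∀ a b, H a b → T a < T b
  mono_rf : ∀ a b, G.rf a b → T a < T b
  upd : (upd = fun V m => V ⊔ m.view) ∧ (∀ a b, G.rf a b → H a b) ∨
    upd = fun V m => Function.update V m.loc m.ts

variable [DecidableEq Loc] {upd : View Loc → Msg Loc Val → View Loc}

theorem ViewPlan.scPerLoc (K : ViewPlan G upd H T) : G.SCPerLoc :=
  K.acyclic.mono fun a b h => h.imp_left fun h => ⟨K.po_le a b h.1, h.2⟩

theorem ViewPlan.irrefl (K : ViewPlan G upd H T) (a : Event Tid Loc Val) : ¬ H a a :=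
  fun h => lt_irrefl _ (K.mono a a h)

/-- An event that comes later in `H` than a write to the same location may still be executed after
the timestamp of the write has been observed. -/
theorem ViewPlan.ok_of_write (K : ViewPlan G upd H T) {e a : Event Tid Loc Val} (he : e ∈ G.E)
    (heW : e.IsW) (h : H e a) (hl : e.loc = a.loc) :
    (∀ d, G.rf d a → G.ts e ≤ G.ts d) ∧ (a.IsW → G.ts e < G.ts a) := by
  have hea : e ≠ a := by
    rintro rfl
    exact K.irrefl e h
  constructor
  · intro d hd
    obtain ⟨h1, h2, h3, -⟩ := G.rf_match d a hd
    refine EGraph.ts_le_of_not_mo K.fair.1 he (G.rf_mem d a hd).1 heW h1 (hl.trans h3.symm) ?_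
    intro hmo
    exact K.acyclic e (.tail (.single (Or.inl ⟨h, hl⟩))
      (Or.inr (Or.inr (Or.inr ⟨⟨d, hd, hmo⟩, fun hc => hea hc.1.symm⟩))))
  · intro haW
    refine EGraph.ts_lt K.fair.1 ((G.mo_total e he a (K.proper e a h).1 heW haW hl
      hea).resolve_right fun hmo => ?_)
    exact K.acyclic e (.tail (.single (Or.inl ⟨h, hl⟩)) (Or.inr (Or.inr (Or.inl hmo))))

/-- If `a` read or wrote before `d` in modification order, an `fr` or `mo` edge from `a` back to `d`
would close a cycle with `rf` and `H`. -/
theorem ViewPlan.ok_of_read (K : ViewPlan G upd H T) {d e a : Event Tid Loc Val} (hrf : G.rf d e)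
    (h : H e a) (hl : e.loc = a.loc) :
    (∀ d', G.rf d' a → G.ts d ≤ G.ts d') ∧ (a.IsW → G.ts d < G.ts a) := by
  obtain ⟨hdE, heE⟩ := G.rf_mem d e hrf
  obtain ⟨hdW, -, hdl, -⟩ := G.rf_match d e hrf
  have hcyc : Relation.TransGen
      (fun a b => (H a b ∧ a.loc = b.loc) ∨ G.rf a b ∨ G.mo a b ∨ G.fr a b) d a :=
    .tail (.single (Or.inr (Or.inl hrf))) (Or.inl ⟨h, hl⟩)
  have hda : d ≠ a := by
    rintro rfl
    exact K.acyclic d hcyc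
  constructor
  · intro d' hd
    obtain ⟨h1, h2, h3, -⟩ := G.rf_match d' a hd
    refine EGraph.ts_le_of_not_mo K.fair.1 hdE (G.rf_mem d' a hd).1 hdW h1
      ((hdl.trans hl).trans h3.symm) ?_
    intro hmo
    exact K.acyclic d (hcyc.tail
      (Or.inr (Or.inr (Or.inr ⟨⟨d', hd, hmo⟩, fun hc => hda hc.1.symm⟩))))
  · intro haW
    refine EGraph.ts_lt K.fair.1 ((G.mo_total d hdE a (K.proper e a h).1 hdW haW
      (hdl.trans hl) hda).resolve_right fun hmo => ?_)
    exact K.acyclic d (hcyc.tail (Or.inr (Or.inr (Or.inl hmo))))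

theorem ViewPlan.ok_update_write (K : ViewPlan G upd H T) {e a : Event Tid Loc Val} (he : e ∈ G.E)
    (heW : e.IsW) (h : H e a) {V : View Loc} (hV : ViewOk G V a) :
    ViewOk G (Function.update V e.loc (G.ts e)) a := by
  by_cases hl : a.loc = e.loc
  · obtain ⟨h1, h2⟩ := K.ok_of_write he heW h hl.symm
    unfold ViewOk
    rw [hl, Function.update_self]
    exact ⟨h1, h2⟩
  · exact hV.congr (by rw [Function.update_of_ne hl])

/-- Reading a message of `d`. -/
theorem ViewPlan.ok_upd (K : ViewPlan G upd H T) {d e a : Event Tid Loc Val} (hrf : G.rf d e)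
    (h : H e a) {V : View Loc} (hV : ViewOk G V a) {m : Msg Loc Val} (hloc : m.loc = e.loc)
    (hts : m.ts = G.ts d) (hview : m.view m.loc = m.ts) (hle : V e.loc ≤ G.ts d)
    (hm : ∀ a, H d a → ViewOk G m.view a) : ViewOk G (upd V m) a := by
  by_cases hl : a.loc = e.loc
  · have hval : upd V m a.loc = G.ts d := by
      rw [hl, ← hloc]
      rw [← hloc, ← hts] at hle
      rw [← hts]
      rcases K.upd with ⟨rfl, -⟩ | rfl
      · exact (advances_join V m hle hview).1
      · exact (advances_update V m hle hview).1
    obtain ⟨h1, h2⟩ := K.ok_of_read hrf h hl.symm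
    unfold ViewOk
    rw [hval]
    exact ⟨h1, h2⟩
  -- Away from the location read only the join changes the view. In that case `rf` is contained in
  -- `H`, so `a` is `H`-after `d` and the guarantee carried by the message of `d` applies to it.
  · rcases K.upd with ⟨rfl, hrfH⟩ | rfl
    · have hma := hm a (K.trans d e a (hrfH d e hrf) h)
      simp only [ViewOk, Pi.sup_apply]
      exact ⟨fun d' hd' => sup_le (hV.1 d' hd') (hma.1 d' hd'),
        fun hW => sup_lt_iff.2 ⟨hV.2 hW, hma.2 hW⟩⟩
    · refine hV.congr ?_
      change Function.update V m.loc m.ts a.loc ≤ V a.loc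
      rw [hloc, Function.update_of_ne hl]

theorem ViewPlan.ok_zero (K : ViewPlan G upd H T) {a : Event Tid Loc Val} (ha : Proper G.E a) :
    ViewOk G (fun _ => 0) a :=
  ⟨fun _ _ => Nat.zero_le _, fun hW => EGraph.ts_pos K.fair.1 K.scPerLoc ha hW⟩

theorem ViewInv.zero (K : ViewPlan G upd H T) : ViewInv G H T 0 viewInit := by
  refine ⟨?_, ?_, ?_⟩
  · rintro _ ⟨x, rfl⟩
    have hi : (⟨none, none, .write x 0⟩ : Event Tid Loc Val) ∈ Init Tid Loc Val := ⟨x, rfl⟩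
    refine ⟨rfl, _, G.wf.init_subset hi, isW_of_mem_Init hi, (K.sched.init _ hi).le, rfl, rfl,
      (EGraph.ts_init K.scPerLoc hi).symm, fun a ha => K.ok_zero (K.proper _ a ha)⟩
  · intro w hw hW hTw
    have hi : w ∈ Init Tid Loc Val := by
      by_contra hi
      have := K.sched.pos w ⟨hw, hi⟩
      omega
    exact ⟨_, ⟨w.loc, rfl⟩, rfl, (EGraph.ts_init K.scPerLoc hi).symm⟩
  · rintro τ b a hb - - h
    rcases h with rfl | h
    · exact K.ok_zero hb
    · exact K.ok_zero (K.proper b a h)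

theorem ViewInv.exists_msg (h : ViewInv G H T n q) (K : ViewPlan G upd H T)
    {w : Event Tid Loc Val} (hw : w ∈ G.E) (hW : w.IsW) (hT : T w ≤ n) :
    ∃ m ∈ q.mem, m.loc = w.loc ∧ some m.val = w.valW ∧ m.ts = G.ts w ∧ m.view m.loc = m.ts ∧
      ∀ a, H w a → ViewOk G m.view a := by
  obtain ⟨m, hm, h1, h2⟩ := h.mem w hw hW hT
  obtain ⟨h3, w', h4, h5, h6, h7, h8, h9, h10⟩ := h.msg m hm
  obtain rfl := EGraph.ts_inj K.fair.1 hw h4 hW h5 (h1.symm.trans h7) (h2.symm.trans h9)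
  exact ⟨m, hm, h1, h8, h2, h3, h10⟩

/-- The thread views after the execution of the event `e`. -/
theorem ViewInv.thread_step [DecidableEq Tid] (h : ViewInv G H T n q) (K : ViewPlan G upd H T)
    {e : Event Tid Loc Val} (he : Proper G.E e) (hTe : T e = n + 1) {τ : Tid}
    (hτ : e.tid = some τ) {V : View Loc} (hV : ∀ a, H e a → ViewOk G V a) :
    ∀ τ' b a, Proper G.E b → b.tid = some τ' → n + 1 < T b → (b = a ∨ H b a) →
      ViewOk G (Function.update q.tview τ V τ') a := by
  intro τ' b a hb hτ' hTb hba
  by_cases hττ : τ' = τ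
  · subst hττ
    rw [Function.update_self]
    have hs := K.sched.lt_of_same_thread G.wf he hb (hτ.trans hτ'.symm) (by omega)
    have heb := K.po_le e b ⟨he.1, hb.1, hs⟩
    rcases hba with rfl | hba
    · exact hV _ heb
    · exact hV _ (K.trans e b a heb hba)
  · rw [Function.update_of_ne hττ]
    exact h.thread τ' b a hb hτ' (by omega) hba

theorem ViewInv.read [DecidableEq Tid] (h : ViewInv G H T n q) (K : ViewPlan G upd H T)
    {e : Event Tid Loc Val} (he : Proper G.E e) (hTe : T e = n + 1) {τ : Tid}
    (hτ : e.tid = some τ) {V : View Loc} (hV : ∀ a, H e a → ViewOk G V a) (hW : ¬ e.IsW) :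
    ViewInv G H T (n + 1) ⟨q.mem, Function.update q.tview τ V⟩ := by
  refine ⟨fun m hm => ?_, fun w hw hW' hTw => ?_, h.thread_step K he hTe hτ hV⟩
  · obtain ⟨h3, w', h4, h5, h6, h7⟩ := h.msg m hm
    exact ⟨h3, w', h4, h5, by omega, h7⟩
  · refine h.mem w hw hW' ?_
    by_contra hc
    rw [K.sched.inj w e (K.sched.proper_of_pos hw (by omega)) he (by omega)] at hW'
    exact hW hW'

theorem ViewInv.write [DecidableEq Tid] (h : ViewInv G H T n q) (K : ViewPlan G upd H T)
    {e : Event Tid Loc Val} (he : Proper G.E e) (hTe : T e = n + 1) {τ : Tid}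
    (hτ : e.tid = some τ) {V : View Loc} (hV : ∀ a, H e a → ViewOk G V a) {v : Val}
    (hv : e.valW = some v) (hVx : V e.loc = G.ts e) :
    ViewInv G H T (n + 1)
      ⟨q.mem ∪ {⟨e.loc, v, G.ts e, V⟩}, Function.update q.tview τ V⟩ := by
  have hW : e.IsW := (ELab.isW_iff _).2 ⟨v, hv⟩
  refine ⟨?_, fun w hw hW' hTw => ?_, h.thread_step K he hTe hτ hV⟩
  · rintro m (hm | rfl)
    · obtain ⟨h3, w', h4, h5, h6, h7⟩ := h.msg m hm
      exact ⟨h3, w', h4, h5, by omega, h7⟩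
    · exact ⟨hVx, e, he.1, hW, hTe.le, rfl, hv.symm, rfl, hV⟩
  · by_cases hTw' : T w = n + 1
    · rw [K.sched.inj w e (K.sched.proper_of_pos hw (by omega)) he (by omega)]
      exact ⟨_, Or.inr rfl, rfl, rfl⟩
    · obtain ⟨m, hm, h1⟩ := h.mem w hw hW' (by omega)
      exact ⟨m, Or.inl hm, h1⟩

theorem ViewInv.fresh (h : ViewInv G H T n q) (K : ViewPlan G upd H T)
    {e : Event Tid Loc Val} (he : Proper G.E e) (hTe : T e = n + 1) (hW : e.IsW) :
    ¬ ∃ m ∈ q.mem, m.loc = e.loc ∧ m.ts = G.ts e := by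
  rintro ⟨m, hm, h1, h2⟩
  obtain ⟨h3, w', h4, h5, h6, h7, h8, h9, h10⟩ := h.msg m hm
  have := EGraph.ts_inj K.fair.1 he.1 h4 hW h5 (h1.symm.trans h7) (h2.symm.trans h9)
  subst this
  omega

variable [DecidableEq Tid]

/-- The thread invariant at `e` itself is the side condition of the step: the source is not older
than the view, and the timestamp to be written lies above it. For an update the intermediate view
equals the timestamp of the source, and `EGraph.ts_rmw` gives the increment. -/
theorem ViewInv.exists_event_step (h : ViewInv G H T n q) (K : ViewPlan G upd H T)
    {e : Event Tid Loc Val} (he : Proper G.E e) (hTe : T e = n + 1) {τ : Tid}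
    (hτ : e.tid = some τ) :
    ∃ q', viewStep upd q (Sum.inl (τ, e.lab)) q' ∧ ViewInv G H T (n + 1) q' := by
  have hok := h.thread τ e e he hτ (by omega) (Or.inl rfl)
  have hok' : ∀ a, H e a → ViewOk G (q.tview τ) a := fun a ha =>
    h.thread τ e a he hτ (by omega) (Or.inr ha)
  have hread : e.IsR → ∃ m ∈ q.mem, ∃ d, G.rf d e ∧ m.loc = e.loc ∧ some m.val = e.valR ∧
      q.tview τ e.loc ≤ m.ts ∧ m.ts = G.ts d ∧ upd (q.tview τ) m e.loc = m.ts ∧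
      ∀ a, H e a → ViewOk G (upd (q.tview τ) m) a := by
    intro hR
    obtain ⟨d, hd⟩ := G.rf_total e he.1 hR
    obtain ⟨hdW, -, hdl, hdv⟩ := G.rf_match d e hd
    have hTd := K.mono_rf d e hd
    obtain ⟨m, hm, h1, h2, h3, h4, h5⟩ := h.exists_msg K (G.rf_mem d e hd).1 hdW (by omega)
    have hle : q.tview τ e.loc ≤ G.ts d := hok.1 d hd
    refine ⟨m, hm, d, hd, h1.trans hdl, h2.trans hdv, hle.trans h3.ge, h3, ?_, fun a ha =>
      K.ok_upd hd ha (hok' a ha) (h1.trans hdl) h3 h4 hle h5⟩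
    rw [← hdl, ← h1, ← h3] at hle
    rw [← hdl, ← h1]
    rcases K.upd with ⟨rfl, -⟩ | rfl
    · exact (advances_join _ m hle h4).1
    · exact (advances_update _ m hle h4).1
  cases hlab : e.lab with
  | read x v =>
    obtain ⟨m, hm, d, hd, h1, h2, h3, h4, h5, h6⟩ := hread (by simp [Event.IsR, hlab, ELab.IsR])
    simp only [Event.loc, Event.valR, hlab, ELab.loc, ELab.valR, Option.some.injEq] at h1 h2 h3
    exact ⟨_, ⟨m, hm, h1, h2, h3, rfl⟩, h.read K he hTe hτ h6 (by simp [Event.IsW, hlab, ELab.IsW])⟩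
  | write x v =>
    have hW : e.IsW := by simp [Event.IsW, hlab, ELab.IsW]
    have hx : e.loc = x := by simp [Event.loc, hlab, ELab.loc]
    have hlt := hok.2 hW
    have hfresh := h.fresh K he hTe hW
    have hinv := h.write K he hTe hτ (V := Function.update (q.tview τ) e.loc (G.ts e))
      (fun a ha => K.ok_update_write he.1 hW ha (hok' a ha)) (v := v)
      (by simp [Event.valW, hlab, ELab.valW]) (by simp)
    rw [hx] at hlt hfresh hinv
    refine ⟨_, ⟨G.ts e, hfresh, hlt, rfl, ?_⟩, hinv⟩
    simp
  | rmw x v v' =>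
    have hW : e.IsW := by simp [Event.IsW, hlab, ELab.IsW]
    have hx : e.loc = x := by simp [Event.loc, hlab, ELab.loc]
    obtain ⟨m, hm, d, hd, h1, h2, h3, h4, h5, h6⟩ := hread (by simp [Event.IsR, hlab, ELab.IsR])
    simp only [Event.valR, hlab, ELab.valR, Option.some.injEq] at h2
    have hts := EGraph.ts_rmw K.fair.1 K.scPerLoc hd hW
    have hfresh := h.fresh K he hTe hW
    have hinv := h.write K he hTe hτ (V := Function.update (upd (q.tview τ) m) e.loc (G.ts e))
      (fun a ha => K.ok_update_write he.1 hW ha (h6 a ha)) (v := v')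
      (by simp [Event.valW, hlab, ELab.valW]) (by simp)
    rw [hx] at h1 h3 h5 hfresh hinv
    refine ⟨_, ⟨⟨q.mem, Function.update q.tview τ (upd (q.tview τ) m)⟩, ⟨m, hm, h1, h2, h3, rfl⟩,
      ⟨G.ts e, hfresh, ?_, ?_, ?_⟩, ?_⟩, hinv⟩
    · simp only [Function.update_self, h5]
      omega
    · simp
    · simp
    · simp only [Function.update_self, h5]
      omega

/-- Once `w` and all events that come before it in `fr` or `mo` have been executed, it may be
propagated to any thread. -/
theorem ViewInv.exists_prop_step (h : ViewInv G H T n q) (K : ViewPlan G upd H T)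
    (hn : ∀ e, Proper G.E e → T e ≠ n + 1) {w : Event Tid Loc Val} (hw : w ∈ G.E) (hW : w.IsW)
    (hTw : T w ≤ n) (hguard : ∀ a, G.fr a w ∨ G.mo a w → T a ≤ n) {τ : Tid}
    (hlt : q.tview τ w.loc < G.ts w) :
    ∃ m q', viewStep upd q (Sum.inr (τ, m)) q' ∧ ViewInv G H T (n + 1) q' ∧
      G.ts w ≤ q'.tview τ w.loc := by
  obtain ⟨m, hm, h1, h2⟩ := h.mem w hw hW hTw
  refine ⟨m, _, ⟨hm, by rw [h1, h2]; exact hlt, rfl⟩, h.silent hn K.sched ?_, ?_⟩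
  · intro b a hb hτ hTb hba
    have hold := h.thread τ b a hb hτ (by omega) hba
    have hTa : n < T a ∧ a ∈ G.E := by
      rcases hba with rfl | hba
      · exact ⟨by omega, hb.1⟩
      · have := K.mono b a hba
        exact ⟨by omega, (K.proper b a hba).1⟩
    have haw : a ≠ w := by
      rintro rfl
      omega
    -- The event `a` is still to be executed, so the guard excludes both `fr a w` and `mo a w`.
    -- Raising the view to the timestamp of `w` thus rules out neither the source of `a` nor the
    -- timestamp of `a`.
    by_cases hl : a.loc = w.loc
    · unfold ViewOk
      rw [h1, h2, hl, Function.update_self]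
      constructor
      · intro d hd
        obtain ⟨h3, h4, h5, -⟩ := G.rf_match d a hd
        refine EGraph.ts_le_of_not_mo K.fair.1 hw (G.rf_mem d a hd).1 hW h3
          (hl.symm.trans h5.symm) fun hmo => ?_
        have := hguard a (Or.inl ⟨⟨d, hd, hmo⟩, fun hc => haw hc.1⟩)
        omega
      · intro haW
        refine EGraph.ts_lt K.fair.1 ((G.mo_total w hw a hTa.2 hW haW hl.symm
          haw.symm).resolve_right fun hmo => ?_)
        have := hguard a (Or.inr hmo)
        omega
    · refine hold.congr ?_
      rw [h1, Function.update_of_ne hl]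
  · simp [h1, h2]

theorem exists_bound_of_finite {α : Type*} {s : Set α} (hs : s.Finite) (f : α → ℕ) :
    ∃ N, ∀ a ∈ s, f a ≤ N := by
  obtain ⟨N, hN⟩ := (hs.image f).bddAbove
  exact ⟨N, fun a ha => hN ⟨a, ha, rfl⟩⟩

/-- As positions are odd, events occupy only even steps. The odd step `2 * k + 1` tries to propagate
the write to the thread coded by the first component of `k.unpair`, so every pair is tried
infinitely often. Fairness of the graph makes the guard of each write hold from some step on. -/
theorem ViewPlan.mem_behMF [Finite Tid] (K : ViewPlan G upd H T)
    (hodd : ∀ e, Proper G.E e → Odd (T e))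
    {β : Behavior Tid Loc Val} (hβ : eventsOf β = G.E) :
    β ∈ BehMF (memView (Tid := Tid) upd) := by
  classical
  have := G.wf.countable_proper
  obtain ⟨c, hc⟩ := exists_injective_nat ({e // Proper G.E e} × Tid)
  rw [mem_BehMF_iff]
  obtain ⟨q, l, hrun, hinv, hl⟩ := (memView (Tid := Tid) upd).exists_stutterRun (ViewInv G H T)
    (fun n _ o q' => ObsSpec G.E T n o ∧ ∀ k τ w (hw : Proper G.E w), w.IsW → n = 2 * k + 1 →
      c (⟨w, hw⟩, τ) = k.unpair.1 → T w ≤ n → (∀ a, G.fr a w ∨ G.mo a w → T a ≤ n) →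
      G.ts w ≤ q'.tview τ w.loc) (ViewInv.zero K) (by
      intro n q hq
      by_cases hex : ∃ e, Proper G.E e ∧ T e = n + 1
      · obtain ⟨e, he, hTe⟩ := hex
        obtain ⟨τ, k, hτ, -⟩ := G.wf.exists_tid_sn he
        obtain ⟨q', h1, h2⟩ := hq.exists_event_step K he hTe hτ
        refine ⟨_, q', ⟨ObsSpec.of_event K.sched he hTe hτ, ?_⟩, h1, h2⟩
        rintro k - - - - rfl
        obtain ⟨j, hj⟩ := hodd e he
        omega
      · have hex' : ∀ e, Proper G.E e → T e ≠ n + 1 := fun e he hTe => hex ⟨e, he, hTe⟩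
        by_cases hprop : ∃ k τ w, ∃ hw : Proper G.E w, w.IsW ∧ n = 2 * k + 1 ∧
            c (⟨w, hw⟩, τ) = k.unpair.1 ∧ T w ≤ n ∧ (∀ a, G.fr a w ∨ G.mo a w → T a ≤ n) ∧
            q.tview τ w.loc < G.ts w
        · obtain ⟨k, τ, w, hw, hW, hn, hcode, hTw, hguard, hlt⟩ := hprop
          obtain ⟨m, q', h1, h2, h3⟩ := hq.exists_prop_step K hex' hw.1 hW hTw hguard hlt
          refine ⟨some (Sum.inr (τ, m)), q', ⟨ObsSpec.of_no_event (by simp) hex', ?_⟩, h1, h2⟩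
          intro k' τ' w' hw' _ hn' hcode' _ _
          have hk : k' = k := by omega
          subst hk
          have := hc (hcode'.trans hcode.symm)
          simp only [Prod.mk.injEq, Subtype.mk.injEq] at this
          obtain ⟨rfl, rfl⟩ := this
          exact h3
        · refine ⟨none, q, ⟨ObsSpec.of_no_event (by simp) hex', ?_⟩, rfl, hq.stay hex' K.sched⟩
          intro k τ w hw hW hn hcode hTw hguard
          by_contra hlt
          exact hprop ⟨k, τ, w, hw, hW, hn, hcode, hTw, hguard, not_le.1 hlt⟩)
  refine ⟨q, l, hrun, Or.inr fun θ k hk => ?_, ?_⟩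
  -- No silent label stays enabled forever: a successful try lifts the view of the thread to the
  -- timestamp of the message.
  · exfalso
    obtain ⟨τ, m⟩ := θ
    obtain ⟨_, hm, hlt, -⟩ := hk k le_rfl
    obtain ⟨-, w, hwE, hW, hTw, h1, -, h2, -⟩ := (hinv k).msg m hm
    have hw : Proper G.E w := by
      refine ⟨hwE, fun hi => ?_⟩
      rw [h2, EGraph.ts_init K.scPerLoc hi] at hlt
      omega
    obtain ⟨N, hN⟩ := exists_bound_of_finite ((K.fair.2 w hwE).union (K.fair.1 w hwE)) T
    -- The first component selects the pair `(w, τ)`; the second makes the try late enough to come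
    -- after step `k` and after all `fr`- and `mo`-predecessors of `w`.
    let j := Nat.pair (c (⟨w, hw⟩, τ)) (max N k)
    have hj : max N k ≤ j := Nat.right_le_pair _ _
    have h3 : G.ts w ≤ (q (2 * j + 1 + 1)).tview τ w.loc :=
      (hl (2 * j + 1)).2 j τ w hw hW rfl (by simp [j]) (by omega) fun a ha => by
        have := hN a ha
        omega
    obtain ⟨_, -, hlt', -⟩ := hk (2 * j + 1 + 1) (by omega)
    rw [h1, h2] at hlt'
    omega
  · have hl' : ∀ n, ObsSpec G.E T n (l n) := fun n => (hl n).1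
    have hT := K.sched
    rw [← hβ] at hT hl'
    exact hT.isBehavior hl'

end ViewGraphToRun

/-! ### Schedules along happens-before, and behaviors of RA and StrongCOH graphs as behaviors of
runs -/

section ViewDecl

variable {Tid : Type*} {Loc : Type*} {Val : Type*} [Zero Val]

theorem EGraph.hbRA_proper {G : EGraph Tid Loc Val} {a b : Event Tid Loc Val} (h : G.hbRA a b) :
    Proper G.E b := by
  have : ∀ a b, (G.po a b ∨ G.rf a b) → Proper G.E b := by
    rintro a b (h | h)
    · exact ⟨h.2.1, h.2.2.not_init⟩
    · exact EGraph.proper_of_isR (G.rf_mem a b h).2 (G.rf_match a b h).2.1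
  cases h with
  | single h => exact this _ _ h
  | tail _ h => exact this _ _ h

variable [Finite Tid]

/-- If happens-before is acyclic, there is a schedule compatible with it; it uses only odd
positions. -/
theorem EGraph.exists_schedule_hbRA (G : EGraph Tid Loc Val) (h : ∀ a, ¬ G.hbRA a a) :
    ∃ T, Schedule G.E T ∧ (∀ e, Proper G.E e → Odd (T e)) ∧ ∀ a b, G.hbRA a b → T a < T b := by
  obtain ⟨f, hf, hfR⟩ := G.wf.exists_enumeration (fun a b => G.po a b ∨ G.rf a b)
    (G.wf.wellFounded_of_closureIrrefl (fun _ => ()) h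
      fun a b ha hb _ h => Or.inl ⟨ha.1, hb.1, h⟩)
    (by
      intro b hb
      refine ((G.wf.finite_seqBefore b).union (G.finite_rf b)).subset ?_
      rintro a ⟨ha, h | h⟩
      · exact Or.inl ⟨ha, h.2.2⟩
      · exact Or.inr h)
  obtain ⟨T, hT, hTf⟩ := exists_schedule_of_enumeration (E := G.E) (f := fun e => 2 * f e)
    (fun a b ha hb hab => hf a b ha hb (by simpa using hab))
    fun a b ha hb h => by
      have := hfR a b ha hb (Or.inl ⟨ha.1, hb.1, h⟩)
      omega
  refine ⟨T, hT, fun e he => ⟨f e, hTf e he⟩, ?_⟩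
  have hstep : ∀ a b, (G.po a b ∨ G.rf a b) → T a < T b := by
    intro a b hab
    have hb := EGraph.hbRA_proper (.single hab)
    by_cases hi : a ∈ Init Tid Loc Val
    · rw [hT.init a hi]
      exact hT.pos b hb
    · have ha : Proper G.E a := by
        rcases hab with h | h
        · exact ⟨h.1, hi⟩
        · exact ⟨(G.rf_mem a b h).1, hi⟩
      rw [hTf a ha, hTf b hb]
      have := hfR a b ha hb hab
      omega
  intro a b hab
  induction hab with
  | single h => exact hstep _ _ h
  | tail _ h ih => exact ih.trans (hstep _ _ h)

variable [DecidableEq Tid] [DecidableEq Loc]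

theorem ra_behDecl_subset :
    BehDecl (graphsRA Tid Loc Val ∩ graphsFair Tid Loc Val) ⊆ BehMF (memRA Tid Loc Val) := by
  rintro β ⟨G, ⟨hG, hfair⟩, hβ⟩
  obtain ⟨T, hT, hodd, hmono⟩ := G.exists_schedule_hbRA fun a ha =>
    hG a (.single (Or.inl ⟨ha, rfl⟩))
  have K : ViewPlan G (fun V m => V ⊔ m.view) G.hbRA T :=
    { fair := hfair
      sched := hT
      po_le := fun a b h => .single (Or.inl h)
      trans := fun a b c h h' => h.trans h'
      proper := fun a b h => EGraph.hbRA_proper h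
      acyclic := hG
      mono := hmono
      mono_rf := fun a b h => hmono a b (.single (Or.inr h))
      upd := Or.inl ⟨rfl, fun a b h => .single (Or.inr h)⟩ }
  exact K.mem_behMF hodd hβ

/-- Views are propagated along `po` only, but the schedule follows all of happens-before: a read
needs the message of its source to be in memory already. -/
theorem strongCOH_behDecl_subset :
    BehDecl (graphsStrongCOH Tid Loc Val ∩ graphsFair Tid Loc Val) ⊆
      BehMF (memStrongCOH Tid Loc Val) := by
  rintro β ⟨G, ⟨⟨hhb, hG⟩, hfair⟩, hβ⟩
  obtain ⟨T, hT, hodd, hmono⟩ := G.exists_schedule_hbRA hhb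
  have K : ViewPlan G (fun V m => Function.update V m.loc m.ts) G.po T :=
    { fair := hfair
      sched := hT
      po_le := fun a b h => h
      trans := fun a b c h h' => ⟨h.1, h'.2.1, h.2.2.trans h'.2.2⟩
      proper := fun a b h => ⟨h.2.1, h.2.2.not_init⟩
      acyclic := hG
      mono := fun a b h => hmono a b (.single (Or.inl h))
      mono_rf := fun a b h => hmono a b (.single (Or.inr h))
      upd := Or.inr rfl }
  exact K.mem_behMF hodd hβ

end ViewDecl

end FairMM

theorem theorem4p3 {Tid : Type*} {Loc : Type*} {Val : Type*}
    [Finite Tid] [DecidableEq Tid] [DecidableEq Loc] [Zero Val] :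
    FairMM.BehMF (FairMM.memSC Tid Loc Val) =
        FairMM.BehDecl (FairMM.graphsSC Tid Loc Val ∩ FairMM.graphsFair Tid Loc Val) ∧
      FairMM.BehMF (FairMM.memTSO Tid Loc Val) =
        FairMM.BehDecl (FairMM.graphsTSO Tid Loc Val ∩ FairMM.graphsFair Tid Loc Val) ∧
      FairMM.BehMF (FairMM.memRA Tid Loc Val) =
        FairMM.BehDecl (FairMM.graphsRA Tid Loc Val ∩ FairMM.graphsFair Tid Loc Val) ∧
      FairMM.BehMF (FairMM.memStrongCOH Tid Loc Val) =
        FairMM.BehDecl (FairMM.graphsStrongCOH Tid Loc Val ∩ FairMM.graphsFair Tid Loc Val) :=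
  ⟨FairMM.sc_behMF_subset.antisymm FairMM.sc_behDecl_subset,
    FairMM.tso_behMF_subset.antisymm FairMM.tso_behDecl_subset,
    FairMM.ra_behMF_subset.antisymm FairMM.ra_behDecl_subset,
    FairMM.strongCOH_behMF_subset.antisymm FairMM.strongCOH_behDecl_subset⟩
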